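/- All graphs are finite, simple and undirected. A \emph{drawing} of a graph represents its vertices by distinct points of the plane and each edge by a simple curve between its endpoints, such that an edge contains no vertices other than its own endpoints and no three edges meet at a common point other than a common endpoint. A \emph{crossing} is a point of intersection of two edges other than a common endpoint; the \emph{crossing number} $\mathrm{cr}(G)$ is the minimum number of crossings in a drawing of $G$, and a graph is \emph{planar} if it has a drawing without crossings. A \emph{decomposition} of a graph $G$ is a graph $D$ together with a set of vertices of $G$ (a \emph{bag}) for each vertex of $D$, distinct vertices of $D$ being allowed to have equal bags, such that (a) for each $v\in V(G)$, the subgraph $D(v)$ of $D$ induced by the vertices of $D$ whose bags contain $v$ is nonempty and connected, and (b) for each edge $vw$ of $G$, $D(v)$ and $D(w)$ share a vertex or are joined by an edge of $D$. Its \emph{width} is the maximum cardinality of a bag, its \emph{order} is $|V(D)|$, and it is \emph{planar} if $D$ is planar. \textbf{Theorem.} Let $\Delta$ be an integer and let $\mathcal{G}$ be a family of graphs, each with maximum degree at most $\Delta$. The following are equivalent: \begin{enumerate} \item there is a constant $c_1$ such that $\mathrm{cr}(G)\le c_1|V(G)|$ for every $G\in\mathcal{G}$; \item there is a constant $c_2$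 such that every $G\in\mathcal{G}$ has a planar decomposition of width at most $c_2$ and order exactly $|V(G)|$; \item there is a constant $c_3$ such that every $G\in\mathcal{G}$ has a planar decomposition of width at most $2$ and order at most $c_3|V(G)|$. \end{enumerate} -/

import Mathlib

open scoped NNReal ENNReal

namespace SimpleGraph

/-- A drawing of a graph in the plane: vertices are distinct points, each edge is (the image of) a
simple curve between its endpoints, an edge contains no vertices but its endpoints, and three
distinct edges meet only at a common endpoint. -/
structure Drawing {V : Type*} (G : SimpleGraph V) where
  point : V → EuclideanSpace ℝ (Fin 2)
  point_injective : Function.Injective point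
  arc : G.edgeSet → Set (EuclideanSpace ℝ (Fin 2))
  arc_simple : ∀ (v w : V) (h : G.Adj v w), ∃ γ : _root_.Path (point v) (point w),
    Function.Injective γ ∧ Set.range γ = arc ⟨s(v, w), h⟩
  mem_of_point_mem_arc : ∀ (e : G.edgeSet) (v : V), point v ∈ arc e → v ∈ (e : Sym2 V)
  no_three : ∀ e f g : G.edgeSet, e ≠ f → e ≠ g → f ≠ g →
    ∀ p ∈ arc e ∩ arc f ∩ arc g,
      ∃ v : V, p = point v ∧ v ∈ (e : Sym2 V) ∧ v ∈ (f : Sym2 V) ∧ v ∈ (g : Sym2 V)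

/-- The crossings of a drawing: the points common to two distinct edges, other than a common
endpoint. -/
def Drawing.crossings {V : Type*} {G : SimpleGraph V} (φ : G.Drawing) :
    Set (EuclideanSpace ℝ (Fin 2)) :=
  {p | ∃ e f : G.edgeSet, e ≠ f ∧ p ∈ φ.arc e ∧ p ∈ φ.arc f ∧
    ¬ ∃ v : V, p = φ.point v ∧ v ∈ (e : Sym2 V) ∧ v ∈ (f : Sym2 V)}

/-- The crossing number: the minimum number of crossings in a drawing. -/
noncomputable def crossingNumber {V : Type*} (G : SimpleGraph V) : ℕ∞ :=
  ⨅ φ : G.Drawing, φ.crossings.encard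

/-- A graph is planar if it has a drawing without crossings. -/
def IsPlanar {V : Type*} (G : SimpleGraph V) : Prop :=
  ∃ φ : G.Drawing, φ.crossings = ∅

/-- A decomposition of `G`: a finite graph each of whose nodes carries a set of vertices of `G`
(its bag; distinct nodes may carry the same bag), such that the nodes whose bags contain a given
vertex induce a nonempty connected subgraph, and such that for adjacent vertices of `G` these
subgraphs touch. -/
structure Decomposition {V : Type*} (G : SimpleGraph V) where
  Node : Type
  [fintypeNode : Fintype Node]
  graph : SimpleGraph Node
  bag : Node → Finset V
  connected : ∀ v : V, (graph.induce {x | v ∈ bag x}).Connected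
  touch : ∀ v w : V, G.Adj v w →
    ∃ x y : Node, v ∈ bag x ∧ w ∈ bag y ∧ (x = y ∨ graph.Adj x y)

/-- The width: the maximum cardinality of a bag (`0` if there are no bags). -/
def Decomposition.width {V : Type*} {G : SimpleGraph V} (D : G.Decomposition) : ℕ :=
  letI := D.fintypeNode
  Finset.univ.sup fun x => (D.bag x).card

/-- The order: the number of bags, counted with multiplicity. -/
def Decomposition.order {V : Type*} {G : SimpleGraph V} (D : G.Decomposition) : ℕ :=
  letI := D.fintypeNode
  Fintype.card D.Node

/-- A decomposition is planar if its underlying graph is planar. -/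
def Decomposition.Planar {V : Type*} {G : SimpleGraph V} (D : G.Decomposition) : Prop :=
  D.graph.IsPlanar

end SimpleGraph

/-! From few crossings to decompositions: turn every crossing of an optimal drawing into a node.
This planarization has one node per vertex and per crossing. Orient each edge; the node of a vertex
`v` gets the bag `{v}`, and a crossing gets the tails of the two edges through it. The nodes
containing `v` then form the edges leaving `v`, each without its last node, so they are connected,
and the last piece of an edge joins the set of its tail to the node of its head. The width is at
most two and the order linear (`Drawing.exists_decomposition`).

To reach order exactly `|V|`, use that the planarization has bounded degree. Its nodes split into
connected classes of bounded size, each of which has at least `M` nodes or is a whole component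
(`exists_connected_partition`). For suitable `M` at most `|V|` classes are large; contract them and
merge their bags. Each small component becomes a single bag, stored at an index belonging to one of
its vertices (`Decomposition.exists_compressed`). Planarity survives because contracting connected
sets preserves it (`IsPlanar.of_connected_fibers`), which reduces to contracting one edge
(`IsPlanar.contract_edge`).

From decompositions to few crossings: draw the decomposition graph with small disks as nodes and
polygonal lines as edges. Route each edge of the graph through disks whose bags contain one of its
ends, and along the lines between them, different edges running as parallel strands. Strands do not
cross, so crossings occur only inside disks. At most `k * Δ` edges use a disk, and each of them has
at most two segments there, so a disk contributes at most `(k * Δ * 2) ^ 2` crossings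
(`Decomposition.crossingNumber_le`).

The topology is reduced to finitely many segments. `exists_polyPlan` replaces arcs by polygonal
lines, `PolyPlan.eventually_disjoint` keeps parallel strands apart for small offsets, and
`exists_drawing_of_routes` perturbs the end points into general position, so that only the pairs of
segments that meet need to be counted. Edge contraction uses the same apparatus: edges at the
removed vertex follow the contracted edge as strands, ordered so that they fan out without crossing.
-/

/-- The Euclidean plane. -/
abbrev Plane := EuclideanSpace ℝ (Fin 2)

/-! ### Arcs, segments and general position -/

namespace Plane

/-- The determinant of two plane vectors. -/
def det (a b : Plane) : ℝ := a 0 * b 1 - a 1 * b 0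

/-- `S` is a simple arc from `a` to `b`. -/
def IsArc (a b : Plane) (S : Set Plane) : Prop :=
  ∃ γ : _root_.Path a b, Function.Injective γ ∧ Set.range γ = S

theorem IsArc.symm {a b : Plane} {S : Set Plane} (h : IsArc a b S) : IsArc b a S := by
  obtain ⟨γ, hi, hr⟩ := h
  refine ⟨γ.symm, ?_, by rw [Path.symm_range, hr]⟩
  intro s t hst
  have := hi hst
  simpa using this

theorem IsArc.trans {a b c : Plane} {S T : Set Plane} (hS : IsArc a b S) (hT : IsArc b c T)
    (hST : S ∩ T ⊆ {b}) : IsArc a c (S ∪ T) := by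
  obtain ⟨γ, hi, rfl⟩ := hS
  obtain ⟨δ, hj, rfl⟩ := hT
  refine ⟨γ.trans δ, ?_, Path.trans_range _ _⟩
  -- A point reached in both halves is `b`, which the second path visits only at its start, that is
  -- at time `1 / 2`, already assigned to the first half.
  have key : ∀ s t : unitInterval, (s : ℝ) ≤ 1 / 2 → ¬ (t : ℝ) ≤ 1 / 2 →
      (γ.trans δ) s ≠ (γ.trans δ) t := by
    intro s t hs ht h
    rw [Path.trans_apply, Path.trans_apply, dif_pos hs, dif_neg ht] at h
    have h1 : δ ⟨2 * t - 1, unitInterval.two_mul_sub_one_mem_iff.2 ⟨(not_le.1 ht).le, t.2.2⟩⟩ = b :=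
      hST ⟨h ▸ ⟨_, rfl⟩, ⟨_, rfl⟩⟩
    have h2 := congrArg Subtype.val (hj (h1.trans δ.source.symm))
    simp only [Set.Icc.coe_zero] at h2
    push Not at ht
    linarith
  intro s t hst
  by_cases hs : (s : ℝ) ≤ 1 / 2 <;> by_cases ht : (t : ℝ) ≤ 1 / 2
  · rw [Path.trans_apply, Path.trans_apply, dif_pos hs, dif_pos ht] at hst
    have := congrArg Subtype.val (hi hst)
    simp only at this
    exact Subtype.ext (by linarith)
  · exact (key s t hs ht hst).elim
  · exact (key t s ht hs hst.symm).elim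
  · rw [Path.trans_apply, Path.trans_apply, dif_neg hs, dif_neg ht] at hst
    have := congrArg Subtype.val (hj hst)
    simp only at this
    exact Subtype.ext (by linarith)

theorem isArc_segment {a b : Plane} (hab : a ≠ b) : IsArc a b (segment ℝ a b) := by
  refine ⟨⟨⟨fun t => AffineMap.lineMap a b (t : ℝ), ?_⟩, by simp, by simp⟩, ?_, ?_⟩
  · exact AffineMap.lineMap_continuous.comp continuous_subtype_val
  · intro s t h
    exact Subtype.ext (AffineMap.lineMap_injective ℝ hab h)
  · rw [segment_eq_image_lineMap]
    ext z
    constructor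
    · rintro ⟨t, rfl⟩
      exact ⟨t, t.2, rfl⟩
    · rintro ⟨t, ht, rfl⟩
      exact ⟨⟨t, ht⟩, rfl⟩

/-- Disjointness of two segments is an open condition on their end points. -/
theorem isOpen_disjoint_segment :
    IsOpen {q : Plane × Plane × Plane × Plane |
      Disjoint (segment ℝ q.1 q.2.1) (segment ℝ q.2.2.1 q.2.2.2)} := by
  rw [← isClosed_compl_iff]
  -- Meeting is a closed condition on the end points together with the two parameters, and
  -- projecting away the compact parameter square keeps it closed.
  have hc : IsClosed {x : (unitInterval × unitInterval) × (Plane × Plane × Plane × Plane) |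
      AffineMap.lineMap x.2.1 x.2.2.1 (x.1.1 : ℝ)
        = (AffineMap.lineMap x.2.2.2.1 x.2.2.2.2 (x.1.2 : ℝ) : Plane)} := by
    apply isClosed_eq <;> simp only [AffineMap.lineMap_apply_module] <;> fun_prop
  convert isClosedMap_snd_of_compactSpace _ hc using 1
  ext q
  simp only [Set.mem_compl_iff, Set.mem_ofPred_eq, Set.not_disjoint_iff, segment_eq_image_lineMap,
    Set.mem_image]
  constructor
  · rintro ⟨z, ⟨s, hs, rfl⟩, t, ht, h⟩
    exact ⟨((⟨s, hs⟩, ⟨t, ht⟩), q), h.symm, rfl⟩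
  · rintro ⟨⟨⟨s, t⟩, q'⟩, h, rfl⟩
    exact ⟨_, ⟨s, s.2, rfl⟩, t, t.2, h.symm⟩

theorem eventually_disjoint_segment {X : Type*} [TopologicalSpace X] {x₀ : X}
    {a b c d : X → Plane} (ha : ContinuousAt a x₀) (hb : ContinuousAt b x₀)
    (hc : ContinuousAt c x₀) (hd : ContinuousAt d x₀)
    (h : Disjoint (segment ℝ (a x₀) (b x₀)) (segment ℝ (c x₀) (d x₀))) :
    ∀ᶠ x in nhds x₀, Disjoint (segment ℝ (a x) (b x)) (segment ℝ (c x) (d x)) :=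
  (ha.prodMk (hb.prodMk (hc.prodMk hd))).eventually (isOpen_disjoint_segment.mem_nhds h)

/-- Three points are collinear iff this vanishes. -/
def orient (a b c : Plane) : ℝ := (b 0 - a 0) * (c 1 - a 1) - (b 1 - a 1) * (c 0 - a 0)

/-- The determinant of the three lines `ab`, `cd` and `ef`. -/
def lineDet (a b c d e f : Plane) : ℝ :=
  (a 1 - b 1) * ((d 0 - c 0) * (e 0 * f 1 - e 1 * f 0) - (f 0 - e 0) * (c 0 * d 1 - c 1 * d 0))
  - (b 0 - a 0) * ((c 1 - d 1) * (e 0 * f 1 - e 1 * f 0) - (e 1 - f 1) * (c 0 * d 1 - c 1 * d 0))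
  + (a 0 * b 1 - a 1 * b 0) * ((c 1 - d 1) * (f 0 - e 0) - (e 1 - f 1) * (d 0 - c 0))

theorem exists_of_mem_segment {a b z : Plane} (h : z ∈ segment ℝ a b) :
    ∃ t : ℝ, 0 ≤ t ∧ t ≤ 1 ∧ z 0 = a 0 + t * (b 0 - a 0) ∧ z 1 = a 1 + t * (b 1 - a 1) := by
  rw [segment_eq_image_lineMap] at h
  obtain ⟨t, ht, rfl⟩ := h
  refine ⟨t, ht.1, ht.2, ?_, ?_⟩ <;> simp [AffineMap.lineMap_apply] <;> ring

theorem orient_eq_zero_of_mem_segment {a b z : Plane} (h : z ∈ segment ℝ a b) :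
    orient a b z = 0 := by
  obtain ⟨t, -, -, h0, h1⟩ := exists_of_mem_segment h
  rw [orient, h0, h1]
  ring

/-- The vector `(z 0, z 1, 1)` lies in the kernel of the matrix of the three line equations. The
coefficients below are the cofactors of its last column. -/
theorem lineDet_eq_zero {a b c d e f z : Plane} (h₁ : z ∈ segment ℝ a b) (h₂ : z ∈ segment ℝ c d)
    (h₃ : z ∈ segment ℝ e f) : lineDet a b c d e f = 0 := by
  have k₁ := orient_eq_zero_of_mem_segment h₁
  have k₂ := orient_eq_zero_of_mem_segment h₂
  have k₃ := orient_eq_zero_of_mem_segment h₃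
  simp only [orient, lineDet] at *
  linear_combination ((c 1 - d 1) * (f 0 - e 0) - (e 1 - f 1) * (d 0 - c 0)) * k₁
    - ((a 1 - b 1) * (f 0 - e 0) - (e 1 - f 1) * (b 0 - a 0)) * k₂
    + ((a 1 - b 1) * (d 0 - c 0) - (c 1 - d 1) * (b 0 - a 0)) * k₃

theorem ext_coord {a b : Plane} (h0 : a 0 = b 0) (h1 : a 1 = b 1) : a = b := by
  ext i
  fin_cases i
  · exact h0
  · exact h1

/-- Two segments with a common end point and independent directions meet only there. -/
theorem eq_of_mem_segment_of_mem_segment {a b c z : Plane} (h : orient a b c ≠ 0)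
    (h₁ : z ∈ segment ℝ a b) (h₂ : z ∈ segment ℝ a c) : z = a := by
  obtain ⟨s, -, -, hs0, hs1⟩ := exists_of_mem_segment h₁
  obtain ⟨t, -, -, ht0, ht1⟩ := exists_of_mem_segment h₂
  have key : s * orient a b c = 0 := by
    rw [orient]
    linear_combination (c 1 - a 1) * (ht0 - hs0) - (c 0 - a 0) * (ht1 - hs1)
  have hs : s = 0 := (mul_eq_zero.1 key).resolve_right h
  subst hs
  exact ext_coord (by linarith) (by linarith)

/-- Two segments, not on a common line, meet in at most one point. -/
theorem eq_of_mem_segments {a b c d z w : Plane} (h : orient a b c ≠ 0)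
    (hz : z ∈ segment ℝ a b) (hz' : z ∈ segment ℝ c d) (hw : w ∈ segment ℝ a b)
    (hw' : w ∈ segment ℝ c d) : z = w := by
  obtain ⟨s, -, -, hs0, hs1⟩ := exists_of_mem_segment hz
  obtain ⟨t, -, -, ht0, ht1⟩ := exists_of_mem_segment hz'
  obtain ⟨s', -, -, hs0', hs1'⟩ := exists_of_mem_segment hw
  obtain ⟨t', -, -, ht0', ht1'⟩ := exists_of_mem_segment hw'
  have e1 : orient a b c + t * ((b 0 - a 0) * (d 1 - c 1) - (b 1 - a 1) * (d 0 - c 0)) = 0 := by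
    rw [orient]
    linear_combination (b 0 - a 0) * (hs1 - ht1) - (b 1 - a 1) * (hs0 - ht0)
  have e2 : orient a b c + t' * ((b 0 - a 0) * (d 1 - c 1) - (b 1 - a 1) * (d 0 - c 0)) = 0 := by
    rw [orient]
    linear_combination (b 0 - a 0) * (hs1' - ht1') - (b 1 - a 1) * (hs0' - ht0')
  have e3 : (t - t') * ((b 0 - a 0) * (d 1 - c 1) - (b 1 - a 1) * (d 0 - c 0)) = 0 := by
    linear_combination e1 - e2
  have htt : t = t' := by
    rcases mul_eq_zero.1 e3 with e | e
    · linarith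
    · rw [e, mul_zero, add_zero] at e1
      exact (h e1).elim
  subst htt
  exact ext_coord (by linarith) (by linarith)

/-- An analytic function that vanishes near `q` vanishes on every line through `q`, in particular at
a configuration where it is known to be nonzero. Hence a single good configuration makes the good
ones dense. -/
theorem dense_ne_zero {ι : Type*} [Finite ι] (F : (ι → Plane) → ℝ)
    (hF : ∀ q r : ι → Plane, AnalyticOnNhd ℝ (fun s : ℝ => F (q + s • (r - q))) Set.univ)
    (h : ∃ q, F q ≠ 0) : Dense {q | F q ≠ 0} := by
  obtain ⟨r, hr⟩ := h
  intro q
  rw [mem_closure_iff_frequently]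
  intro hev
  have hcont : Filter.Tendsto (fun s : ℝ => q + s • (r - q)) (nhds 0) (nhds q) := by
    have : Continuous (fun s : ℝ => q + s • (r - q)) := by fun_prop
    simpa using this.tendsto 0
  have h0 := hcont.eventually hev
  have h1 := (hF q r).eqOn_zero_of_preconnected_of_eventuallyEq_zero isPreconnected_univ
    (Set.mem_univ 0) (by filter_upwards [h0] with s hs; simpa using hs)
  exact hr (by simpa using h1 (Set.mem_univ 1))

/-- A family of points in general position: the points are distinct, no three of them are
collinear, and no three of the lines through disjoint pairs are concurrent. -/
structure GeneralPosition {ι : Type*} (q : ι → Plane) : Prop where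
  injective : Function.Injective q
  orient_ne : ∀ a b c, a ≠ b → a ≠ c → b ≠ c → orient (q a) (q b) (q c) ≠ 0
  lineDet_ne : ∀ a b c d e f, a ≠ b → c ≠ d → e ≠ f → a ≠ c → a ≠ d → b ≠ c → b ≠ d →
    a ≠ e → a ≠ f → b ≠ e → b ≠ f → c ≠ e → c ≠ f → d ≠ e → d ≠ f →
    lineDet (q a) (q b) (q c) (q d) (q e) (q f) ≠ 0

/-- Each forbidden coincidence is the zero set of a polynomial that is nonzero somewhere, so its
complement is open and dense, and finitely many such sets meet inside any nonempty open set. -/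
theorem exists_generalPosition {ι : Type*} [Finite ι] (U : Set (ι → Plane)) (hU : IsOpen U)
    (hne : U.Nonempty) : ∃ q ∈ U, GeneralPosition q := by
  classical
  have d1 : Dense (⋂ x : {x : ι × ι // x.1 ≠ x.2},
      {q : ι → Plane | (q x.1.1 0 - q x.1.2 0) ^ 2 + (q x.1.1 1 - q x.1.2 1) ^ 2 ≠ 0}) := by
    apply dense_iInter_of_isOpen
    · intro x
      exact isOpen_ne_fun (by fun_prop) (by fun_prop)
    · rintro ⟨⟨a, b⟩, hab⟩
      apply dense_ne_zero
      · intro q r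
        simp only [Pi.add_apply, Pi.smul_apply, Pi.sub_apply, PiLp.add_apply, PiLp.smul_apply,
          PiLp.sub_apply, smul_eq_mul]
        intro s _
        fun_prop
      · refine ⟨fun w => if w = a then !₂[0, 0] else !₂[1, 0], ?_⟩
        have := Ne.symm hab
        simp_all
  have d2 : Dense (⋂ x : {x : ι × ι × ι // x.1 ≠ x.2.1 ∧ x.1 ≠ x.2.2 ∧ x.2.1 ≠ x.2.2},
      {q : ι → Plane | orient (q x.1.1) (q x.1.2.1) (q x.1.2.2) ≠ 0}) := by
    apply dense_iInter_of_isOpen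
    · intro x
      exact isOpen_ne_fun (by unfold orient; fun_prop) (by fun_prop)
    · rintro ⟨⟨a, b, c⟩, hab, hac, hbc⟩
      apply dense_ne_zero
      · intro q r
        simp only [orient, Pi.add_apply, Pi.smul_apply, Pi.sub_apply, PiLp.add_apply,
          PiLp.smul_apply, PiLp.sub_apply, smul_eq_mul]
        intro s _
        fun_prop
      · refine ⟨fun w => if w = a then !₂[0, 0] else if w = b then !₂[1, 0] else !₂[0, 1], ?_⟩
        have := Ne.symm hab
        have := Ne.symm hac
        have := Ne.symm hbc
        simp_all [orient]
  have d3 : Dense (⋂ x : {x : ι × ι × ι × ι × ι × ι // x.1 ≠ x.2.1 ∧ x.2.2.1 ≠ x.2.2.2.1 ∧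
        x.2.2.2.2.1 ≠ x.2.2.2.2.2 ∧ x.1 ≠ x.2.2.1 ∧ x.1 ≠ x.2.2.2.1 ∧ x.2.1 ≠ x.2.2.1 ∧
        x.2.1 ≠ x.2.2.2.1 ∧ x.1 ≠ x.2.2.2.2.1 ∧ x.1 ≠ x.2.2.2.2.2 ∧ x.2.1 ≠ x.2.2.2.2.1 ∧
        x.2.1 ≠ x.2.2.2.2.2 ∧ x.2.2.1 ≠ x.2.2.2.2.1 ∧ x.2.2.1 ≠ x.2.2.2.2.2 ∧
        x.2.2.2.1 ≠ x.2.2.2.2.1 ∧ x.2.2.2.1 ≠ x.2.2.2.2.2},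
      {q : ι → Plane | lineDet (q x.1.1) (q x.1.2.1) (q x.1.2.2.1) (q x.1.2.2.2.1)
        (q x.1.2.2.2.2.1) (q x.1.2.2.2.2.2) ≠ 0}) := by
    apply dense_iInter_of_isOpen
    · intro x
      exact isOpen_ne_fun (by unfold lineDet; fun_prop) (by fun_prop)
    · rintro ⟨⟨a, b, c, d, e, f⟩, h1, h2, h3, h4, h5, h6, h7, h8, h9, h10, h11, h12, h13, h14, h15⟩
      apply dense_ne_zero
      · intro q r
        simp only [lineDet, Pi.add_apply, Pi.smul_apply, Pi.sub_apply, PiLp.add_apply,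
          PiLp.smul_apply, PiLp.sub_apply, smul_eq_mul]
        intro s _
        fun_prop
      -- The three lines are the two axes and `x + y = 5`, which misses the origin.
      · refine ⟨fun w => if w = a then !₂[0, 0] else if w = b then !₂[1, 0] else
          if w = c then !₂[0, 1] else if w = d then !₂[0, 2] else
          if w = e then !₂[2, 3] else !₂[3, 2], ?_⟩
        simp only at h1 h2 h3 h4 h5 h6 h7 h8 h9 h10 h11 h12 h13 h14 h15
        have ha : ∀ {x y : ι} {p r : Plane}, x ≠ y → (if y = x then p else r) = r := by
          intro x y p r h
          rw [if_neg h.symm]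
        simp only [lineDet, if_true, ha h1, ha h2, ha h3, ha h4, ha h5, ha h6, ha h7, ha h8, ha h9,
          ha h10, ha h11, ha h12, ha h13, ha h14, ha h15]
        norm_num
  have o1 : IsOpen (⋂ x : {x : ι × ι // x.1 ≠ x.2},
      {q : ι → Plane | (q x.1.1 0 - q x.1.2 0) ^ 2 + (q x.1.1 1 - q x.1.2 1) ^ 2 ≠ 0}) := by
    apply isOpen_iInter_of_finite
    intro x
    exact isOpen_ne_fun (by fun_prop) (by fun_prop)
  have o2 : IsOpen (⋂ x : {x : ι × ι × ι // x.1 ≠ x.2.1 ∧ x.1 ≠ x.2.2 ∧ x.2.1 ≠ x.2.2},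
      {q : ι → Plane | orient (q x.1.1) (q x.1.2.1) (q x.1.2.2) ≠ 0}) := by
    apply isOpen_iInter_of_finite
    intro x
    exact isOpen_ne_fun (by unfold orient; fun_prop) (by fun_prop)
  obtain ⟨q₁, hU₁, h₁⟩ := d1.inter_open_nonempty U hU hne
  obtain ⟨q₂, ⟨hU₂, h₂⟩, h₂'⟩ := d2.inter_open_nonempty _ (hU.inter o1) ⟨q₁, hU₁, h₁⟩
  obtain ⟨q, ⟨⟨hq, hq1⟩, hq2⟩, hq3⟩ :=
    d3.inter_open_nonempty _ ((hU.inter o1).inter o2) ⟨q₂, ⟨hU₂, h₂⟩, h₂'⟩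
  rw [Set.mem_iInter] at hq1 hq2 hq3
  refine ⟨q, hq, ⟨?_, ?_, ?_⟩⟩
  · intro a b hab
    by_contra hne
    exact hq1 ⟨(a, b), hne⟩ (by simp [hab])
  · intro a b c h1 h2 h3
    exact hq2 ⟨(a, b, c), h1, h2, h3⟩
  · intro a b c d e f h1 h2 h3 h4 h5 h6 h7 h8 h9 h10 h11 h12 h13 h14 h15
    exact hq3 ⟨(a, b, c, d, e, f), h1, h2, h3, h4, h5, h6, h7, h8, h9, h10, h11, h12, h13, h14, h15⟩

end Plane

/-! ### Drawings whose edges are routed along segments -/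

namespace Plane

/-- The segment spanned by an unordered pair of indices of points. -/
def seg {W : Type*} (pos : W → Plane) (s : Sym2 W) : Set Plane :=
  Sym2.lift ⟨fun a b => segment ℝ (pos a) (pos b), fun _ _ => segment_symm ℝ _ _⟩ s

@[simp] theorem seg_mk {W : Type*} (pos : W → Plane) (a b : W) :
    seg pos s(a, b) = segment ℝ (pos a) (pos b) := rfl

/-- Two distinct segments with a common end point meet only there, in general position. -/
theorem GeneralPosition.eq_of_common {W : Type*} {pos : W → Plane} (hg : GeneralPosition pos)
    {s t : Sym2 W} (hs : ¬ s.IsDiag) (ht : ¬ t.IsDiag) (hst : s ≠ t) {w : W} (hws : w ∈ s)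
    (hwt : w ∈ t) {z : Plane} (hzs : z ∈ seg pos s) (hzt : z ∈ seg pos t) : z = pos w := by
  obtain ⟨a, rfl⟩ := hws
  obtain ⟨b, rfl⟩ := hwt
  have hab : a ≠ b := by rintro rfl; exact hst rfl
  exact eq_of_mem_segment_of_mem_segment (hg.orient_ne w a b (by simpa using hs)
    (by simpa using ht) hab) hzs hzt

/-- A point of the family on a segment is an end point of the segment. -/
theorem GeneralPosition.mem_of_pos_mem_seg {W : Type*} {pos : W → Plane}
    (hg : GeneralPosition pos) {s : Sym2 W} (hs : ¬ s.IsDiag) {w : W} (h : pos w ∈ seg pos s) :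
    w ∈ s := by
  induction s with | _ a b
  by_contra hw
  simp only [Sym2.mem_iff, not_or] at hw
  exact hg.orient_ne a b w (by simpa using hs) (Ne.symm hw.1) (Ne.symm hw.2)
    (orient_eq_zero_of_mem_segment h)

theorem GeneralPosition.eq_of_mem_seg {W : Type*} {pos : W → Plane}
    (hg : GeneralPosition pos) {s t : Sym2 W} (hs : ¬ s.IsDiag) (hst : ∀ w ∈ s, w ∉ t)
    {z z' : Plane} (h₁ : z ∈ seg pos s) (h₂ : z ∈ seg pos t) (h₁' : z' ∈ seg pos s)
    (h₂' : z' ∈ seg pos t) : z = z' := by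
  induction s with | _ a b
  induction t with | _ c d
  have ha := hst a (by simp)
  have hb := hst b (by simp)
  simp only [Sym2.mem_iff, not_or] at ha hb
  exact eq_of_mem_segments (hg.orient_ne a b c (by simpa using hs) ha.1 hb.1) h₁ h₂ h₁' h₂'

theorem GeneralPosition.not_concurrent {W : Type*} {pos : W → Plane}
    (hg : GeneralPosition pos) {s t r : Sym2 W} (hs : ¬ s.IsDiag) (ht : ¬ t.IsDiag)
    (hr : ¬ r.IsDiag) (hst : ∀ w ∈ s, w ∉ t) (hsr : ∀ w ∈ s, w ∉ r) (htr : ∀ w ∈ t, w ∉ r)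
    {z : Plane} (h₁ : z ∈ seg pos s) (h₂ : z ∈ seg pos t) (h₃ : z ∈ seg pos r) : False := by
  induction s with | _ a b
  induction t with | _ c d
  induction r with | _ e f
  have h1 := hst a (by simp)
  have h2 := hst b (by simp)
  have h3 := hsr a (by simp)
  have h4 := hsr b (by simp)
  have h5 := htr c (by simp)
  have h6 := htr d (by simp)
  simp only [Sym2.mem_iff, not_or] at h1 h2 h3 h4 h5 h6
  exact hg.lineDet_ne a b c d e f (by simpa using hs) (by simpa using ht) (by simpa using hr)
    h1.1 h1.2 h2.1 h2.2 h3.1 h3.2 h4.1 h4.2 h5.1 h5.2 h6.1 h6.2 (lineDet_eq_zero h₁ h₂ h₃)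

/-- A path of segments in general position whose segments without a common end point are disjoint
traces out a simple arc. -/
theorem GeneralPosition.isArc_walk {W : Type*} {pos : W → Plane} (hg : GeneralPosition pos)
    {S : SimpleGraph W} {u v : W} (p : S.Walk u v) (hp : p.IsPath) (huv : u ≠ v)
    (hd : ∀ s ∈ p.edges, ∀ t ∈ p.edges, (∀ w ∈ s, w ∉ t) → Disjoint (seg pos s) (seg pos t)) :
    IsArc (pos u) (pos v) (⋃ s ∈ p.edges, seg pos s) := by
  induction p with
  | nil => exact (huv rfl).elim
  | @cons u x v h p ih =>
    rw [SimpleGraph.Walk.cons_isPath_iff] at hp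
    have hux : pos u ≠ pos x := fun e => h.ne (hg.injective e)
    by_cases hxv : x = v
    · subst hxv
      rw [SimpleGraph.Walk.isPath_iff_nil] at hp
      rw [hp.1.eq_nil]
      simpa using isArc_segment hux
    · have ih' := ih hp.1 hxv (fun s hs t ht => hd s (by simp [hs]) t (by simp [ht]))
      have := (isArc_segment hux).trans ih' ?_
      · convert this using 1
        simp
      · rintro z ⟨hz1, hz2⟩
        simp only [Set.mem_iUnion] at hz2
        obtain ⟨t, ht, hzt⟩ := hz2
        have hut : u ∉ t := fun hut => hp.2 (p.mem_support_of_mem_edges ht hut)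
        have htd : ¬ t.IsDiag := S.not_isDiag_of_mem_edgeSet (p.edges_subset_edgeSet ht)
        by_cases hxt : x ∈ t
        · refine hg.eq_of_common (s := s(u, x)) (by simpa using h.ne) htd ?_ (by simp) hxt hz1 hzt
          rintro rfl
          exact hut (by simp)
        · exfalso
          refine Set.disjoint_left.1 (hd s(u, x) (by simp) t (by simp [ht]) ?_) hz1 hzt
          intro w hw
          rcases Sym2.mem_iff.1 hw with rfl | rfl <;> assumption

/-- A graph whose edges are routed along paths of segments can be drawn with at most as many
crossings as there are pairs of segments, of different edges and without a common end point, that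
meet; here the points spanning the segments need not be in general position. -/
theorem exists_drawing_of_routes {V W : Type*} [Finite W] (G : SimpleGraph V)
    (emb : V → W) (hemb : Function.Injective emb) (S : G.edgeSet → SimpleGraph W)
    (a b : G.edgeSet → V) (hab : ∀ g : G.edgeSet, (g : Sym2 V) = s(a g, b g))
    (P : ∀ g, (S g).Walk (emb (a g)) (emb (b g))) (hP : ∀ g, (P g).IsPath)
    (hself : ∀ g v, emb v ∈ (P g).support → v ∈ (g : Sym2 V))
    (hpriv : ∀ g h, g ≠ h → ∀ w, w ∈ (P g).support → w ∈ (P h).support → ∃ v, w = emb v)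
    (pos₀ : W → Plane)
    (hdisj : ∀ g, ∀ s ∈ (P g).edges, ∀ t ∈ (P g).edges, (∀ w ∈ s, w ∉ t) →
      Disjoint (seg pos₀ s) (seg pos₀ t)) :
    ∃ φ : G.Drawing, φ.crossings.encard ≤ {q : Sym2 W × Sym2 W | ∃ g h, g ≠ h ∧
      q.1 ∈ (P g).edges ∧ q.2 ∈ (P h).edges ∧ (∀ w ∈ q.1, w ∉ q.2) ∧
      ¬ Disjoint (seg pos₀ q.1) (seg pos₀ q.2)}.encard := by
  -- Every disjointness that holds at `pos₀` survives small perturbations, so the points can be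
  -- moved into general position without creating new meetings.
  have hopen : IsOpen (⋂ x : {x : Sym2 W × Sym2 W // Disjoint (seg pos₀ x.1) (seg pos₀ x.2)},
      {pos : W → Plane | Disjoint (seg pos x.1.1) (seg pos x.1.2)}) := by
    apply isOpen_iInter_of_finite
    rintro ⟨⟨s, t⟩, -⟩
    induction s with | _ a b
    induction t with | _ c d
    have : Continuous fun pos : W → Plane => (pos a, pos b, pos c, pos d) := by fun_prop
    exact isOpen_disjoint_segment.preimage this
  obtain ⟨pos, hpos, hg⟩ := exists_generalPosition _ hopen
    ⟨pos₀, Set.mem_iInter.2 fun x => x.2⟩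
  replace hpos : ∀ s t, Disjoint (seg pos₀ s) (seg pos₀ t) → Disjoint (seg pos s) (seg pos t) :=
    fun s t h => Set.mem_iInter.1 hpos ⟨(s, t), h⟩
  have hne : ∀ g, emb (a g) ≠ emb (b g) := by
    intro g e
    have := G.not_isDiag_of_mem_edgeSet g.2
    rw [hab] at this
    exact this (hemb e)
  have hdiag : ∀ g, ∀ s ∈ (P g).edges, ¬ s.IsDiag := fun g s hs =>
    (S g).not_isDiag_of_mem_edgeSet ((P g).edges_subset_edgeSet hs)
  have harc : ∀ g, IsArc (pos (emb (a g))) (pos (emb (b g))) (⋃ s ∈ (P g).edges, seg pos s) :=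
    fun g => hg.isArc_walk (P g) (hP g) (hne g)
      (fun s hs t ht h => hpos s t (hdisj g s hs t ht h))
  have hmem : ∀ (g : G.edgeSet) (v : V), pos (emb v) ∈ (⋃ s ∈ (P g).edges, seg pos s) →
      v ∈ (g : Sym2 V) := by
    intro g v hv
    simp only [Set.mem_iUnion] at hv
    obtain ⟨s, hs, hv⟩ := hv
    exact hself g v ((P g).mem_support_of_mem_edges hs (hg.mem_of_pos_mem_seg (hdiag g s hs) hv))
  -- A segment end shared by two routes is a vertex, and two distinct segments in general position
  -- meet only there. If the segments coincided, both their ends would be vertices and the two edges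
  -- would be equal.
  have hcommon : ∀ g h, g ≠ h → ∀ s ∈ (P g).edges, ∀ t ∈ (P h).edges, ∀ w ∈ s, w ∈ t →
      ∀ z ∈ seg pos s, z ∈ seg pos t → ∃ v, z = pos (emb v) ∧ v ∈ (g : Sym2 V) ∧
        v ∈ (h : Sym2 V) := by
    intro g h hgh s hs t ht w hws hwt z hzs hzt
    have hws' := (P g).mem_support_of_mem_edges hs hws
    have hwt' := (P h).mem_support_of_mem_edges ht hwt
    obtain ⟨v, rfl⟩ := hpriv g h hgh w hws' hwt'
    refine ⟨v, ?_, hself g v hws', hself h v hwt'⟩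
    refine hg.eq_of_common (hdiag g s hs) (hdiag h t ht) ?_ hws hwt hzs hzt
    rintro rfl
    apply hgh
    obtain ⟨y, rfl⟩ := hws
    obtain ⟨v', rfl⟩ := hpriv g h hgh y ((P g).mem_support_of_mem_edges hs (by simp))
      ((P h).mem_support_of_mem_edges ht (by simp))
    have hvv : v ≠ v' := by
      rintro rfl
      exact hdiag g _ hs (by simp)
    have e1 : (g : Sym2 V) = s(v, v') := (Sym2.mem_and_mem_iff hvv).1 ⟨hself g v hws',
      hself g v' ((P g).mem_support_of_mem_edges hs (by simp))⟩
    have e2 : (h : Sym2 V) = s(v, v') := (Sym2.mem_and_mem_iff hvv).1 ⟨hself h v hwt',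
      hself h v' ((P h).mem_support_of_mem_edges ht (by simp))⟩
    exact Subtype.ext (e1.trans e2.symm)
  let φ : G.Drawing :=
    { point := fun v => pos (emb v)
      point_injective := hg.injective.comp hemb
      arc := fun g => ⋃ s ∈ (P g).edges, seg pos s
      arc_simple := by
        intro v w h
        have h1 := harc ⟨s(v, w), h⟩
        have h2 := hab ⟨s(v, w), h⟩
        generalize (⋃ s ∈ (P ⟨s(v, w), h⟩).edges, seg pos s) = T at h1 ⊢
        rcases Sym2.eq_iff.1 h2 with ⟨e1, e2⟩ | ⟨e1, e2⟩
        · rw [← e1, ← e2] at h1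
          exact h1
        · rw [← e1, ← e2] at h1
          exact h1.symm
      mem_of_point_mem_arc := hmem
      no_three := by
        rintro e f g hef heg hfg p ⟨⟨h1, h2⟩, h3⟩
        have h1' := h1
        have h2' := h2
        have h3' := h3
        simp only [Set.mem_iUnion] at h1 h2 h3
        obtain ⟨s, hs, hps⟩ := h1
        obtain ⟨t, ht, hpt⟩ := h2
        obtain ⟨r, hr, hpr⟩ := h3
        by_cases c1 : ∃ w ∈ s, w ∈ t
        · obtain ⟨w, hws, hwt⟩ := c1
          obtain ⟨v, rfl, hv1, hv2⟩ := hcommon e f hef s hs t ht w hws hwt p hps hpt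
          exact ⟨v, rfl, hv1, hv2, hmem g v h3'⟩
        by_cases c2 : ∃ w ∈ s, w ∈ r
        · obtain ⟨w, hws, hwt⟩ := c2
          obtain ⟨v, rfl, hv1, hv2⟩ := hcommon e g heg s hs r hr w hws hwt p hps hpr
          exact ⟨v, rfl, hv1, hmem f v h2', hv2⟩
        by_cases c3 : ∃ w ∈ t, w ∈ r
        · obtain ⟨w, hws, hwt⟩ := c3
          obtain ⟨v, rfl, hv1, hv2⟩ := hcommon f g hfg t ht r hr w hws hwt p hpt hpr
          exact ⟨v, rfl, hmem e v h1', hv1, hv2⟩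
        push Not at c1 c2 c3
        exact (hg.not_concurrent (hdiag e s hs) (hdiag f t ht) (hdiag g r hr) c1 c2 c3
          hps hpt hpr).elim }
  refine ⟨φ, ?_⟩
  have hcross : ∀ p ∈ φ.crossings, ∃ q : Sym2 W × Sym2 W, (∃ g h, g ≠ h ∧
      q.1 ∈ (P g).edges ∧ q.2 ∈ (P h).edges ∧ (∀ w ∈ q.1, w ∉ q.2) ∧
      ¬ Disjoint (seg pos₀ q.1) (seg pos₀ q.2)) ∧ p ∈ seg pos q.1 ∧ p ∈ seg pos q.2 := by
    rintro p ⟨g, h, hgh, h1, h2, hnot⟩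
    simp only [φ, Set.mem_iUnion] at h1 h2
    obtain ⟨s, hs, hps⟩ := h1
    obtain ⟨t, ht, hpt⟩ := h2
    refine ⟨(s, t), ⟨g, h, hgh, hs, ht, ?_, ?_⟩, hps, hpt⟩
    · intro w hws hwt
      exact hnot (hcommon g h hgh s hs t ht w hws hwt p hps hpt)
    · intro hd
      exact Set.disjoint_left.1 (hpos s t hd) hps hpt
  rcases φ.crossings.eq_empty_or_nonempty with h0 | ⟨p₀, hp₀⟩
  · simp [h0]
  have : Nonempty (Sym2 W × Sym2 W) := ⟨(hcross p₀ hp₀).choose⟩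
  -- Charge each crossing to a pair of segments through it. The charge is injective because two
  -- segments without a common end meet at most once in general position.
  choose! f hf1 hf2 hf3 using hcross
  refine Set.encard_le_encard_of_injOn (f := f) (fun p hp => hf1 p hp) ?_
  intro p hp p' hp' hpp
  obtain ⟨g, h, -, hs, -, hn, -⟩ := hf1 p hp
  have h2 := hf2 p' hp'
  have h3 := hf3 p' hp'
  rw [← hpp] at h2 h3
  exact hg.eq_of_mem_seg (hdiag g _ hs) hn (hf2 p hp) (hf3 p hp) h2 h3

end Plane

/-- A path uses at most two edges at each vertex. -/
theorem SimpleGraph.Walk.IsPath.length_filter_edges_le_two {V : Type*} [DecidableEq V]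
    {G : SimpleGraph V} {u v : V} {p : G.Walk u v} (hp : p.IsPath) (w : V) :
    (p.edges.filter (w ∈ ·)).length ≤ 2 := by
  -- The induction needs the sharper bound of one edge at the starting vertex, since prepending an
  -- edge adds a second one there.
  have key : ∀ {u v : V} {p : G.Walk u v}, p.IsPath →
      (p.edges.filter (w ∈ ·)).length ≤ (if w = u then 1 else 2) ∧
      (w ∉ p.support → (p.edges.filter (w ∈ ·)).length = 0) := by
    intro u v p hp
    refine ⟨?_, ?_⟩
    · induction p with
      | nil => simp
      | @cons u x v h p ih =>
        rw [SimpleGraph.Walk.cons_isPath_iff] at hp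
        have ih' := ih hp.1
        have h0 : w ∉ p.support → (p.edges.filter (w ∈ ·)).length = 0 := by
          intro hw
          simp only [List.length_eq_zero_iff, List.filter_eq_nil_iff, decide_eq_true_eq]
          exact fun e he hwe => hw (p.mem_support_of_mem_edges he hwe)
        rw [SimpleGraph.Walk.edges_cons, List.filter_cons]
        split_ifs with h1 h2 h2
        · subst h2
          simp [h0 hp.2]
        · have : w = x := by simpa [h2] using h1
          subst this
          simp only [if_true] at ih'
          simp only [List.length_cons]
          omega
        · subst h2
          simp at h1
        · split_ifs at ih' <;> omega
    · intro hw
      simp only [List.length_eq_zero_iff, List.filter_eq_nil_iff, decide_eq_true_eq]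
      exact fun e he hwe => hw (p.mem_support_of_mem_edges he hwe)
  have := (key hp).1
  split_ifs at this <;> omega

/-! ### Simple polygonal lines and pieces of arcs -/

namespace Plane

/-- The scalar product of two plane vectors. -/
def dot (a b : Plane) : ℝ := a 0 * b 0 + a 1 * b 1

theorem dot_self (a : Plane) : dot a a = ‖a‖ ^ 2 := by
  rw [EuclideanSpace.norm_sq_eq, Fin.sum_univ_two, dot]
  simp [sq]

theorem dot_smul_left (t : ℝ) (a b : Plane) : dot (t • a) b = t * dot a b := by
  simp [dot]; ring

theorem dot_smul_right (t : ℝ) (a b : Plane) : dot a (t • b) = t * dot a b := by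
  simp [dot]; ring

/-- `z 0, …, z n` is a polygonal line in `S`. -/
def PolyChain (S : Set Plane) (n : ℕ) (z : ℕ → Plane) : Prop :=
  ∀ i < n, segment ℝ (z i) (z (i + 1)) ⊆ S

theorem exists_polyChain {S : Set Plane} {a b : Plane}
    (h : Relation.ReflTransGen (fun p q => segment ℝ p q ⊆ S) a b) :
    ∃ n z, z 0 = a ∧ z n = b ∧ PolyChain S n z := by
  induction h with
  | refl => exact ⟨0, fun _ => a, rfl, rfl, fun i hi => (Nat.not_lt_zero i hi).elim⟩
  | @tail b c _ hbc ih =>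
    obtain ⟨n, z, h0, hn, hz⟩ := ih
    refine ⟨n + 1, fun i => if i ≤ n then z i else c, by simp [h0], by simp, ?_⟩
    intro i hi
    rcases Nat.lt_succ_iff_lt_or_eq.1 hi with h | rfl
    · simpa [h.le, Nat.succ_le_of_lt h] using hz i h
    · simpa [hn] using hbc

/-- Of three collinear points one lies between the other two, and each case is immediate. This
permits dropping a vertex at which a polygonal line does not turn. -/
theorem segment_subset_union_of_orient {a b c : Plane} (h : orient a b c = 0) :
    segment ℝ a c ⊆ segment ℝ a b ∪ segment ℝ b c := by
  have hcol : Collinear ℝ {a, b, c} := by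
    by_cases hab : a = b
    · subst hab
      simpa using collinear_pair ℝ a c
    · rw [collinear_iff_of_mem (p₀ := a) (by simp)]
      refine ⟨b - a, ?_⟩
      have hden : (b 0 - a 0) ^ 2 + (b 1 - a 1) ^ 2 ≠ 0 := by
        intro h0
        apply hab
        apply ext_coord <;> nlinarith [sq_nonneg (b 0 - a 0), sq_nonneg (b 1 - a 1)]
      intro p hp
      simp only [Set.mem_insert_iff, Set.mem_singleton_iff] at hp
      rcases hp with rfl | rfl | rfl
      · exact ⟨0, by simp⟩
      · exact ⟨1, by simp⟩
      · refine ⟨((b 0 - a 0) * (p 0 - a 0) + (b 1 - a 1) * (p 1 - a 1)) /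
          ((b 0 - a 0) ^ 2 + (b 1 - a 1) ^ 2), ?_⟩
        rw [orient] at h
        apply ext_coord
        · simp only [vadd_eq_add, PiLp.add_apply, PiLp.smul_apply, PiLp.sub_apply, smul_eq_mul]
          field_simp
          linear_combination (-(b 1 - a 1)) * h
        · simp only [vadd_eq_add, PiLp.add_apply, PiLp.smul_apply, PiLp.sub_apply, smul_eq_mul]
          field_simp
          linear_combination (b 0 - a 0) * h
  rcases hcol.wbtw_or_wbtw_or_wbtw with h | h | h
  · rw [← mem_segment_iff_wbtw, segment_eq_image_lineMap] at h
    obtain ⟨β, hβ, rfl⟩ := h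
    rw [segment_eq_image_lineMap]
    rintro _ ⟨τ, hτ, rfl⟩
    rcases le_total τ β with h | h
    · left
      have := image_segment ℝ (AffineMap.lineMap (k := ℝ) a c) 0 β
      rw [AffineMap.lineMap_apply_zero, segment_eq_Icc hβ.1] at this
      rw [← this]
      exact ⟨τ, ⟨hτ.1, h⟩, rfl⟩
    · right
      have := image_segment ℝ (AffineMap.lineMap (k := ℝ) a c) β 1
      rw [AffineMap.lineMap_apply_one, segment_eq_Icc hβ.2] at this
      rw [← this]
      exact ⟨τ, ⟨h, hτ.2⟩, rfl⟩
  · rw [← mem_segment_iff_wbtw, segment_symm] at h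
    exact ((convex_segment a b).segment_subset (left_mem_segment ℝ _ _) h).trans
      Set.subset_union_left
  · rw [← mem_segment_iff_wbtw, segment_symm] at h
    exact ((convex_segment b c).segment_subset h (right_mem_segment ℝ _ _)).trans
      Set.subset_union_right

/-- A polygonal line with the least number of segments is simple, and turns at each of its inner
vertices. -/
theorem exists_simple_polyChain {S : Set Plane} {a b : Plane} (hab : a ≠ b)
    (h : Relation.ReflTransGen (fun p q => segment ℝ p q ⊆ S) a b) :
    ∃ n z, 0 < n ∧ z 0 = a ∧ z n = b ∧ PolyChain S n z ∧ (∀ i < n, z i ≠ z (i + 1)) ∧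
      (∀ i j, i + 1 < j → j < n →
        Disjoint (segment ℝ (z i) (z (i + 1))) (segment ℝ (z j) (z (j + 1)))) ∧
      (∀ i, i + 1 < n → orient (z i) (z (i + 1)) (z (i + 2)) ≠ 0) := by
  classical
  have hex : ∃ n, ∃ z, z 0 = a ∧ z n = b ∧ PolyChain S n z := exists_polyChain h
  obtain ⟨z, h0, hn, hz⟩ := Nat.find_spec hex
  set n := Nat.find hex with hndef
  have hmin : ∀ m, m < n → ∀ z : ℕ → Plane, z 0 = a → z m = b → ¬ PolyChain S m z :=
    fun m hm z h1 h2 h3 => Nat.find_min hex hm ⟨z, h1, h2, h3⟩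
  have hpos : 0 < n := by
    rcases Nat.eq_zero_or_pos n with e | e
    · rw [e] at hn
      exact (hab (h0.symm.trans hn)).elim
    · exact e
  -- Without a turn at `z (i + 1)`, that vertex could be removed, contradicting minimality.
  have hturn : ∀ i, i + 1 < n → orient (z i) (z (i + 1)) (z (i + 2)) ≠ 0 := by
    intro i hi ho
    refine hmin (n - 1) (by omega) (fun k => if k ≤ i then z k else z (k + 1)) (by simp [h0]) ?_ ?_
    · rw [if_neg (by omega), Nat.sub_add_cancel hpos, hn]
    · intro k hk
      rcases lt_trichotomy k i with hki | rfl | hki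
      · simp only [hki.le, if_true, Nat.succ_le_of_lt hki]
        exact hz k (by omega)
      · simp only [le_refl, if_true, show ¬ k + 1 ≤ k by omega, if_false]
        exact (segment_subset_union_of_orient ho).trans
          (Set.union_subset (hz k (by omega)) (hz (k + 1) (by omega)))
      · simp only [show ¬ k ≤ i by omega, show ¬ k + 1 ≤ i by omega, if_false]
        exact hz (k + 1) (by omega)
  refine ⟨n, z, hpos, h0, hn, hz, ?_, ?_, hturn⟩
  · intro i hi e
    by_cases hi' : i + 1 < n
    · refine hturn i hi' ?_
      rw [e, orient]
      ring
    · rcases Nat.eq_zero_or_pos i with rfl | hi0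
      · have : n = 1 := by omega
        rw [this] at hn
        exact hab (h0.symm.trans (e.trans hn))
      · refine hturn (i - 1) (by omega) ?_
        rw [show i - 1 + 2 = i + 1 by omega, show i - 1 + 1 = i by omega, e, orient]
        ring
  · intro i j hij hj
    rw [Set.disjoint_left]
    intro w hw1 hw2
    -- If segments `i` and `j` share `w`, replace `z (i + 1), …, z j` by the single vertex `w`; this
    -- saves `j - i - 1 > 0` segments.
    refine hmin (n - (j - i - 1)) (by omega)
      (fun k => if k ≤ i then z k else if k = i + 1 then w else z (k + (j - i - 1)))
      (by simp [h0]) ?_ ?_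
    · rw [if_neg (by omega), if_neg (by omega), Nat.sub_add_cancel (by omega), hn]
    · intro k hk
      rcases lt_trichotomy k i with hki | rfl | hki
      · simp only [hki.le, if_true, Nat.succ_le_of_lt hki]
        exact hz k (by omega)
      · simp only [le_refl, if_true, show ¬ k + 1 ≤ k by omega, if_false]
        exact ((convex_segment _ _).segment_subset (left_mem_segment ℝ _ _) hw1).trans
          (hz k (by omega))
      · by_cases hk1 : k = i + 1
        · subst hk1
          simp only [show ¬ i + 1 ≤ i by omega, show ¬ i + 1 + 1 ≤ i by omega, if_false, if_true,
            show ¬ i + 1 + 1 = i + 1 by omega]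
          rw [show i + 1 + 1 + (j - i - 1) = j + 1 by omega]
          exact ((convex_segment _ _).segment_subset hw2 (right_mem_segment ℝ _ _)).trans
            (hz j (by omega))
        · simp only [show ¬ k ≤ i by omega, show ¬ k + 1 ≤ i by omega, hk1,
            show ¬ k + 1 = i + 1 by omega, if_false]
          rw [show k + 1 + (j - i - 1) = k + (j - i - 1) + 1 by omega]
          exact hz _ (by omega)

/-- Being joined by a polygonal line in the thickening is symmetric and transitive, and it holds
locally because balls are convex. Preconnectedness makes it global. -/
theorem reflTransGen_of_isPreconnected {M : Set Plane} (hM : IsPreconnected M) {δ : ℝ} (hδ : 0 < δ)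
    {a b : Plane} (ha : a ∈ M) (hb : b ∈ M) :
    Relation.ReflTransGen (fun p q => segment ℝ p q ⊆ Metric.thickening δ M) a b := by
  refine hM.induction₂ _ ?_ ?_ ?_ ha hb
  · intro x hx
    have : Metric.ball x δ ∈ nhdsWithin x M := mem_nhdsWithin_of_mem_nhds (Metric.ball_mem_nhds x hδ)
    filter_upwards [this] with y hy
    refine Relation.ReflTransGen.single ?_
    refine ((convex_ball x δ).segment_subset (Metric.mem_ball_self hδ) hy).trans ?_
    exact Metric.ball_subset_thickening hx δ
  · exact fun x y z hx hy hz => Relation.ReflTransGen.trans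
  · intro x y hx hy h
    have : Std.Symm (fun p q : Plane => segment ℝ p q ⊆ Metric.thickening δ M) :=
      ⟨fun p q h => by rwa [segment_symm]⟩
    exact Relation.ReflTransGen.stdSymm.symm _ _ h

/-- A simple arc contains a connected compact piece outside the open disks around its end points
that joins their boundaries. -/
theorem IsArc.exists_middle {c c' : Plane} {A : Set Plane} (hA : IsArc c c' A) {r : ℝ}
    (hr : 0 < r) (hcc : 2 * r < dist c c') :
    ∃ M ⊆ A, IsCompact M ∧ IsPreconnected M ∧ (∀ z ∈ M, r ≤ dist z c ∧ r ≤ dist z c') ∧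
      (∃ a ∈ M, dist a c = r) ∧ ∃ b ∈ M, dist b c' = r := by
  obtain ⟨γ, -, rfl⟩ := hA
  have hγ : Continuous γ.extend := γ.continuous_extend
  have h0 : γ.extend 0 = c := γ.extend_zero
  have h1 : γ.extend 1 = c' := γ.extend_one
  have hf : Continuous fun t => dist (γ.extend t) c := hγ.dist continuous_const
  have hf' : Continuous fun t => dist (γ.extend t) c' := hγ.dist continuous_const
  have hK : IsCompact {t | t ∈ Set.Icc (0 : ℝ) 1 ∧ dist (γ.extend t) c = r} :=
    isCompact_Icc.inter_right (isClosed_eq hf continuous_const)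
  have hKne : {t | t ∈ Set.Icc (0 : ℝ) 1 ∧ dist (γ.extend t) c = r}.Nonempty := by
    obtain ⟨t, ht, h⟩ := intermediate_value_Icc zero_le_one hf.continuousOn
      (show r ∈ Set.Icc _ _ by
        simp only [h0, h1, dist_self, dist_comm c' c]
        exact ⟨hr.le, by linarith⟩)
    exact ⟨t, ht, h⟩
  -- Cut at the last time on the circle around `c`; by the intermediate value theorem the arc does
  -- not enter that disk again.
  obtain ⟨s, ⟨hs, hsr⟩, hsmax⟩ := hK.exists_isGreatest hKne
  have hs' : ∀ t ∈ Set.Icc s 1, r ≤ dist (γ.extend t) c := by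
    intro t ht
    by_contra hlt
    push Not at hlt
    obtain ⟨t', ht', h⟩ := intermediate_value_Icc ht.2 hf.continuousOn
      (show r ∈ Set.Icc _ _ by
        simp only [h1, dist_comm c' c]
        exact ⟨hlt.le, by linarith⟩)
    have := hsmax ⟨⟨hs.1.trans (ht.1.trans ht'.1), ht'.2⟩, h⟩
    have : t = s := le_antisymm (ht'.1.trans this) ht.1
    subst this
    exact hlt.ne hsr
  have hsc' : r < dist (γ.extend s) c' := by
    have := dist_triangle c (γ.extend s) c'
    rw [dist_comm c (γ.extend s), hsr] at this
    linarith
  have hL : IsCompact {t | t ∈ Set.Icc s 1 ∧ dist (γ.extend t) c' = r} :=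
    isCompact_Icc.inter_right (isClosed_eq hf' continuous_const)
  have hLne : {t | t ∈ Set.Icc s 1 ∧ dist (γ.extend t) c' = r}.Nonempty := by
    obtain ⟨t, ht, h⟩ := intermediate_value_Icc' hs.2 hf'.continuousOn
      (show r ∈ Set.Icc _ _ by
        simp only [h1, dist_self]
        exact ⟨hr.le, hsc'.le⟩)
    exact ⟨t, ht, h⟩
  -- Likewise stop at the first time after `s` on the circle around `c'`.
  obtain ⟨t, ⟨ht, htr⟩, htmin⟩ := hL.exists_isLeast hLne
  have ht' : ∀ u ∈ Set.Icc s t, r ≤ dist (γ.extend u) c' := by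
    intro u hu
    by_contra hlt
    push Not at hlt
    obtain ⟨u', hu', h⟩ := intermediate_value_Icc' hu.1 hf'.continuousOn
      (show r ∈ Set.Icc _ _ from ⟨hlt.le, hsc'.le⟩)
    have := htmin ⟨⟨hu'.1, hu'.2.trans (hu.2.trans ht.2)⟩, h⟩
    have : u = t := le_antisymm hu.2 (this.trans hu'.2)
    subst this
    exact hlt.ne htr
  refine ⟨γ.extend '' Set.Icc s t, ?_, isCompact_Icc.image hγ,
    isPreconnected_Icc.image _ hγ.continuousOn, ?_, ?_, ?_⟩
  · rintro _ ⟨u, -, rfl⟩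
    rw [← γ.extend_range]
    exact ⟨u, rfl⟩
  · rintro _ ⟨u, hu, rfl⟩
    exact ⟨hs' u ⟨hu.1, hu.2.trans ht.2⟩, ht' u hu⟩
  · exact ⟨_, ⟨s, ⟨le_rfl, ht.1⟩, rfl⟩, hsr⟩
  · exact ⟨_, ⟨t, ⟨ht.1, le_rfl⟩, rfl⟩, htr⟩

end Plane

/-! ### From plane drawings to polygonal layouts -/

namespace Plane

/-- A polygonal layout of a graph: disjoint disks for the vertices, and for each edge a simple
polygonal line joining the boundaries of the disks of its ends; these lines are pairwise disjoint,
and leave the disks transversally. -/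
structure PolyPlan {N : Type*} (D : SimpleGraph N) where
  center : N → Plane
  R : ℝ
  R_pos : 0 < R
  tail : D.edgeSet → N
  head : D.edgeSet → N
  eq_mk : ∀ e : D.edgeSet, (e : Sym2 N) = s(tail e, head e)
  len : D.edgeSet → ℕ
  len_pos : ∀ e, 0 < len e
  p : D.edgeSet → ℕ → Plane
  disjoint_ball : ∀ x y, x ≠ y →
    Disjoint (Metric.closedBall (center x) R) (Metric.closedBall (center y) R)
  disjoint_edge : ∀ e f, e ≠ f → ∀ i < len e, ∀ j < len f,
    Disjoint (segment ℝ (p e i) (p e (i + 1))) (segment ℝ (p f j) (p f (j + 1)))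
  disjoint_nonadj : ∀ e i j, i + 1 < j → j < len e →
    Disjoint (segment ℝ (p e i) (p e (i + 1))) (segment ℝ (p e j) (p e (j + 1)))
  turn : ∀ e i, i + 1 < len e → orient (p e i) (p e (i + 1)) (p e (i + 2)) ≠ 0
  ne_succ : ∀ e, ∀ i < len e, p e i ≠ p e (i + 1)
  mem_ball : ∀ e, ∀ i < len e, ∀ x, ∀ z ∈ segment ℝ (p e i) (p e (i + 1)),
    z ∈ Metric.closedBall (center x) R → (x = tail e ∧ z = p e 0) ∨ (x = head e ∧ z = p e (len e))
  dist_tail : ∀ e, dist (p e 0) (center (tail e)) = R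
  dist_head : ∀ e, dist (p e (len e)) (center (head e)) = R
  out_tail : ∀ e, 0 < dot (p e 1 - p e 0) (p e 0 - center (tail e))
  out_head : ∀ e, 0 < dot (p e (len e - 1) - p e (len e)) (p e (len e) - center (head e))

theorem exists_of_mem_radial {c a z : Plane} {ρ : ℝ} (hρ : ρ ≤ 1)
    (h : z ∈ segment ℝ (c + ρ • (a - c)) a) :
    ∃ t, ρ ≤ t ∧ t ≤ 1 ∧ z = c + t • (a - c) := by
  rw [segment_eq_image_lineMap] at h
  obtain ⟨τ, hτ, rfl⟩ := h
  refine ⟨ρ + τ * (1 - ρ), by nlinarith [hτ.1], by nlinarith [hτ.2], ?_⟩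
  apply ext_coord <;> simp [AffineMap.lineMap_apply] <;> ring

theorem dist_radial (c a : Plane) {t : ℝ} (ht : 0 ≤ t) : dist (c + t • (a - c)) c = t * dist a c := by
  rw [dist_eq_norm, add_sub_cancel_left, norm_smul, Real.norm_of_nonneg ht, dist_eq_norm]

/-- A segment that starts along a ray from `c` leaves disks around `c` transversally. -/
theorem dot_pos_of_radial {c a q : Plane} {ρ r' : ℝ} (hρ : 0 < ρ) (hac : a ≠ c)
    (hq : c + ρ • (a - c) ≠ q) (hr' : dist (c + ρ • (a - c)) c < r')
    (h : ∀ z ∈ segment ℝ (c + ρ • (a - c)) q, dist z c < r' → ∃ t, ρ ≤ t ∧ z = c + t • (a - c)) :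
    0 < dot (q - (c + ρ • (a - c))) (c + ρ • (a - c) - c) := by
  set p := c + ρ • (a - c) with hp
  have hcont : Continuous fun τ : ℝ => dist (AffineMap.lineMap p q τ) c :=
    AffineMap.lineMap_continuous.dist continuous_const
  have h1 : ∀ᶠ τ in nhdsWithin (0 : ℝ) (Set.Ioi 0), dist (AffineMap.lineMap p q τ) c < r' := by
    apply Filter.Eventually.filter_mono nhdsWithin_le_nhds
    apply hcont.continuousAt.eventually_lt continuousAt_const
    simpa using hr'
  have h2 : ∀ᶠ τ in nhdsWithin (0 : ℝ) (Set.Ioi 0), τ ∈ Set.Ioo (0 : ℝ) 1 :=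
    Ioo_mem_nhdsGT one_pos
  obtain ⟨τ, hτ1, hτ2⟩ := (h1.and h2).exists
  obtain ⟨t, ht, hz⟩ := h (AffineMap.lineMap p q τ)
    (by rw [segment_eq_image_lineMap]; exact ⟨τ, ⟨hτ2.1.le, hτ2.2.le⟩, rfl⟩) hτ1
  -- For small `τ` the point is still near `c`, hence on the ray, so `q - p` is a positive multiple
  -- of the radial direction.
  have e : τ • (q - p) = (t - ρ) • (a - c) := by
    have : AffineMap.lineMap p q τ = p + τ • (q - p) := by
      rw [AffineMap.lineMap_apply, vsub_eq_sub, vadd_eq_add, add_comm]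
    have h4 : τ • (q - p) = c + t • (a - c) - p := by
      rw [← hz, this]
      abel
    rw [h4, hp, sub_smul]
    abel
  have htρ : t ≠ ρ := by
    rintro rfl
    rw [sub_self, zero_smul, smul_eq_zero, sub_eq_zero] at e
    rcases e with e | e
    · exact hτ2.1.ne' e
    · exact hq e.symm
  have e2 : τ * dot (q - p) (p - c) = (t - ρ) * (ρ * ‖a - c‖ ^ 2) := by
    rw [← dot_smul_left, e, dot_smul_left, hp, add_sub_cancel_left, dot_smul_right, dot_self]
  have h5 : 0 < (t - ρ) * (ρ * ‖a - c‖ ^ 2) := by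
    have : 0 < ‖a - c‖ := norm_pos_iff.2 (sub_ne_zero.2 hac)
    have : 0 < t - ρ := sub_pos.2 (lt_of_le_of_ne ht (Ne.symm htρ))
    positivity
  rw [← e2] at h5
  exact pos_of_mul_pos_right h5 hτ2.1.le

/-- Every plane drawing can be replaced by a polygonal layout. -/
theorem exists_polyPlan {N : Type*} [Finite N] {D : SimpleGraph N} (φ : D.Drawing)
    (hφ : φ.crossings = ∅) : Nonempty (PolyPlan D) := by
  classical
  have hcr : ∀ e f : D.edgeSet, e ≠ f → ∀ z, z ∈ φ.arc e → z ∈ φ.arc f → ∃ v, z = φ.point v := by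
    intro e f hef z he hf
    by_contra hno
    have : z ∈ φ.crossings := ⟨e, f, hef, he, hf, fun ⟨v, hv, _⟩ => hno ⟨v, hv⟩⟩
    rw [hφ] at this
    exact this
  have hth : ∀ e : D.edgeSet, ∃ t : N × N, (e : Sym2 N) = s(t.1, t.2) := by
    rintro ⟨e, he⟩
    induction e with | _ x y
    exact ⟨(x, y), rfl⟩
  choose th hth using hth
  have hthne : ∀ e, (th e).1 ≠ (th e).2 := by
    intro e h
    have := D.not_isDiag_of_mem_edgeSet e.2
    rw [hth e] at this
    exact this h
  have harc : ∀ e, IsArc (φ.point (th e).1) (φ.point (th e).2) (φ.arc e) := by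
    intro e
    have h : D.Adj (th e).1 (th e).2 := by
      rw [← SimpleGraph.mem_edgeSet, ← hth e]
      exact e.2
    have := φ.arc_simple _ _ h
    have he : (⟨s((th e).1, (th e).2), h⟩ : D.edgeSet) = e := Subtype.ext (hth e).symm
    rw [he] at this
    exact this
  have hcomp : ∀ e, IsCompact (φ.arc e) := by
    intro e
    obtain ⟨γ, -, h⟩ := harc e
    rw [← h]
    exact isCompact_range γ.continuous
  -- the radius of the disks
  obtain ⟨r, hr, hr1, hr2⟩ : ∃ r : ℝ, 0 < r ∧ (∀ x y, x ≠ y → 2 * r < dist (φ.point x) (φ.point y)) ∧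
      ∀ e : D.edgeSet, ∀ x, x ∉ (e : Sym2 N) → ∀ z ∈ φ.arc e, r ≤ dist z (φ.point x) := by
    have e1 : ∀ᶠ r in nhdsWithin (0 : ℝ) (Set.Ioi 0), ∀ x y, x ≠ y →
        2 * r < dist (φ.point x) (φ.point y) := by
      rw [Filter.eventually_all]; intro x
      rw [Filter.eventually_all]; intro y
      rw [Filter.eventually_imp_distrib_left]; intro hxy
      apply Filter.Eventually.filter_mono nhdsWithin_le_nhds
      refine ContinuousAt.eventually_lt (by fun_prop) continuousAt_const ?_
      simpa using fun h => hxy (φ.point_injective h)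
    have e2 : ∀ᶠ r in nhdsWithin (0 : ℝ) (Set.Ioi 0), ∀ e : D.edgeSet, ∀ x, x ∉ (e : Sym2 N) →
        ∀ z ∈ φ.arc e, r ≤ dist z (φ.point x) := by
      rw [Filter.eventually_all]; intro e
      rw [Filter.eventually_all]; intro x
      rw [Filter.eventually_imp_distrib_left]; intro hx
      have hpos : 0 < Metric.infDist (φ.point x) (φ.arc e) := by
        obtain ⟨γ, -, h⟩ := harc e
        refine ((hcomp e).isClosed.notMem_iff_infDist_pos ⟨γ 0, h ▸ ⟨0, rfl⟩⟩).1 ?_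
        exact fun h => hx (φ.mem_of_point_mem_arc e x h)
      filter_upwards [Ioo_mem_nhdsGT hpos] with r hr z hz
      rw [dist_comm]
      exact hr.2.le.trans (Metric.infDist_le_dist_of_mem hz)
    obtain ⟨r, ⟨h1, h2⟩, h3⟩ := ((e1.and e2).and self_mem_nhdsWithin).exists
    exact ⟨r, h3, h1, h2⟩
  -- The middle pieces stay at distance at least `r` from all vertices, so they are pairwise
  -- disjoint compact sets and have disjoint tubes around them.
  have hmid := fun e => (harc e).exists_middle hr (hr1 _ _ (hthne e))
  choose M hMA hMc hMp hMr ha hb using hmid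
  choose a haM hac using ha
  choose b hbM hbc using hb
  have hMall : ∀ e x, ∀ z ∈ M e, r ≤ dist z (φ.point x) := by
    intro e x z hz
    by_cases hx : x ∈ (e : Sym2 N)
    · rw [hth e, Sym2.mem_iff] at hx
      rcases hx with rfl | rfl
      · exact (hMr e z hz).1
      · exact (hMr e z hz).2
    · exact hr2 e x hx z (hMA e hz)
  have hMdisj : ∀ e f, e ≠ f → Disjoint (M e) (M f) := by
    intro e f hef
    rw [Set.disjoint_left]
    intro z he hf
    obtain ⟨v, rfl⟩ := hcr e f hef z (hMA e he) (hMA f hf)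
    have := hMall e v _ he
    rw [dist_self] at this
    linarith
  -- the thickness of the tubes
  obtain ⟨δ, hδ, hδr, hδM⟩ : ∃ δ : ℝ, 0 < δ ∧ 4 * δ < r ∧ ∀ e f, e ≠ f →
      Disjoint (Metric.thickening (3 * δ) (M e)) (Metric.thickening (3 * δ) (M f)) := by
    have e2 : ∀ᶠ δ in nhdsWithin (0 : ℝ) (Set.Ioi 0), ∀ e f, e ≠ f →
        Disjoint (Metric.thickening (3 * δ) (M e)) (Metric.thickening (3 * δ) (M f)) := by
      rw [Filter.eventually_all]; intro e
      rw [Filter.eventually_all]; intro f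
      rw [Filter.eventually_imp_distrib_left]; intro hef
      obtain ⟨ε, hε, h⟩ := (hMdisj e f hef).exists_thickenings (hMc e) (hMc f).isClosed
      filter_upwards [Ioo_mem_nhdsGT (show 0 < ε / 3 by positivity)] with δ hδ
      exact h.mono (Metric.thickening_mono (by linarith [hδ.2]) _)
        (Metric.thickening_mono (by linarith [hδ.2]) _)
    obtain ⟨δ, h2, h3⟩ := (e2.and (Ioo_mem_nhdsGT (show 0 < r / 4 by positivity))).exists
    exact ⟨δ, h3.1, by linarith [h3.2], h2⟩
  -- The disks of the layout have radius `ρ * r = r - 2 * δ`, smaller than `r - δ`, so tubes of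
  -- width `δ` around the middle pieces do not reach them.
  set ρ : ℝ := (r - 2 * δ) / r with hρdef
  have hρ0 : 0 < ρ := div_pos (by linarith) hr
  have hρ1 : ρ < 1 := (div_lt_one hr).2 (by linarith)
  have hρr : ρ * r = r - 2 * δ := by rw [hρdef]; field_simp
  let a' := fun e => φ.point (th e).1 + ρ • (a e - φ.point (th e).1)
  let b' := fun e => φ.point (th e).2 + ρ • (b e - φ.point (th e).2)
  have hda' : ∀ e, dist (a' e) (φ.point (th e).1) = r - 2 * δ := fun e => by
    rw [dist_radial _ _ hρ0.le, hac, hρr]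
  have hdb' : ∀ e, dist (b' e) (φ.point (th e).2) = r - 2 * δ := fun e => by
    rw [dist_radial _ _ hρ0.le, hbc, hρr]
  -- A tube around the middle piece, with a radial segment of length `2 * δ` at each end down to the
  -- smaller disk. The polygonal line of `e` is chosen inside this set.
  let S := fun e => Metric.thickening δ (M e) ∪ segment ℝ (a' e) (a e) ∪ segment ℝ (b' e) (b e)
  have hthick : ∀ e x, ∀ z ∈ Metric.thickening δ (M e), r - δ < dist z (φ.point x) := by
    intro e x z hz
    obtain ⟨m, hm, hzm⟩ := Metric.mem_thickening_iff.1 hz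
    have h1 := hMall e x m hm
    have h2 := dist_triangle m z (φ.point x)
    rw [dist_comm m z] at h2
    linarith
  have hrada : ∀ e, ∀ z ∈ segment ℝ (a' e) (a e), ∃ t, ρ ≤ t ∧ t ≤ 1 ∧
      z = φ.point (th e).1 + t • (a e - φ.point (th e).1) ∧ dist z (φ.point (th e).1) = t * r := by
    intro e z hz
    obtain ⟨t, h1, h2, h3⟩ := exists_of_mem_radial hρ1.le hz
    refine ⟨t, h1, h2, h3, ?_⟩
    rw [h3, dist_radial _ _ (hρ0.le.trans h1), hac]
  have hradb : ∀ e, ∀ z ∈ segment ℝ (b' e) (b e), ∃ t, ρ ≤ t ∧ t ≤ 1 ∧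
      z = φ.point (th e).2 + t • (b e - φ.point (th e).2) ∧ dist z (φ.point (th e).2) = t * r := by
    intro e z hz
    obtain ⟨t, h1, h2, h3⟩ := exists_of_mem_radial hρ1.le hz
    refine ⟨t, h1, h2, h3, ?_⟩
    rw [h3, dist_radial _ _ (hρ0.le.trans h1), hbc]
  have hfar : ∀ x y, x ≠ y → ∀ z, dist z (φ.point x) ≤ r → r < dist z (φ.point y) := by
    intro x y hxy z hz
    have h1 := hr1 x y hxy
    have h2 := dist_triangle (φ.point x) z (φ.point y)
    rw [dist_comm _ z] at h2
    linarith
  -- Within distance `r - δ` of an end only the radial segment is left, which forces the polygonal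
  -- line to leave its disk radially.
  have hSnear1 : ∀ e, ∀ z ∈ S e, dist z (φ.point (th e).1) ≤ r - δ → ∃ t, ρ ≤ t ∧ t ≤ 1 ∧
      z = φ.point (th e).1 + t • (a e - φ.point (th e).1) ∧
      dist z (φ.point (th e).1) = t * r := by
    rintro e z ((hz | hz) | hz) hd
    · exact absurd (hthick e _ z hz) (not_lt.2 hd)
    · exact hrada e z hz
    · obtain ⟨t, h1, h2, -, h4⟩ := hradb e z hz
      have := hfar _ _ (hthne e).symm z (by rw [h4]; nlinarith)
      linarith
  have hSnear2 : ∀ e, ∀ z ∈ S e, dist z (φ.point (th e).2) ≤ r - δ → ∃ t, ρ ≤ t ∧ t ≤ 1 ∧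
      z = φ.point (th e).2 + t • (b e - φ.point (th e).2) ∧
      dist z (φ.point (th e).2) = t * r := by
    rintro e z ((hz | hz) | hz) hd
    · exact absurd (hthick e _ z hz) (not_lt.2 hd)
    · obtain ⟨t, h1, h2, -, h4⟩ := hrada e z hz
      have := hfar _ _ (hthne e) z (by rw [h4]; nlinarith)
      linarith
    · exact hradb e z hz
  have hSball : ∀ e, ∀ z ∈ S e, ∀ x, dist z (φ.point x) ≤ r - 2 * δ →
      (x = (th e).1 ∧ z = a' e) ∨ (x = (th e).2 ∧ z = b' e) := by
    intro e z hz x hd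
    by_cases h1 : x = (th e).1
    · left
      subst h1
      obtain ⟨t, ht1, -, hz', hd'⟩ := hSnear1 e z hz (by linarith)
      rw [hd', ← hρr] at hd
      have : t = ρ := le_antisymm (le_of_mul_le_mul_right hd hr) ht1
      subst this
      exact ⟨rfl, hz'⟩
    by_cases h2 : x = (th e).2
    · right
      subst h2
      obtain ⟨t, ht1, -, hz', hd'⟩ := hSnear2 e z hz (by linarith)
      rw [hd', ← hρr] at hd
      have : t = ρ := le_antisymm (le_of_mul_le_mul_right hd hr) ht1
      subst this
      exact ⟨rfl, hz'⟩
    exfalso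
    rcases hz with (hz | hz) | hz
    · linarith [hthick e x z hz]
    · obtain ⟨t, -, ht, -, h4⟩ := hrada e z hz
      have := hfar _ _ (Ne.symm h1) z (by rw [h4]; nlinarith)
      linarith
    · obtain ⟨t, -, ht, -, h4⟩ := hradb e z hz
      have := hfar _ _ (Ne.symm h2) z (by rw [h4]; nlinarith)
      linarith
  -- The radial segments have length `2 * δ`, which is why the tubes were made disjoint up to width
  -- `3 * δ`.
  have hSM : ∀ e, S e ⊆ Metric.thickening (3 * δ) (M e) := by
    have key : ∀ e (c m z : Plane) (t : ℝ), m ∈ M e → dist m c = r → ρ ≤ t → t ≤ 1 →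
        z = c + t • (m - c) → z ∈ Metric.thickening (3 * δ) (M e) := by
      intro e c m z t hm hd h1 h2 hz
      refine Metric.mem_thickening_iff.2 ⟨m, hm, ?_⟩
      have : z - m = (t - 1) • (m - c) := by
        rw [hz, sub_smul, one_smul]; abel
      rw [dist_eq_norm, this, norm_smul, ← dist_eq_norm m c, hd, Real.norm_of_nonpos (by linarith)]
      nlinarith
    rintro e z ((hz | hz) | hz)
    · exact Metric.thickening_mono (by linarith) _ hz
    · obtain ⟨t, h1, h2, h3, -⟩ := hrada e z hz
      exact key e _ _ z t (haM e) (hac e) h1 h2 h3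
    · obtain ⟨t, h1, h2, h3, -⟩ := hradb e z hz
      exact key e _ _ z t (hbM e) (hbc e) h1 h2 h3
  have hSdisj : ∀ e f, e ≠ f → Disjoint (S e) (S f) := fun e f hef =>
    (hδM e f hef).mono (hSM e) (hSM f)
  have hab' : ∀ e, a' e ≠ b' e := by
    intro e h
    have := hfar _ _ (hthne e) (a' e) (by rw [hda']; linarith)
    rw [h, hdb'] at this
    linarith
  have hconn : ∀ e, Relation.ReflTransGen (fun p q => segment ℝ p q ⊆ S e) (a' e) (b' e) := by
    intro e
    have h1 : Relation.ReflTransGen (fun p q => segment ℝ p q ⊆ S e) (a' e) (a e) :=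
      Relation.ReflTransGen.single fun z hz => Or.inl (Or.inr hz)
    have h2 : Relation.ReflTransGen (fun p q => segment ℝ p q ⊆ S e) (a e) (b e) :=
      Relation.ReflTransGen.mono (fun p q (h : segment ℝ p q ⊆ _) =>
        (h.trans fun z hz => Or.inl (Or.inl hz) : segment ℝ p q ⊆ S e)) _ _
        (reflTransGen_of_isPreconnected (hMp e) hδ (haM e) (hbM e))
    have h3 : Relation.ReflTransGen (fun p q => segment ℝ p q ⊆ S e) (b e) (b' e) :=
      Relation.ReflTransGen.single fun z hz => Or.inr (by rwa [segment_symm])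
    exact (h1.trans h2).trans h3
  have hchain := fun e => exists_simple_polyChain (hab' e) (hconn e)
  choose n z hn0 hz0 hzn hzS hzne hznon hzturn using hchain
  exact ⟨{
    center := φ.point
    R := r - 2 * δ
    R_pos := by linarith
    tail := fun e => (th e).1
    head := fun e => (th e).2
    eq_mk := hth
    len := n
    len_pos := hn0
    p := z
    disjoint_ball := by
      intro x y hxy
      apply Metric.closedBall_disjoint_closedBall
      linarith [hr1 x y hxy]
    disjoint_edge := fun e f hef i hi j hj => (hSdisj e f hef).mono (hzS e i hi) (hzS f j hj)
    disjoint_nonadj := hznon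
    turn := hzturn
    ne_succ := hzne
    mem_ball := by
      intro e i hi x w hw hx
      rw [hz0, hzn]
      exact hSball e w (hzS e i hi hw) x hx
    dist_tail := fun e => by rw [hz0, hda']
    dist_head := fun e => by rw [hzn, hdb']
    out_tail := by
      intro e
      rw [hz0]
      refine dot_pos_of_radial (r' := r - δ) hρ0 ?_ ?_ ?_ ?_
      · intro h
        have := hac e
        rw [h, dist_self] at this
        linarith
      · have := hzne e 0 (hn0 e)
        rwa [hz0] at this
      · rw [hda']
        linarith
      · intro w hw hd
        have := hzS e 0 (hn0 e)
        rw [hz0] at this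
        obtain ⟨t, h1, -, h3, -⟩ := hSnear1 e w (this hw) hd.le
        exact ⟨t, h1, h3⟩
    out_head := by
      intro e
      have hpos := hn0 e
      have hlast := hzS e (n e - 1) (by omega)
      have hlastne := hzne e (n e - 1) (by omega)
      rw [Nat.sub_add_cancel hpos, hzn] at hlast hlastne
      rw [hzn]
      refine dot_pos_of_radial (r' := r - δ) hρ0 ?_ ?_ ?_ ?_
      · intro h
        have := hbc e
        rw [h, dist_self] at this
        linarith
      · exact hlastne.symm
      · rw [hdb']
        linarith
      · intro w hw hd
        rw [segment_symm] at hw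
        obtain ⟨t, h1, -, h3, -⟩ := hSnear2 e w (hlast hw) hd.le
        exact ⟨t, h1, h3⟩ }⟩

end Plane

/-! ### Parallel offsets of polygonal lines -/

namespace Plane

theorem det_add_right (a b c : Plane) : det a (b + c) = det a b + det a c := by
  simp [det]; ring

theorem det_smul_right (t : ℝ) (a b : Plane) : det a (t • b) = t * det a b := by
  simp [det]; ring

theorem det_sub_right (a b c : Plane) : det a (b - c) = det a b - det a c := by
  simp [det]; ring

theorem orient_eq_det (a b c : Plane) : orient a b c = det (b - a) (c - b) := by
  simp [orient, det]; ring

/-- A vector with prescribed determinants with two independent vectors. -/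
theorem exists_det_eq_one_det_eq_one {d d' : Plane} (h : det d d' ≠ 0) :
    ∃ u, det d u = 1 ∧ det d' u = 1 := by
  refine ⟨(1 / det d d') • (d' - d), ?_, ?_⟩
  · rw [det_smul_right, det_sub_right, show det d d = 0 by simp [det]; ring, sub_zero]
    field_simp
  · rw [det_smul_right, det_sub_right, show det d' d' = 0 by simp [det]; ring,
      show det d' d = - det d d' by simp [det]; ring]
    field_simp
    ring

/-- A vector orthogonal to `n` with prescribed determinant with `d`. -/
theorem exists_det_eq_one_dot_eq_zero {d n : Plane} (h : dot d n ≠ 0) :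
    ∃ u, det d u = 1 ∧ dot u n = 0 := by
  refine ⟨(1 / dot d n) • !₂[-n 1, n 0], ?_, ?_⟩
  · rw [det_smul_right]
    have : det d !₂[-n 1, n 0] = dot d n := by simp [det, dot]
    rw [this]
    field_simp
  · rw [dot_smul_left]
    have : dot !₂[-n 1, n 0] n = 0 := by simp [dot]; ring
    rw [this, mul_zero]

/-- Different offsets of a segment are disjoint. -/
theorem disjoint_offset_parallel {p p' u u' : Plane} {s t : ℝ} (hu : det (p' - p) u = 1)
    (hu' : det (p' - p) u' = 1) (hst : s ≠ t) :
    Disjoint (segment ℝ (p + s • u) (p' + s • u')) (segment ℝ (p + t • u) (p' + t • u')) := by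
  -- Determinant one at both ends puts the offset segment on the line at signed height `r`, parallel
  -- to the original.
  have key : ∀ r, ∀ z ∈ segment ℝ (p + r • u) (p' + r • u'), det (p' - p) (z - p) = r := by
    intro r z hz
    obtain ⟨a, -, -, h0, h1⟩ := exists_of_mem_segment hz
    simp only [det, PiLp.sub_apply, PiLp.add_apply, PiLp.smul_apply, smul_eq_mul] at *
    rw [h0, h1]
    linear_combination (1 - a) * r * hu + a * r * hu'
  rw [Set.disjoint_left]
  intro z hz hz'
  exact hst ((key s z hz).symm.trans (key t z hz'))

theorem exists_eq_smul_of_det {d w : Plane} (h : det d w = 0) (hd : 0 < dot w d) :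
    ∃ α : ℝ, 0 < α ∧ w = α • d := by
  have hdd : 0 < dot d d := by
    rw [dot_self]
    have : d ≠ 0 := by
      rintro rfl
      simp [dot] at hd
    have := norm_pos_iff.2 this
    positivity
  refine ⟨dot w d / dot d d, div_pos hd hdd, ?_⟩
  have hne := hdd.ne'
  simp only [det, dot] at *
  apply ext_coord
  · simp only [PiLp.smul_apply, smul_eq_mul]
    rw [div_mul_eq_mul_div, eq_div_iff hne]
    linear_combination (-(d 1)) * h
  · simp only [PiLp.smul_apply, smul_eq_mul]
    rw [div_mul_eq_mul_div, eq_div_iff hne]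
    linear_combination (d 0) * h

/-- Different offsets of consecutive segments are disjoint. -/
theorem disjoint_offset_adjacent {p₀ p₁ p₂ u₀ u₁ u₂ : Plane} {s t : ℝ}
    (h₀ : det (p₁ - p₀) u₀ = 1) (h₁ : det (p₁ - p₀) u₁ = 1) (h₁' : det (p₂ - p₁) u₁ = 1)
    (h₂ : det (p₂ - p₁) u₂ = 1) (hturn : det (p₁ - p₀) (p₂ - p₁) ≠ 0) (hst : s ≠ t)
    (hs : 0 < dot (p₁ + s • u₁ - (p₀ + s • u₀)) (p₁ - p₀))
    (ht : 0 < dot (p₂ + t • u₂ - (p₁ + t • u₁)) (p₂ - p₁)) :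
    Disjoint (segment ℝ (p₀ + s • u₀) (p₁ + s • u₁)) (segment ℝ (p₁ + t • u₁) (p₂ + t • u₂)) := by
  obtain ⟨α, hα, e1⟩ := exists_eq_smul_of_det (d := p₁ - p₀) (by
    simp only [det_sub_right, det_add_right, det_smul_right, h₀, h₁]
    simp [det]; ring) hs
  obtain ⟨β, hβ, e2⟩ := exists_eq_smul_of_det (d := p₂ - p₁) (by
    simp only [det_sub_right, det_add_right, det_smul_right, h₁', h₂]
    simp [det]; ring) ht
  rw [Set.disjoint_left]
  intro z hz hz'
  rw [segment_symm] at hz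
  obtain ⟨a, ha, -, h0, h1⟩ := exists_of_mem_segment hz
  obtain ⟨b, hb, -, h0', h1'⟩ := exists_of_mem_segment hz'
  have e10 := congrArg (fun v : Plane => v 0) e1
  have e11 := congrArg (fun v : Plane => v 1) e1
  have e20 := congrArg (fun v : Plane => v 0) e2
  have e21 := congrArg (fun v : Plane => v 1) e2
  simp only [det, PiLp.sub_apply, PiLp.add_apply, PiLp.smul_apply, smul_eq_mul] at *
  have k0 : (s - t) * u₁ 0 = a * (α * (p₁ 0 - p₀ 0)) + b * (β * (p₂ 0 - p₁ 0)) := by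
    rw [← e10, ← e20]
    linear_combination h0' - h0
  have k1 : (s - t) * u₁ 1 = a * (α * (p₁ 1 - p₀ 1)) + b * (β * (p₂ 1 - p₁ 1)) := by
    rw [← e11, ← e21]
    linear_combination h1' - h1
  -- At a common point `(s - t) • u₁` is a nonnegative combination of the two directions. Taking
  -- determinants with each direction gives `s - t` as `b * β * T` and as `-(a * α) * T`, so both
  -- vanish.
  set T := (p₁ 0 - p₀ 0) * (p₂ 1 - p₁ 1) - (p₁ 1 - p₀ 1) * (p₂ 0 - p₁ 0) with hT
  have k2 : s - t = b * β * T := by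
    linear_combination (p₁ 0 - p₀ 0) * k1 - (p₁ 1 - p₀ 1) * k0 - (s - t) * h₁
  have k3 : s - t = - (a * α) * T := by
    linear_combination (p₂ 0 - p₁ 0) * k1 - (p₂ 1 - p₁ 1) * k0 - (s - t) * h₁'
  have k4 : (b * β + a * α) * T = 0 := by linear_combination k3 - k2
  have k5 : b * β + a * α = 0 := (mul_eq_zero.1 k4).resolve_right hturn
  have k6 : b * β = 0 := by
    have := mul_nonneg hb hβ.le
    have := mul_nonneg ha hα.le
    linarith only [k5, this, mul_nonneg hb hβ.le]
  rw [k6, zero_mul] at k2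
  exact hst (by linarith)

/-- Two segments that start at different points of a line, on different sides, are disjoint. -/
theorem disjoint_of_sides {p n a b a' b' : Plane} (ha : dot (a - p) n = 0)
    (hb : 0 < dot (b - p) n) (ha' : dot (a' - p) n = 0) (hb' : dot (b' - p) n < 0) (h : a ≠ a') :
    Disjoint (segment ℝ a b) (segment ℝ a' b') := by
  rw [Set.disjoint_left]
  intro z hz hz'
  obtain ⟨s, hs, -, h0, h1⟩ := exists_of_mem_segment hz
  obtain ⟨t, ht, -, h0', h1'⟩ := exists_of_mem_segment hz'
  have k1 : dot (z - p) n = s * dot (b - p) n := by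
    simp only [dot, PiLp.sub_apply] at *
    rw [h0, h1]
    linear_combination (1 - s) * ha
  have k2 : dot (z - p) n = t * dot (b' - p) n := by
    simp only [dot, PiLp.sub_apply] at *
    rw [h0', h1']
    linear_combination (1 - t) * ha'
  have k3 : 0 ≤ s * dot (b - p) n := mul_nonneg hs hb.le
  have k4 : t * dot (b' - p) n ≤ 0 := mul_nonpos_of_nonneg_of_nonpos ht hb'.le
  have k5 : s = 0 := by
    have : s * dot (b - p) n = 0 := by linarith
    exact (mul_eq_zero.1 this).resolve_right hb.ne'
  have k6 : t = 0 := by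
    have : t * dot (b' - p) n = 0 := by linarith
    exact (mul_eq_zero.1 this).resolve_right hb'.ne
  subst k5 k6
  exact h (ext_coord (by linarith) (by linarith))

/-- A disk lies strictly on the inner side of its tangent at `p`, except for `p` itself: expand `‖b
- c‖ ^ 2` around `p`. -/
theorem dot_neg_of_mem_closedBall {b p c : Plane} (h : dist b c ≤ dist p c) (hbp : b ≠ p) :
    dot (b - p) (p - c) < 0 := by
  have h1 : dot (b - c) (b - c) ≤ dot (p - c) (p - c) := by
    rw [dot_self, dot_self, ← dist_eq_norm, ← dist_eq_norm]
    have := dist_nonneg (x := b) (y := c)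
    gcongr
  have h2 : 0 < dot (b - p) (b - p) := by
    rw [dot_self]
    have := norm_pos_iff.2 (sub_ne_zero.2 hbp)
    positivity
  simp only [dot, PiLp.sub_apply] at *
  nlinarith

namespace PolyPlan

variable {N : Type*} {D : SimpleGraph N}

theorem tail_ne_head (Q : PolyPlan D) (e : D.edgeSet) : Q.tail e ≠ Q.head e := by
  intro h
  have := D.not_isDiag_of_mem_edgeSet e.2
  rw [Q.eq_mk e] at this
  exact this h

/-- Offset directions along the polygonal lines of a layout. -/
structure Offset (Q : PolyPlan D) where
  u : D.edgeSet → ℕ → Plane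
  det_left : ∀ e, ∀ i < Q.len e, det (Q.p e (i + 1) - Q.p e i) (u e i) = 1
  det_right : ∀ e, ∀ i < Q.len e, det (Q.p e (i + 1) - Q.p e i) (u e (i + 1)) = 1
  dot_tail : ∀ e, dot (u e 0) (Q.p e 0 - Q.center (Q.tail e)) = 0
  dot_head : ∀ e, dot (u e (Q.len e)) (Q.p e (Q.len e) - Q.center (Q.head e)) = 0

/-- At an inner bend the adjacent directions are independent because the line turns, so one vector
has determinant one with both. At an end the line is transversal to the disk, so the vector can be
taken tangent to the disk; offset ends then move along the tangent. -/
theorem nonempty_offset (Q : PolyPlan D) : Nonempty Q.Offset := by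
  have key : ∀ e i, ∃ v : Plane, (i < Q.len e → det (Q.p e (i + 1) - Q.p e i) v = 1) ∧
      (∀ j, i = j + 1 → j < Q.len e → det (Q.p e (j + 1) - Q.p e j) v = 1) ∧
      (i = 0 → dot v (Q.p e 0 - Q.center (Q.tail e)) = 0) ∧
      (i = Q.len e → dot v (Q.p e (Q.len e) - Q.center (Q.head e)) = 0) := by
    intro e i
    have hl := Q.len_pos e
    rcases Nat.eq_zero_or_pos i with rfl | hi
    · obtain ⟨v, h1, h2⟩ := exists_det_eq_one_dot_eq_zero (Q.out_tail e).ne'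
      exact ⟨v, fun _ => h1, fun j hj => by omega, fun _ => h2, fun h => by omega⟩
    obtain ⟨k, rfl⟩ : ∃ k, i = k + 1 := ⟨i - 1, by omega⟩
    rcases lt_trichotomy (k + 1) (Q.len e) with h | h | h
    · obtain ⟨v, h1, h2⟩ := exists_det_eq_one_det_eq_one
        (by rw [← orient_eq_det]; exact Q.turn e k h)
      refine ⟨v, fun _ => h2, ?_, by omega, by omega⟩
      intro j hj _
      obtain rfl : j = k := by omega
      exact h1
    · have ho := Q.out_head e
      rw [← h, Nat.add_sub_cancel] at ho
      have ho' : dot (Q.p e (k + 1) - Q.p e k) (Q.p e (k + 1) - Q.center (Q.head e)) ≠ 0 := by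
        simp only [dot, PiLp.sub_apply] at ho ⊢
        intro h'
        linarith
      obtain ⟨v, h1, h2⟩ := exists_det_eq_one_dot_eq_zero ho'
      refine ⟨v, by omega, ?_, by omega, fun _ => by rw [← h]; exact h2⟩
      intro j hj _
      obtain rfl : j = k := by omega
      exact h1
    · exact ⟨0, by omega, by omega, by omega, by omega⟩
  choose u h1 h2 h3 h4 using key
  exact ⟨⟨u, fun e i hi => h1 e i hi, fun e i hi => h2 e (i + 1) i rfl hi, fun e => h3 e 0 rfl,
    fun e => h4 e _ rfl⟩⟩

/-- `k` is the index of the end of the polygonal line `e` at the disk `x`, and `k'` the index next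
to it. -/
def EndAt (Q : PolyPlan D) (e : D.edgeSet) (x : N) (k k' : ℕ) : Prop :=
  (x = Q.tail e ∧ k = 0 ∧ k' = 1) ∨ (x = Q.head e ∧ k = Q.len e ∧ k' = Q.len e - 1)

variable {Q : PolyPlan D}

theorem EndAt.unique {e : D.edgeSet} {x : N} {k k' l l' : ℕ} (h : Q.EndAt e x k k')
    (h' : Q.EndAt e x l l') : k = l ∧ k' = l' := by
  have := Q.tail_ne_head e
  rcases h with ⟨rfl, rfl, rfl⟩ | ⟨rfl, rfl, rfl⟩ <;> rcases h' with ⟨h, rfl, rfl⟩ | ⟨h, rfl, rfl⟩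
  · exact ⟨rfl, rfl⟩
  · exact (this h).elim
  · exact (this h.symm).elim
  · exact ⟨rfl, rfl⟩

theorem EndAt.dist_eq {e : D.edgeSet} {x : N} {k k' : ℕ} (h : Q.EndAt e x k k') :
    dist (Q.p e k) (Q.center x) = Q.R := by
  rcases h with ⟨rfl, rfl, rfl⟩ | ⟨rfl, rfl, rfl⟩
  · exact Q.dist_tail e
  · exact Q.dist_head e

theorem EndAt.dot_pos {e : D.edgeSet} {x : N} {k k' : ℕ} (h : Q.EndAt e x k k') :
    0 < dot (Q.p e k' - Q.p e k) (Q.p e k - Q.center x) := by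
  rcases h with ⟨rfl, rfl, rfl⟩ | ⟨rfl, rfl, rfl⟩
  · exact Q.out_tail e
  · exact Q.out_head e

theorem EndAt.dot_offset {e : D.edgeSet} {x : N} {k k' : ℕ} (h : Q.EndAt e x k k') (O : Q.Offset) :
    dot (O.u e k) (Q.p e k - Q.center x) = 0 := by
  rcases h with ⟨rfl, rfl, rfl⟩ | ⟨rfl, rfl, rfl⟩
  · exact O.dot_tail e
  · exact O.dot_head e

theorem EndAt.offset_ne_zero {e : D.edgeSet} {x : N} {k k' : ℕ} (h : Q.EndAt e x k k')
    (O : Q.Offset) : O.u e k ≠ 0 := by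
  have hl := Q.len_pos e
  intro h0
  rcases h with ⟨rfl, rfl, rfl⟩ | ⟨rfl, rfl, rfl⟩
  · have := O.det_left e 0 hl
    rw [h0] at this
    simp [det] at this
  · have := O.det_right e (Q.len e - 1) (by omega)
    rw [Nat.sub_add_cancel hl, h0] at this
    simp [det] at this

/-- The end of a polygonal line lies only on its last segment. -/
theorem EndAt.index_eq {e : D.edgeSet} {x : N} {k k' i : ℕ} (h : Q.EndAt e x k k')
    (hi : i < Q.len e) (hm : Q.p e k ∈ segment ℝ (Q.p e i) (Q.p e (i + 1))) :
    (i = k ∧ i + 1 = k') ∨ (i = k' ∧ i + 1 = k) := by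
  have hl := Q.len_pos e
  rcases h with ⟨rfl, rfl, rfl⟩ | ⟨rfl, rfl, rfl⟩
  · left
    rcases Nat.lt_or_ge 1 i with h | h
    · exact (Set.disjoint_left.1 (Q.disjoint_nonadj e 0 i (by omega) hi)
        (left_mem_segment ℝ _ _) hm).elim
    · rcases Nat.eq_zero_or_pos i with rfl | h0
      · simp
      · obtain rfl : i = 1 := by omega
        refine (Q.turn e 0 hi ?_).elim
        have := orient_eq_zero_of_mem_segment hm
        simp only [orient] at this ⊢
        linear_combination this
  · right
    rcases Nat.lt_or_ge (i + 2) (Q.len e) with h | h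
    · refine (Set.disjoint_left.1 (Q.disjoint_nonadj e i (Q.len e - 1) (by omega) (by omega))
        hm ?_).elim
      rw [Nat.sub_add_cancel hl]
      exact right_mem_segment ℝ _ _
    · rcases Nat.lt_or_ge (i + 1) (Q.len e) with h0 | h0
      · refine (Q.turn e i h0 ?_).elim
        have e2 : i + 2 = Q.len e := by omega
        have := orient_eq_zero_of_mem_segment hm
        rw [← e2] at this
        exact this
      · omega

theorem EndAt.lt {e : D.edgeSet} {x : N} {k k' : ℕ} (h : Q.EndAt e x k k') :
    ∃ i < Q.len e, (i = k ∧ i + 1 = k') ∨ (i = k' ∧ i + 1 = k) := by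
  have hl := Q.len_pos e
  rcases h with ⟨rfl, rfl, rfl⟩ | ⟨rfl, rfl, rfl⟩
  · exact ⟨0, hl, by simp⟩
  · exact ⟨Q.len e - 1, by omega, by omega⟩

theorem EndAt.mem_segment {e : D.edgeSet} {x : N} {k k' : ℕ} (h : Q.EndAt e x k k') :
    ∃ i < Q.len e, Q.p e k ∈ segment ℝ (Q.p e i) (Q.p e (i + 1)) := by
  obtain ⟨i, hi, ⟨rfl, h⟩ | ⟨h, rfl⟩⟩ := h.lt
  · exact ⟨i, hi, left_mem_segment ℝ _ _⟩
  · exact ⟨i, hi, right_mem_segment ℝ _ _⟩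

theorem EndAt.edge_eq {e f : D.edgeSet} {x y : N} {k k' l l' : ℕ} (h : Q.EndAt e x k k')
    (h' : Q.EndAt f y l l') (hp : Q.p e k = Q.p f l) : e = f := by
  by_contra hef
  obtain ⟨i, hi, h1⟩ := h.mem_segment
  obtain ⟨j, hj, h2⟩ := h'.mem_segment
  rw [← hp] at h2
  exact Set.disjoint_left.1 (Q.disjoint_edge e f hef i hi j hj) h1 h2

end PolyPlan

/-! ### Route points, strips and chords -/

/-- The points along which the edges of a graph (indexed by `Γ`) are routed in a layout of `D`:
vertices, an auxiliary point for each edge in each disk, and points along the polygonal lines. -/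
inductive RoutePoint (V Γ N E : Type*) (K : ℕ)
  | vertex (v : V)
  | hub (g : Γ) (x : N)
  | bend (g : Γ) (e : E) (i : Fin K)

instance {V Γ N E : Type*} {K : ℕ} [Finite V] [Finite Γ] [Finite N] [Finite E] :
    Finite (RoutePoint V Γ N E K) := by
  let f : RoutePoint V Γ N E K → V ⊕ (Γ × N) ⊕ (Γ × E × Fin K) := fun w =>
    match w with
    | .vertex v => Sum.inl v
    | .hub g x => Sum.inr (Sum.inl (g, x))
    | .bend g e i => Sum.inr (Sum.inr (g, e, i))
  refine Finite.of_injective f ?_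
  intro a b h
  cases a <;> cases b <;> simp_all [f]

namespace PolyPlan

open RoutePoint

variable {N : Type*} {D : SimpleGraph N} {Q : PolyPlan D} {V Γ : Type*} {K : ℕ}

/-- The positions of the route points, the lines being offset by `ε * σ g e`. -/
def pos (O : Q.Offset) (home : V → N) (σ : Γ → D.edgeSet → ℝ) (ε : ℝ) :
    RoutePoint V Γ N D.edgeSet K → Plane
  | vertex v => Q.center (home v)
  -- Hubs of different edges, and vertices with this home, share the centre;
  -- `exists_drawing_of_routes` separates them later.
  | hub _ x => Q.center x
  | bend g e i => Q.p e i + (ε * σ g e) • O.u e i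

/-- The route points of `g` in the disk of `x`, where `F g` are the lines that `g` may use. -/
def At (Q : PolyPlan D) (home : V → N) (F : Γ → Set D.edgeSet) (g : Γ) (x : N)
    (w : RoutePoint V Γ N D.edgeSet K) : Prop :=
  (∃ v, w = vertex v ∧ home v = x) ∨ w = hub g x ∨
    ∃ e ∈ F g, ∃ k : Fin K, ∃ k', Q.EndAt e x k k' ∧ w = bend g e k

/-- The segments of `g` along the polygonal lines. -/
def IsStrip (Q : PolyPlan D) (F : Γ → Set D.edgeSet) (g : Γ)
    (s : Sym2 (RoutePoint V Γ N D.edgeSet K)) : Prop :=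
  ∃ e ∈ F g, ∃ i j : Fin K, (i : ℕ) < Q.len e ∧ (j : ℕ) = i + 1 ∧ s = s(bend g e i, bend g e j)

/-- The segments of `g` inside the disk of `x`. -/
def IsChord (Q : PolyPlan D) (home : V → N) (F : Γ → Set D.edgeSet) (g : Γ) (x : N)
    (s : Sym2 (RoutePoint V Γ N D.edgeSet K)) : Prop :=
  ∃ w w', w ≠ w' ∧ Q.At home F g x w ∧ Q.At home F g x w' ∧ s = s(w, w')

theorem continuous_pos (O : Q.Offset) (home : V → N) (σ : Γ → D.edgeSet → ℝ)
    (w : RoutePoint V Γ N D.edgeSet K) : Continuous fun ε => pos O home σ ε w := by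
  cases w <;> simp only [pos] <;> fun_prop

theorem pos_zero_bend (O : Q.Offset) (home : V → N) (σ : Γ → D.edgeSet → ℝ) (g : Γ)
    (e : D.edgeSet) (i : Fin K) :
    pos O home σ 0 (bend g e i : RoutePoint V Γ N D.edgeSet K) = Q.p e i := by
  simp [pos]

theorem At.mem_closedBall {home : V → N} {F : Γ → Set D.edgeSet} {g : Γ} {x : N}
    {w : RoutePoint V Γ N D.edgeSet K} (h : Q.At home F g x w) (O : Q.Offset)
    (σ : Γ → D.edgeSet → ℝ) : pos O home σ 0 w ∈ Metric.closedBall (Q.center x) Q.R := by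
  rcases h with ⟨v, rfl, rfl⟩ | rfl | ⟨e, -, k, k', hk, rfl⟩
  · simp [pos, Q.R_pos.le]
  · simp [pos, Q.R_pos.le]
  · rw [pos_zero_bend, Metric.mem_closedBall, hk.dist_eq]

theorem IsChord.subset_closedBall {home : V → N} {F : Γ → Set D.edgeSet} {g : Γ} {x : N}
    {s : Sym2 (RoutePoint V Γ N D.edgeSet K)} (h : Q.IsChord home F g x s) (O : Q.Offset)
    (σ : Γ → D.edgeSet → ℝ) : seg (pos O home σ 0) s ⊆ Metric.closedBall (Q.center x) Q.R := by
  obtain ⟨w, w', -, h1, h2, rfl⟩ := h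
  exact (convex_closedBall _ _).segment_subset (h1.mem_closedBall O σ) (h2.mem_closedBall O σ)

theorem eventually_disjoint_seg (O : Q.Offset) (home : V → N) (σ : Γ → D.edgeSet → ℝ)
    {s t : Sym2 (RoutePoint V Γ N D.edgeSet K)}
    (h : Disjoint (seg (pos O home σ 0) s) (seg (pos O home σ 0) t)) :
    ∀ᶠ ε in nhdsWithin (0 : ℝ) (Set.Ioi 0),
      Disjoint (seg (pos O home σ ε) s) (seg (pos O home σ ε) t) := by
  induction s with | _ a b
  induction t with | _ c d
  apply Filter.Eventually.filter_mono nhdsWithin_le_nhds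
  exact eventually_disjoint_segment (continuous_pos O home σ a).continuousAt
    (continuous_pos O home σ b).continuousAt (continuous_pos O home σ c).continuousAt
    (continuous_pos O home σ d).continuousAt h

end PolyPlan

end Plane

/-! ### Small offsets keep route segments apart -/

namespace Plane
namespace PolyPlan

open RoutePoint

variable {N : Type*} {D : SimpleGraph N} {Q : PolyPlan D} {V Γ : Type*} {K : ℕ}

/-- Strips on different lines, or on non-consecutive segments of one line, are already disjoint in
the limit `ε = 0`. On equal or consecutive segments they must belong to different edges, since
otherwise they would share a bend; then their offsets differ. -/
theorem eventually_disjoint_strip_strip (O : Q.Offset) (home : V → N) (F : Γ → Set D.edgeSet)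
    (σ : Γ → D.edgeSet → ℝ) (hσ : ∀ g h e, g ≠ h → e ∈ F g → e ∈ F h → σ g e ≠ σ h e) {g h : Γ}
    {s t : Sym2 (RoutePoint V Γ N D.edgeSet K)} (hst : ∀ w ∈ s, w ∉ t)
    (hs : Q.IsStrip F g s) (ht : Q.IsStrip F h t) :
    ∀ᶠ ε in nhdsWithin (0 : ℝ) (Set.Ioi 0),
      Disjoint (seg (pos O home σ ε) s) (seg (pos O home σ ε) t) := by
  obtain ⟨e, he, i, i', hi, hi', rfl⟩ := hs
  obtain ⟨f, hf, j, j', hj, hj', rfl⟩ := ht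
  have hcomm : ∀ k l : Fin K, g = h → e = f → k = l →
      bend g e k = (bend h f l : RoutePoint V Γ N D.edgeSet K) := by
    rintro k l rfl rfl rfl; rfl
  by_cases hef : e = f
  swap
  · apply eventually_disjoint_seg
    simp only [seg_mk, pos_zero_bend, hi', hj']
    exact Q.disjoint_edge e f hef i hi j hj
  subst hef
  -- the offset segments keep the direction of the original ones
  have hdir : ∀ (g : Γ) (k : ℕ), k < Q.len e → ∀ᶠ ε in nhdsWithin (0 : ℝ) (Set.Ioi 0),
      0 < dot (Q.p e (k + 1) + (ε * σ g e) • O.u e (k + 1) - (Q.p e k + (ε * σ g e) • O.u e k))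
        (Q.p e (k + 1) - Q.p e k) := by
    intro g k hk
    apply Filter.Eventually.filter_mono nhdsWithin_le_nhds
    refine ContinuousAt.eventually_lt continuousAt_const ?_ ?_
    · unfold dot
      fun_prop
    · simp only [zero_mul, zero_smul, add_zero]
      rw [dot_self]
      have := norm_pos_iff.2 (sub_ne_zero.2 (Q.ne_succ e k hk).symm)
      positivity
  have hne : g ≠ h → ∀ᶠ ε in nhdsWithin (0 : ℝ) (Set.Ioi 0), ε * σ g e ≠ ε * σ h e := by
    intro hgh
    filter_upwards [self_mem_nhdsWithin] with ε hε h'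
    exact hσ g h e hgh he hf (mul_left_cancel₀ (ne_of_gt hε) h')
  rcases lt_trichotomy (i : ℕ) j with hij | hij | hij
  · by_cases hij' : (i : ℕ) + 1 = j
    · have hgh : g ≠ h := fun hgh =>
        hst (bend g e i') (by simp) (by
          rw [hcomm i' j hgh rfl (Fin.ext (by omega))]; simp)
      filter_upwards [hne hgh, hdir g i hi, hdir h j hj] with ε h1 h2 h3
      simp only [seg_mk, pos, hi', hj', ← hij'] at h3 ⊢
      rw [← hij'] at hj
      refine disjoint_offset_adjacent (O.det_left e i hi) (O.det_right e i hi)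
        (O.det_left e _ hj) (O.det_right e _ hj) ?_ h1 h2 h3
      rw [← orient_eq_det]
      exact Q.turn e i hj
    · apply eventually_disjoint_seg
      simp only [seg_mk, pos_zero_bend, hi', hj']
      exact Q.disjoint_nonadj e i j (by omega) hj
  · have hgh : g ≠ h := fun hgh =>
        hst (bend g e i) (by simp) (by
          rw [hcomm i j hgh rfl (Fin.ext (by omega))]; simp)
    filter_upwards [hne hgh] with ε h1
    simp only [seg_mk, pos, hi', hj', ← hij]
    exact disjoint_offset_parallel (O.det_left e i hi) (O.det_right e i hi) h1
  · by_cases hij' : (j : ℕ) + 1 = i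
    · have hgh : g ≠ h := fun hgh =>
        hst (bend g e i) (by simp) (by
          rw [hcomm i j' hgh rfl (Fin.ext (by omega))]; simp)
      filter_upwards [hne hgh, hdir g i hi, hdir h j hj] with ε h1 h2 h3
      simp only [seg_mk, pos, hi', hj', ← hij'] at h2 ⊢
      rw [← hij'] at hi
      refine (disjoint_offset_adjacent (O.det_left e j hj) (O.det_right e j hj)
        (O.det_left e _ hi) (O.det_right e _ hi) ?_ h1.symm h3 h2).symm
      rw [← orient_eq_det]
      exact Q.turn e j hi
    · apply eventually_disjoint_seg
      simp only [seg_mk, pos_zero_bend, hi', hj']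
      exact (Q.disjoint_nonadj e j i (by omega) hi).symm

/-- The limit position of a route point in a disk is an end of a line only if the point is on that
line. -/
theorem At.eq_bend {home : V → N} {F : Γ → Set D.edgeSet} {h : Γ} {x : N}
    {w : RoutePoint V Γ N D.edgeSet K} (hw : Q.At home F h x w) (O : Q.Offset)
    (σ : Γ → D.edgeSet → ℝ) {e : D.edgeSet} {k k' : ℕ} (hk : Q.EndAt e x k k')
    (hp : pos O home σ 0 w = Q.p e k) : e ∈ F h ∧ ∃ l : Fin K, (l : ℕ) = k ∧ w = bend h e l := by
  have hR := Q.R_pos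
  have hd := hk.dist_eq
  rw [← hp] at hd
  rcases hw with ⟨v, rfl, rfl⟩ | rfl | ⟨f, hf, l, l', hl, rfl⟩
  · simp [pos, hR.ne] at hd
  · simp [pos, hR.ne] at hd
  · rw [pos_zero_bend] at hp
    obtain rfl := hl.edge_eq hk hp
    exact ⟨hf, l, (hl.unique hk).1, rfl⟩

/-- In the limit a strip touches the disk at most at an end of its line, and a chord contains that
point only if it ends there. After offsetting, strip and chord start at different points of the
tangent and go to different sides of it. -/
theorem eventually_disjoint_strip_chord (O : Q.Offset) (home : V → N) (F : Γ → Set D.edgeSet)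
    (σ : Γ → D.edgeSet → ℝ) (hσ : ∀ g h e, g ≠ h → e ∈ F g → e ∈ F h → σ g e ≠ σ h e) {g h : Γ}
    {s t : Sym2 (RoutePoint V Γ N D.edgeSet K)} (hst : ∀ w ∈ s, w ∉ t)
    (hs : Q.IsStrip F g s) {x : N} (ht : Q.IsChord home F h x t) :
    ∀ᶠ ε in nhdsWithin (0 : ℝ) (Set.Ioi 0),
      Disjoint (seg (pos O home σ ε) s) (seg (pos O home σ ε) t) := by
  by_cases hdis : Disjoint (seg (pos O home σ 0) s) (seg (pos O home σ 0) t)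
  · exact eventually_disjoint_seg O home σ hdis
  obtain ⟨z, hzs, hzt⟩ := Set.not_disjoint_iff.1 hdis
  have hzx := ht.subset_closedBall O σ hzt
  obtain ⟨e, he, i, i', hi, hi', rfl⟩ := hs
  simp only [seg_mk, pos_zero_bend, hi'] at hzs
  obtain ⟨k, k', hk, rfl⟩ : ∃ k k', Q.EndAt e x k k' ∧ z = Q.p e k := by
    rcases Q.mem_ball e i hi x z hzs hzx with ⟨h1, h2⟩ | ⟨h1, h2⟩
    · exact ⟨0, 1, Or.inl ⟨h1, rfl, rfl⟩, h2⟩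
    · exact ⟨_, _, Or.inr ⟨h1, rfl, rfl⟩, h2⟩
  obtain ⟨w, w', hww, hw, hw', rfl⟩ := ht
  have hdot : ∀ w : RoutePoint V Γ N D.edgeSet K, Q.At home F h x w → pos O home σ 0 w ≠ Q.p e k →
      dot (pos O home σ 0 w - Q.p e k) (Q.p e k - Q.center x) < 0 := by
    intro w hw hne
    refine dot_neg_of_mem_closedBall ?_ hne
    rw [hk.dist_eq]
    exact hw.mem_closedBall O σ
  -- one end of the chord is on the line, the other one is inside the disk
  obtain ⟨w₀, w₁, hs01, hw₀, hw₁, hp0, hp1⟩ : ∃ w₀ w₁ : RoutePoint V Γ N D.edgeSet K,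
      s(w, w') = s(w₀, w₁) ∧ Q.At home F h x w₀ ∧ Q.At home F h x w₁ ∧
      pos O home σ 0 w₀ = Q.p e k ∧ pos O home σ 0 w₁ ≠ Q.p e k := by
    by_cases h0 : pos O home σ 0 w = Q.p e k
    · refine ⟨w, w', rfl, hw, hw', h0, ?_⟩
      intro h1
      obtain ⟨-, l, hl, rfl⟩ := hw.eq_bend O σ hk h0
      obtain ⟨-, l', hl', rfl⟩ := hw'.eq_bend O σ hk h1
      exact hww (by rw [Fin.ext (hl.trans hl'.symm)])
    by_cases h1 : pos O home σ 0 w' = Q.p e k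
    · exact ⟨w', w, Sym2.eq_swap, hw', hw, h1, h0⟩
    -- The linear functional vanishing on the tangent is negative at both ends of the chord, so it
    -- cannot vanish at a point of it.
    exfalso
    obtain ⟨a, ha, ha', e0, e1⟩ := exists_of_mem_segment hzt
    have k1 := hdot w hw h0
    have k2 := hdot w' hw' h1
    have k3 : (1 - a) * dot (pos O home σ 0 w - Q.p e k) (Q.p e k - Q.center x) +
        a * dot (pos O home σ 0 w' - Q.p e k) (Q.p e k - Q.center x) = 0 := by
      simp only [dot, PiLp.sub_apply] at e0 e1 ⊢
      linear_combination (-(Q.p e k 0 - Q.center x 0)) * e0 - (Q.p e k 1 - Q.center x 1) * e1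
    rcases lt_or_eq_of_le ha with h | h
    · have := mul_neg_of_pos_of_neg h k2
      have := mul_nonpos_of_nonneg_of_nonpos (sub_nonneg.2 ha') k1.le
      linarith
    · subst h
      apply h0
      exact ext_coord (by linarith) (by linarith)
  rw [hs01] at hst ⊢
  obtain ⟨heh, l, hl, rfl⟩ := hw₀.eq_bend O σ hk hp0
  obtain ⟨m, m', hmm, hm, hm'⟩ : ∃ m m' : Fin K, s(bend g e i, bend g e i') =
      (s(bend g e m, bend g e m') : Sym2 (RoutePoint V Γ N D.edgeSet K)) ∧ (m : ℕ) = k ∧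
        (m' : ℕ) = k' := by
    rcases hk.index_eq hi hzs with ⟨h1, h2⟩ | ⟨h1, h2⟩
    · exact ⟨i, i', rfl, h1, by omega⟩
    · exact ⟨i', i, Sym2.eq_swap, by omega, h1⟩
  rw [hmm] at hst ⊢
  have hgh : g ≠ h := by
    rintro rfl
    obtain rfl : m = l := Fin.ext (by omega)
    exact hst (bend g e m) (by simp) (by simp)
  have ev1 : ∀ᶠ ε in nhdsWithin (0 : ℝ) (Set.Ioi 0),
      0 < dot (pos O home σ ε (bend g e m' : RoutePoint V Γ N D.edgeSet K) - Q.p e k)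
        (Q.p e k - Q.center x) := by
    apply Filter.Eventually.filter_mono nhdsWithin_le_nhds
    refine ContinuousAt.eventually_lt continuousAt_const ?_ ?_
    · have := continuous_pos O home σ (bend g e m' : RoutePoint V Γ N D.edgeSet K)
      unfold dot
      fun_prop
    · rw [pos_zero_bend, hm']
      exact hk.dot_pos
  have ev2 : ∀ᶠ ε in nhdsWithin (0 : ℝ) (Set.Ioi 0),
      dot (pos O home σ ε w₁ - Q.p e k) (Q.p e k - Q.center x) < 0 := by
    apply Filter.Eventually.filter_mono nhdsWithin_le_nhds
    refine ContinuousAt.eventually_lt ?_ continuousAt_const (hdot w₁ hw₁ hp1)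
    have := continuous_pos O home σ w₁
    unfold dot
    fun_prop
  filter_upwards [ev1, ev2, self_mem_nhdsWithin] with ε h1 h2 h3
  have hzero : ∀ (g : Γ) (m : Fin K), (m : ℕ) = k →
      dot (pos O home σ ε (bend g e m : RoutePoint V Γ N D.edgeSet K) - Q.p e k)
        (Q.p e k - Q.center x) = 0 := by
    intro g m hm
    simp only [pos, hm, add_sub_cancel_left]
    rw [dot_smul_left, hk.dot_offset, mul_zero]
  refine disjoint_of_sides (hzero g m hm) h1 (hzero h l hl) h2 ?_
  simp only [pos, hm, hl]
  intro h'
  have h'' := smul_left_injective ℝ (hk.offset_ne_zero O) (add_left_cancel h')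
  exact hσ g h e hgh he heh (mul_left_cancel₀ (ne_of_gt h3) h'')

theorem eventually_disjoint_chord_chord (O : Q.Offset) (home : V → N) (F : Γ → Set D.edgeSet)
    (σ : Γ → D.edgeSet → ℝ) {g h : Γ} {s t : Sym2 (RoutePoint V Γ N D.edgeSet K)} {x y : N}
    (hxy : x ≠ y) (hs : Q.IsChord home F g x s) (ht : Q.IsChord home F h y t) :
    ∀ᶠ ε in nhdsWithin (0 : ℝ) (Set.Ioi 0),
      Disjoint (seg (pos O home σ ε) s) (seg (pos O home σ ε) t) :=
  eventually_disjoint_seg O home σ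
    ((Q.disjoint_ball x y hxy).mono (hs.subset_closedBall O σ) (ht.subset_closedBall O σ))

/-- For small offsets, route segments without a common end point are disjoint, unless they lie in
the same disk. -/
theorem eventually_disjoint [Finite V] [Finite Γ] [Finite N] (O : Q.Offset) (home : V → N)
    (F : Γ → Set D.edgeSet) (σ : Γ → D.edgeSet → ℝ)
    (hσ : ∀ g h e, g ≠ h → e ∈ F g → e ∈ F h → σ g e ≠ σ h e) :
    ∀ᶠ ε in nhdsWithin (0 : ℝ) (Set.Ioi 0), ∀ (g h : Γ)
      (s t : Sym2 (RoutePoint V Γ N D.edgeSet K)), (∀ w ∈ s, w ∉ t) →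
      (Q.IsStrip F g s ∨ ∃ x, Q.IsChord home F g x s) →
      (Q.IsStrip F h t ∨ ∃ x, Q.IsChord home F h x t) →
      (¬ ∃ x, Q.IsChord home F g x s ∧ Q.IsChord home F h x t) →
      Disjoint (seg (pos O home σ ε) s) (seg (pos O home σ ε) t) := by
  simp only [Filter.eventually_all]
  intro g h s t hst hs ht hno
  rcases hs with hs | ⟨x, hs⟩ <;> rcases ht with ht | ⟨y, ht⟩
  · exact eventually_disjoint_strip_strip O home F σ hσ hst hs ht
  · exact eventually_disjoint_strip_chord O home F σ hσ hst hs ht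
  · filter_upwards [eventually_disjoint_strip_chord O home F σ hσ
      (fun w hw hw' => hst w hw' hw) ht hs] with ε h
    exact h.symm
  · by_cases hxy : x = y
    · subst hxy
      exact (hno ⟨x, hs, ht⟩).elim
    · exact eventually_disjoint_chord_chord O home F σ hxy hs ht

end PolyPlan
end Plane

/-! ### From planar decompositions to drawings -/

open Plane Plane.PolyPlan Plane.RoutePoint in
/-- A planar decomposition yields a drawing in which crossings occur only near the bags. -/
theorem SimpleGraph.Decomposition.crossingNumber_le {V : Type*} [Finite V] {G : SimpleGraph V}
    (B : G.Decomposition) (hB : B.Planar) {k Δ : ℕ} (hk : B.width ≤ k)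
    (hΔ : ∀ v, {g : G.edgeSet | v ∈ (g : Sym2 V)}.ncard ≤ Δ) :
    G.crossingNumber ≤ ((B.order * (k * Δ * 2) ^ 2 : ℕ) : ℕ∞) := by
  classical
  let _ := B.fintypeNode
  let _ := Fintype.ofFinite V
  let _ := Fintype.ofFinite G.edgeSet
  obtain ⟨φ, hφ⟩ := hB
  obtain ⟨Q⟩ := exists_polyPlan φ hφ
  obtain ⟨O⟩ := Q.nonempty_offset
  obtain ⟨K, hK⟩ : ∃ K, ∀ e, Q.len e < K := by
    obtain ⟨K, hK⟩ := Finite.exists_le Q.len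
    exact ⟨K + 1, fun e => Nat.lt_succ_of_le (hK e)⟩
  have hhome : ∀ v, ∃ x, v ∈ B.bag x := fun v => by
    obtain ⟨x, hx⟩ := (B.connected v).nonempty
    exact ⟨x, hx⟩
  choose home hhome using hhome
  -- The route of `g` is confined to the nodes whose bags contain an end of `g` and to the lines
  -- between them.
  let X : G.edgeSet → Set B.Node := fun g => {x | ∃ v ∈ (g : Sym2 V), v ∈ B.bag x}
  let F : G.edgeSet → Set B.graph.edgeSet := fun g => {e | Q.tail e ∈ X g ∧ Q.head e ∈ X g}
  obtain ⟨num, hnum⟩ := exists_injective_nat G.edgeSet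
  let σ : G.edgeSet → B.graph.edgeSet → ℝ := fun g _ => num g
  have hσ : ∀ g h e, g ≠ h → e ∈ F g → e ∈ F h → σ g e ≠ σ h e := by
    intro g h e hgh _ _ he
    exact hgh (hnum (Nat.cast_injective he))
  obtain ⟨ε, hε⟩ := (eventually_disjoint (K := K) O home F σ hσ).exists
  let W := RoutePoint V G.edgeSet B.Node B.graph.edgeSet K
  -- Inside a disk only spokes at the hub of `g` are allowed. Two segments of the same route in one
  -- disk therefore share the hub and need no disjointness.
  let S : G.edgeSet → SimpleGraph W := fun g => SimpleGraph.fromEdgeSet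
    {s | Q.IsStrip F g s ∨ ∃ x, Q.IsChord home F g x s ∧ hub g x ∈ s ∧
      ∀ v, vertex v ∈ s → v ∈ (g : Sym2 V)}
  have hS : ∀ g, ∀ s ∈ (S g).edgeSet, Q.IsStrip F g s ∨ ∃ x, Q.IsChord home F g x s ∧ hub g x ∈ s ∧
      ∀ v, vertex v ∈ s → v ∈ (g : Sym2 V) := by
    intro g s hs
    rw [SimpleGraph.edgeSet_fromEdgeSet] at hs
    exact hs.1
  -- connecting the hubs
  have hendadj : ∀ g, ∀ e ∈ F g, ∀ x (l : Fin K) l', Q.EndAt e x l l' →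
      (S g).Adj (hub g x) (bend g e l) := by
    intro g e he x l l' hl
    rw [SimpleGraph.fromEdgeSet_adj]
    refine ⟨Or.inr ⟨x, ⟨_, _, by simp, Or.inr (Or.inl rfl), Or.inr (Or.inr ⟨e, he, l, l', hl, rfl⟩),
      rfl⟩, by simp, ?_⟩, by simp⟩
    intro v hv
    simp at hv
  have hstrip : ∀ g, ∀ e ∈ F g, ∀ n (hn : n ≤ Q.len e), (S g).Reachable
      (bend g e ⟨0, (Nat.zero_le _).trans_lt (hK e)⟩) (bend g e ⟨n, hn.trans_lt (hK e)⟩) := by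
    intro g e he n
    induction n with
    | zero => intro hn; exact SimpleGraph.Reachable.refl _
    | succ n ih =>
      intro hn
      refine (ih (by omega)).trans (SimpleGraph.Adj.reachable ?_)
      rw [SimpleGraph.fromEdgeSet_adj]
      refine ⟨Or.inl ⟨e, he, _, _, by exact hn, by simp, rfl⟩, fun h => ?_⟩
      have h' := congrArg Fin.val (RoutePoint.bend.inj h).2.2
      simp at h'
  have hedge : ∀ g, ∀ e ∈ F g, (S g).Reachable (hub g (Q.tail e)) (hub g (Q.head e)) := by
    intro g e he
    have h1 := hendadj g e he (Q.tail e) ⟨0, (Nat.zero_le _).trans_lt (hK e)⟩ 1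
      (Or.inl ⟨rfl, rfl, rfl⟩)
    have h2 := hendadj g e he (Q.head e) ⟨Q.len e, hK e⟩ _ (Or.inr ⟨rfl, rfl, rfl⟩)
    exact (h1.reachable.trans (hstrip g e he _ le_rfl)).trans h2.reachable.symm
  have hadj : ∀ g, ∀ x ∈ X g, ∀ y ∈ X g, B.graph.Adj x y →
      (S g).Reachable (hub g x) (hub g y) := by
    intro g x hx y hy hxy
    have he := Q.eq_mk ⟨s(x, y), hxy⟩
    rcases Sym2.eq_iff.1 he with ⟨h1, h2⟩ | ⟨h1, h2⟩
    · have := hedge g ⟨s(x, y), hxy⟩ ⟨h1 ▸ hx, h2 ▸ hy⟩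
      rwa [← h1, ← h2] at this
    · have := hedge g ⟨s(x, y), hxy⟩ ⟨h2 ▸ hy, h1 ▸ hx⟩
      rw [← h1, ← h2] at this
      exact this.symm
  have hbag : ∀ (g : G.edgeSet), ∀ v ∈ (g : Sym2 V), ∀ x y, v ∈ B.bag x → v ∈ B.bag y →
      (S g).Reachable (hub g x) (hub g y) := by
    intro g v hv x y hx hy
    obtain ⟨p⟩ := (B.connected v).preconnected ⟨x, hx⟩ ⟨y, hy⟩
    have : ∀ {a b : {x | v ∈ B.bag x}}, (B.graph.induce {x | v ∈ B.bag x}).Walk a b →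
        (S g).Reachable (hub g a) (hub g b) := by
      intro a b p
      induction p with
      | nil => exact SimpleGraph.Reachable.refl _
      | @cons a c b h p ih =>
        exact (hadj g a ⟨v, hv, a.2⟩ c ⟨v, hv, c.2⟩ h).trans ih
    exact this p
  have hvert : ∀ (g : G.edgeSet), ∀ v ∈ (g : Sym2 V), (S g).Reachable (vertex v) (hub g (home v)) := by
    intro g v hv
    apply SimpleGraph.Adj.reachable
    rw [SimpleGraph.fromEdgeSet_adj]
    refine ⟨Or.inr ⟨home v, ⟨_, _, by simp, Or.inl ⟨v, rfl, rfl⟩, Or.inr (Or.inl rfl), rfl⟩,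
      by simp, ?_⟩, by simp⟩
    intro v' hv'
    have : v' = v := by simpa using hv'
    rwa [this]
  have hends : ∀ g : G.edgeSet, ∃ t : V × V, (g : Sym2 V) = s(t.1, t.2) := by
    rintro ⟨e, he⟩
    induction e with | _ x y
    exact ⟨(x, y), rfl⟩
  choose ends hends using hends
  have hreach : ∀ g, (S g).Reachable (vertex (ends g).1) (vertex (ends g).2) := by
    intro g
    have hG : G.Adj (ends g).1 (ends g).2 := by
      rw [← SimpleGraph.mem_edgeSet, ← hends g]
      exact g.2
    have m1 : (ends g).1 ∈ (g : Sym2 V) := by rw [hends g]; simp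
    have m2 : (ends g).2 ∈ (g : Sym2 V) := by rw [hends g]; simp
    obtain ⟨x, y, hx, hy, hxy⟩ := B.touch _ _ hG
    have hxy' : (S g).Reachable (hub g x) (hub g y) := by
      rcases hxy with rfl | hxy
      · exact SimpleGraph.Reachable.refl _
      · exact hadj g x ⟨_, m1, hx⟩ y ⟨_, m2, hy⟩ hxy
    exact ((hvert g _ m1).trans (hbag g _ m1 _ _ (hhome _) hx)).trans
      (hxy'.trans ((hbag g _ m2 _ _ hy (hhome _)).trans (hvert g _ m2).symm))
  choose P hP using fun g => (hreach g).exists_isPath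
  -- the points on a route
  have hown : ∀ g, ∀ w ∈ (P g).support, (∃ v ∈ (g : Sym2 V), w = vertex v) ∨
      (∃ x, w = hub g x) ∨ ∃ e i, w = bend g e i := by
    intro g w hw
    rcases SimpleGraph.Walk.mem_support_iff_exists_mem_edges.1 hw with rfl | ⟨s, hs, hws⟩
    · exact Or.inl ⟨_, by rw [hends g]; simp, rfl⟩
    · rcases hS g s ((P g).edges_subset_edgeSet hs) with ⟨e, he, i, j, -, -, rfl⟩ |
        ⟨x, ⟨w₁, w₂, -, h1, h2, rfl⟩, -, h4⟩
      · rcases Sym2.mem_iff.1 hws with rfl | rfl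
        · exact Or.inr (Or.inr ⟨_, _, rfl⟩)
        · exact Or.inr (Or.inr ⟨_, _, rfl⟩)
      · have : Q.At home F g x w := by
          rcases Sym2.mem_iff.1 hws with rfl | rfl
          · exact h1
          · exact h2
        rcases this with ⟨v, rfl, -⟩ | rfl | ⟨e, -, l, -, -, rfl⟩
        · exact Or.inl ⟨v, h4 v hws, rfl⟩
        · exact Or.inr (Or.inl ⟨_, rfl⟩)
        · exact Or.inr (Or.inr ⟨_, _, rfl⟩)
  have hchord : ∀ g, ∀ s ∈ (P g).edges, ∀ x, Q.IsChord home F g x s → hub g x ∈ s ∧ x ∈ X g := by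
    intro g s hs x hx
    rcases hS g s ((P g).edges_subset_edgeSet hs) with ⟨e, he, i, j, -, hij, rfl⟩ | ⟨y, h1, h2, h3⟩
    -- A strip is not a chord: its indices `i` and `i + 1` would both be the index of the end of `e`
    -- at `x`.
    · exfalso
      obtain ⟨w, w', hww, hw, hw', hs'⟩ := hx
      have key : ∀ i : Fin K, Q.At home F g x (bend g e i : W) → ∃ k', Q.EndAt e x i k' := by
        intro i hi
        rcases hi with ⟨v, h, -⟩ | h | ⟨f, -, l, l', hl, h⟩
        · simp at h
        · simp at h
        · simp only [RoutePoint.bend.injEq, true_and] at h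
          obtain ⟨rfl, rfl⟩ := h
          exact ⟨l', hl⟩
      have hi : Q.At home F g x (bend g e i : W) ∧ Q.At home F g x (bend g e j : W) := by
        rcases Sym2.eq_iff.1 hs' with ⟨rfl, rfl⟩ | ⟨rfl, rfl⟩
        · exact ⟨hw, hw'⟩
        · exact ⟨hw', hw⟩
      obtain ⟨k1, h1⟩ := key i hi.1
      obtain ⟨k2, h2⟩ := key j hi.2
      have := (h1.unique h2).1
      omega
    · obtain ⟨w, w', hww, hw, hw', rfl⟩ := hx
      have hAt : ∀ u : W, u ∈ s(w, w') → Q.At home F g x u := by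
        intro u hu
        rcases Sym2.mem_iff.1 hu with rfl | rfl
        · exact hw
        · exact hw'
      have hyx : y = x := by
        rcases hAt _ h2 with ⟨v, h, -⟩ | h | ⟨f, -, l, l', hl, h⟩
        · simp at h
        · simpa using h
        · simp at h
      subst hyx
      refine ⟨h2, ?_⟩
      obtain ⟨u, hu⟩ := h2
      have hu2 : u ∈ s(w, w') := by rw [hu]; simp
      have hne : u ≠ hub g y := by
        rintro rfl
        rcases Sym2.eq_iff.1 hu with ⟨rfl, rfl⟩ | ⟨rfl, rfl⟩ <;> exact hww rfl
      rcases hAt _ hu2 with ⟨v, rfl, rfl⟩ | h | ⟨f, hf, l, l', hl, rfl⟩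
      · exact ⟨v, h3 v hu2, hhome v⟩
      · exact (hne h).elim
      · rcases hl with ⟨rfl, -⟩ | ⟨rfl, -⟩
        · exact hf.1
        · exact hf.2
  have hkind : ∀ g, ∀ s ∈ (P g).edges, Q.IsStrip F g s ∨ ∃ x, Q.IsChord home F g x s := by
    intro g s hs
    rcases hS g s ((P g).edges_subset_edgeSet hs) with h | ⟨x, h, -⟩
    · exact Or.inl h
    · exact Or.inr ⟨x, h⟩
  have hself : ∀ g v, (vertex v : W) ∈ (P g).support → v ∈ (g : Sym2 V) := by
    intro g v hv
    rcases hown g _ hv with ⟨v', h, h'⟩ | ⟨x, h⟩ | ⟨e, i, h⟩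
    · rwa [RoutePoint.vertex.inj h']
    · simp at h
    · simp at h
  have hpriv : ∀ g h, g ≠ h → ∀ w, w ∈ (P g).support → w ∈ (P h).support →
      ∃ v, w = vertex v := by
    intro g h hgh w hw hw'
    rcases hown g _ hw with ⟨v', -, rfl⟩ | ⟨x, rfl⟩ | ⟨e, i, rfl⟩
    · exact ⟨v', rfl⟩
    · exfalso
      rcases hown h _ hw' with ⟨v', -, h'⟩ | ⟨x, h'⟩ | ⟨e, i, h'⟩
      · simp at h'
      · exact hgh (RoutePoint.hub.inj h').1
      · simp at h'
    · exfalso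
      rcases hown h _ hw' with ⟨v', -, h'⟩ | ⟨x, h'⟩ | ⟨e, i, h'⟩
      · simp at h'
      · simp at h'
      · exact hgh (RoutePoint.bend.inj h').1
  have hdisj : ∀ g, ∀ s ∈ (P g).edges, ∀ t ∈ (P g).edges, (∀ w ∈ s, w ∉ t) →
      Disjoint (seg (pos O home σ ε) s) (seg (pos O home σ ε) t) := by
    intro g s hs t ht hst
    refine hε g g s t hst (hkind g s hs) (hkind g t ht) ?_
    rintro ⟨x, h1, h2⟩
    exact hst _ (hchord g s hs x h1).1 (hchord g t ht x h2).1
  obtain ⟨ψ, hψ⟩ := exists_drawing_of_routes G (vertex : V → W) (fun a b h => by simpa using h) S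
    (fun g => (ends g).1) (fun g => (ends g).2) hends P hP hself hpriv (pos O home σ ε) hdisj
  -- counting
  let A : B.Node → Finset (Sym2 W) := fun x => (Finset.univ.filter (fun g => x ∈ X g)).biUnion
    fun g => ((P g).edges.filter (hub g x ∈ ·)).toFinset
  have hA : ∀ x, (A x).card ≤ k * Δ * 2 := by
    intro x
    -- At most `k` vertices are in the bag, each on at most `Δ` edges.
    have h1 : (Finset.univ.filter (fun g => x ∈ X g)).card ≤ k * Δ := by
      have hsub : Finset.univ.filter (fun g => x ∈ X g) ⊆ (B.bag x).biUnion fun v =>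
          Finset.univ.filter fun g : G.edgeSet => v ∈ (g : Sym2 V) := by
        intro g hg
        obtain ⟨v, hv, hvx⟩ := (Finset.mem_filter.1 hg).2
        exact Finset.mem_biUnion.2 ⟨v, hvx, by simpa using hv⟩
      refine (Finset.card_le_card hsub).trans ?_
      refine (Finset.card_biUnion_le_card_mul _ _ Δ ?_).trans ?_
      · intro v _
        have := hΔ v
        rw [Set.ncard_eq_toFinset_card'] at this
        convert this using 2
        ext g
        simp
      · refine Nat.mul_le_mul_right _ (le_trans ?_ hk)
        exact Finset.le_sup (f := fun x => (B.bag x).card) (Finset.mem_univ x)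
    -- Each route is a path, so it has at most two segments at its hub.
    refine (Finset.card_biUnion_le_card_mul _ _ 2 ?_).trans (Nat.mul_le_mul_right _ h1)
    intro g _
    exact (List.toFinset_card_le _).trans ((hP g).length_filter_edges_le_two _)
  refine (iInf_le _ ψ).trans (hψ.trans ?_)
  -- Meeting segments of different routes without a common end are chords of one disk, hence a pair
  -- in `A x ×ˢ A x` for some `x`.
  have hsub : {q : Sym2 W × Sym2 W | ∃ g h, g ≠ h ∧ q.1 ∈ (P g).edges ∧ q.2 ∈ (P h).edges ∧
      (∀ w ∈ q.1, w ∉ q.2) ∧ ¬ Disjoint (seg (pos O home σ ε) q.1) (seg (pos O home σ ε) q.2)} ⊆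
      ((Finset.univ.biUnion fun x => A x ×ˢ A x : Finset (Sym2 W × Sym2 W)) : Set _) := by
    rintro ⟨s, t⟩ ⟨g, h, hgh, hs, ht, hst, hnd⟩
    have : ∃ x, Q.IsChord home F g x s ∧ Q.IsChord home F h x t := by
      by_contra hno
      exact hnd (hε g h s t hst (hkind g s hs) (hkind h t ht) hno)
    obtain ⟨x, h1, h2⟩ := this
    have hmem : ∀ g, ∀ s ∈ (P g).edges, Q.IsChord home F g x s → s ∈ A x := by
      intro g s hs h1
      refine Finset.mem_biUnion.2 ⟨g, by simpa using (hchord g s hs x h1).2, ?_⟩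
      simpa using ⟨hs, (hchord g s hs x h1).1⟩
    simp only [Finset.coe_biUnion, Set.mem_iUnion]
    exact ⟨x, Finset.mem_univ x, Finset.mem_coe.2 (Finset.mem_product.2
      ⟨hmem g s hs h1, hmem h t ht h2⟩)⟩
  refine (Set.encard_le_encard hsub).trans ?_
  rw [Set.encard_coe_eq_coe_finsetCard]
  have : (Finset.univ.biUnion fun x => A x ×ˢ A x : Finset (Sym2 W × Sym2 W)).card ≤
      B.order * (k * Δ * 2) ^ 2 := by
    refine Finset.card_biUnion_le_card_mul _ _ _ ?_
    intro x _
    rw [Finset.card_product, sq]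
    exact Nat.mul_le_mul (hA x) (hA x)
  exact_mod_cast this

/-! ### Contracting an edge of a plane graph -/

namespace Plane

/-- Segments that start at different points of a line and go to the same side, the slopes being
ordered as the starting points, are disjoint. -/
theorem disjoint_of_slopes {p n u b b' : Plane} {s s' : ℝ} (hun : dot u n = 0) (hu : u ≠ 0)
    (hs : s < s') (hb : dot (b - p) n < 0) (hb' : dot (b' - p) n < 0)
    (hslope : dot (b - (p + s • u)) u * -dot (b' - p) n < dot (b' - (p + s' • u)) u *
      -dot (b - p) n) :
    Disjoint (segment ℝ (p + s • u) b) (segment ℝ (p + s' • u) b') := by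
  rw [Set.disjoint_left]
  intro z hz hz'
  obtain ⟨a, ha, -, h0, h1⟩ := exists_of_mem_segment hz
  obtain ⟨a', ha', -, h0', h1'⟩ := exists_of_mem_segment hz'
  have huu : 0 < dot u u := by
    rw [dot_self]
    have := norm_pos_iff.2 hu
    positivity
  have k1 : a * dot (b - p) n = a' * dot (b' - p) n := by
    simp only [dot, PiLp.sub_apply, PiLp.add_apply, PiLp.smul_apply, smul_eq_mul] at *
    linear_combination (h0' - h0) * n 0 + (h1' - h1) * n 1 - (s * (1 - a) - s' * (1 - a')) * hun
  have k2 : (s' - s) * dot u u = a * dot (b - (p + s • u)) u - a' * dot (b' - (p + s' • u)) u := by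
    simp only [dot, PiLp.sub_apply, PiLp.add_apply, PiLp.smul_apply, smul_eq_mul] at *
    linear_combination (h0 - h0') * u 0 + (h1 - h1') * u 1
  set T := dot (b - (p + s • u)) u
  set T' := dot (b' - (p + s' • u)) u
  set H := dot (b - p) n
  set H' := dot (b' - p) n
  -- The left side is positive by the order of the starting points, the right side is not by the
  -- order of the slopes.
  have k3 : (s' - s) * dot u u * (H * H') = (a * -H) * (T * -H' - T' * -H) := by
    rw [k2]
    linear_combination (T' * H) * k1
  have k4 : 0 < (s' - s) * dot u u * (H * H') :=
    mul_pos (mul_pos (sub_pos.2 hs) huu) (mul_pos_of_neg_of_neg hb hb')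
  have k5 : (a * -H) * (T * -H' - T' * -H) ≤ 0 :=
    mul_nonpos_of_nonneg_of_nonpos (mul_nonneg ha (by linarith)) (by linarith)
  linarith

/-- Points of a circle that are seen in the same direction from another point of the circle
coincide. -/
theorem eq_of_slope_eq {p c u b b' : Plane} (hu : u ≠ 0) (hun : dot u (p - c) = 0)
    (hb : dist b c = dist p c) (hb' : dist b' c = dist p c) (hbp : b ≠ p) (hbp' : b' ≠ p)
    (h : dot (b - p) u / dot (b - p) (p - c) = dot (b' - p) u / dot (b' - p) (p - c)) : b = b' := by
  have hH := dot_neg_of_mem_closedBall hb.le hbp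
  have hH' := dot_neg_of_mem_closedBall hb'.le hbp'
  -- This is the equation of the circle centred at `c`, seen from its point `p`.
  have hq : dot (b - p) (b - p) = - 2 * dot (b - p) (p - c) := by
    have : dot (b - c) (b - c) = dot (p - c) (p - c) := by
      rw [dot_self, dot_self, ← dist_eq_norm, ← dist_eq_norm, hb]
    simp only [dot, PiLp.sub_apply] at *
    linear_combination this
  have hq' : dot (b' - p) (b' - p) = - 2 * dot (b' - p) (p - c) := by
    have : dot (b' - c) (b' - c) = dot (p - c) (p - c) := by
      rw [dot_self, dot_self, ← dist_eq_norm, ← dist_eq_norm, hb']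
    simp only [dot, PiLp.sub_apply] at *
    linear_combination this
  rw [div_eq_div_iff hH.ne hH'.ne] at h
  have hn : p - c ≠ 0 := by
    intro h0
    rw [h0] at hH
    simp [dot] at hH
  -- in the orthogonal basis `u`, `p - c` the two vectors are proportional
  have huu : 0 < dot u u := by
    rw [dot_self]
    have := norm_pos_iff.2 hu
    positivity
  have hnn : 0 < dot (p - c) (p - c) := by
    rw [dot_self]
    have := norm_pos_iff.2 hn
    positivity
  set n := p - c
  set v := b - p
  set v' := b' - p
  set H := dot v n
  set H' := dot v' n
  -- Equal slopes make the vectors proportional; comparing lengths through `hq` and `hq'` then gives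
  -- `H = H'`.
  have key : H' • v = H • v' := by
    have h1 : dot (H' • v - H • v') n = 0 := by
      simp only [H, H', dot, PiLp.sub_apply, PiLp.smul_apply, smul_eq_mul]
      ring
    have h2 : dot (H' • v - H • v') u = 0 := by
      have : dot (H' • v - H • v') u = H' * dot v u - H * dot v' u := by
        simp only [dot, PiLp.sub_apply, PiLp.smul_apply, smul_eq_mul]
        ring
      rw [this]
      linear_combination h
    set w := H' • v - H • v' with hw
    have hw0 : w = 0 := by
      have hd : det u n ≠ 0 := by
        intro hd
        have : dot u u * dot n n = 0 := by
          have : dot u u * dot n n = dot u n ^ 2 + det u n ^ 2 := by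
            simp only [dot, det]; ring
          rw [this, hun, hd]; ring
        exact (mul_pos huu hnn).ne' this
      simp only [dot, det] at h1 h2 hd
      apply ext_coord
      · have : w 0 * (u 0 * n 1 - u 1 * n 0) = 0 := by linear_combination n 1 * h2 - u 1 * h1
        simpa using (mul_eq_zero.1 this).resolve_right hd
      · have : w 1 * (u 0 * n 1 - u 1 * n 0) = 0 := by linear_combination u 0 * h1 - n 0 * h2
        simpa using (mul_eq_zero.1 this).resolve_right hd
    exact sub_eq_zero.1 hw0
  have e1 : dot (H' • v) (H' • v) = dot (H • v') (H • v') := by rw [key]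
  rw [dot_smul_left, dot_smul_right, dot_smul_left, dot_smul_right, hq, hq'] at e1
  have e2 : H * H' * (H' - H) = 0 := by linear_combination (-1/2) * e1
  have e3 : H' = H := by
    rcases mul_eq_zero.1 e2 with e | e
    · exact ((mul_pos_of_neg_of_neg hH hH').ne' e).elim
    · linarith
  rw [e3] at key
  have := smul_right_injective Plane hH.ne key
  exact sub_left_injective this

namespace PolyPlan

open RoutePoint

variable {N : Type*} {D : SimpleGraph N} {Q : PolyPlan D} {V Γ : Type*} {K : ℕ}

theorem EndAt.mem {e : D.edgeSet} {x : N} {k k' : ℕ} (h : Q.EndAt e x k k') :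
    x ∈ (e : Sym2 N) := by
  rw [Q.eq_mk e]
  rcases h with ⟨rfl, -⟩ | ⟨rfl, -⟩ <;> simp

theorem exists_endAt (hK : ∀ e, Q.len e < K) {e : D.edgeSet} {x : N} (h : x ∈ (e : Sym2 N)) :
    ∃ (k : Fin K) (k' : ℕ), Q.EndAt e x k k' := by
  rw [Q.eq_mk e, Sym2.mem_iff] at h
  rcases h with h | h
  · exact ⟨⟨0, (Nat.zero_le _).trans_lt (hK e)⟩, 1, Or.inl ⟨h, rfl, rfl⟩⟩
  · exact ⟨⟨Q.len e, hK e⟩, _, Or.inr ⟨h, rfl, rfl⟩⟩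

/-- The points of `g` along a line are connected by the strips of `g`. -/
theorem reachable_bend (hK : ∀ e, Q.len e < K) {F : Γ → Set D.edgeSet} {g : Γ}
    {S : SimpleGraph (RoutePoint V Γ N D.edgeSet K)}
    (hS : ∀ s, ¬ s.IsDiag → Q.IsStrip F g s → s ∈ S.edgeSet) {e : D.edgeSet} (he : e ∈ F g)
    {k l : Fin K} (hk : (k : ℕ) ≤ Q.len e) (hl : (l : ℕ) ≤ Q.len e) :
    S.Reachable (bend g e k) (bend g e l) := by
  have key : ∀ n (hn : n ≤ Q.len e), S.Reachable
      (bend g e ⟨0, (Nat.zero_le _).trans_lt (hK e)⟩) (bend g e ⟨n, hn.trans_lt (hK e)⟩) := by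
    intro n
    induction n with
    | zero => intro hn; exact SimpleGraph.Reachable.refl _
    | succ n ih =>
      intro hn
      refine (ih (by omega)).trans (SimpleGraph.Adj.reachable ?_)
      rw [← SimpleGraph.mem_edgeSet]
      exact hS _ (by simp) ⟨e, he, _, _, by exact hn, by simp, rfl⟩
  exact (key k hk).symm.trans (key l hl)

end PolyPlan

end Plane

open Plane Plane.PolyPlan Plane.RoutePoint in
/-- Contracting an edge preserves planarity. -/
theorem SimpleGraph.IsPlanar.contract_edge {N : Type*} [Finite N] {D : SimpleGraph N}
    (hD : D.IsPlanar) {x y : N} (hxy : D.Adj x y) (H : SimpleGraph {z // z ≠ y})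
    (hH : ∀ a b, H.Adj a b →
      D.Adj a b ∨ (a.1 = x ∧ D.Adj y b) ∨ (b.1 = x ∧ D.Adj y a)) : H.IsPlanar := by
  classical
  obtain ⟨φ, hφ⟩ := hD
  obtain ⟨Q⟩ := exists_polyPlan φ hφ
  obtain ⟨O⟩ := Q.nonempty_offset
  obtain ⟨K, hK⟩ : ∃ K, ∀ e, Q.len e < K := by
    obtain ⟨K, hK⟩ := Finite.exists_le Q.len
    exact ⟨K + 1, fun e => Nat.lt_succ_of_le (hK e)⟩
  -- Edges created by the contraction are oriented to start at `x`.
  have hends : ∀ g : H.edgeSet, ∃ t : {z // z ≠ y} × {z // z ≠ y},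
      (g : Sym2 {z // z ≠ y}) = s(t.1, t.2) ∧
      (D.Adj t.1 t.2 ∨ (t.1.1 = x ∧ D.Adj y t.2)) := by
    rintro ⟨e, he⟩
    induction e with | _ a b
    rcases hH a b he with h | h | h
    · exact ⟨(a, b), rfl, Or.inl h⟩
    · exact ⟨(a, b), rfl, Or.inr h⟩
    · exact ⟨(b, a), Sym2.eq_swap, Or.inr h⟩
  choose ends hends hdata using hends
  have hne : ∀ g, (ends g).1 ≠ (ends g).2 := by
    intro g h
    have := H.not_isDiag_of_mem_edgeSet g.2
    rw [hends g] at this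
    exact this h
  -- The edges not present in `D`, which have to run along `xy` and then along a second line at `y`.
  let via : H.edgeSet → Prop := fun g => ¬ D.Adj (ends g).1 (ends g).2
  have hvia : ∀ g, via g → (ends g).1.1 = x ∧ D.Adj y (ends g).2 := fun g hg =>
    (hdata g).resolve_left hg
  have hviane : ∀ g, via g → (ends g).2.1 ≠ x := by
    intro g hg h
    exact hne g (Subtype.ext ((hvia g hg).1.trans h.symm))
  let F : H.edgeSet → Set D.edgeSet := fun g =>
    {e | (¬ via g ∧ (e : Sym2 N) = s((ends g).1.1, (ends g).2.1)) ∨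
      (via g ∧ ((e : Sym2 N) = s(x, y) ∨ (e : Sym2 N) = s(y, (ends g).2.1)))}
  let e₀ : D.edgeSet := ⟨s(x, y), hxy⟩
  obtain ⟨k₀, k₀', hk₀⟩ := exists_endAt hK (e := e₀) (x := y) (by simp [e₀])
  set p₀ := Q.p e₀ k₀ with hp₀
  set u₀ := O.u e₀ k₀ with hu₀
  have hu₀ne : u₀ ≠ 0 := hk₀.offset_ne_zero O
  have hu₀dot : dot u₀ (p₀ - Q.center y) = 0 := hk₀.dot_offset O
  -- the slopes at which the other edges are seen
  have hκ : ∀ g, ∃ κ : ℝ, ∀ e : D.edgeSet, ∀ k k', via g → (e : Sym2 N) = s(y, (ends g).2.1) →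
      Q.EndAt e y k k' → κ = dot (Q.p e k - p₀) u₀ / -dot (Q.p e k - p₀) (p₀ - Q.center y) := by
    intro g
    by_cases hg : via g
    · obtain ⟨k, k', hk⟩ := exists_endAt hK (e := ⟨s(y, (ends g).2.1), (hvia g hg).2⟩) (x := y)
        (by simp)
      refine ⟨dot (Q.p ⟨s(y, (ends g).2.1), (hvia g hg).2⟩ k - p₀) u₀ /
        -dot (Q.p ⟨s(y, (ends g).2.1), (hvia g hg).2⟩ k - p₀) (p₀ - Q.center y),
        fun e l l' _ he hl => ?_⟩
      obtain rfl : e = ⟨s(y, (ends g).2.1), (hvia g hg).2⟩ := Subtype.ext he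
      rw [(hk.unique hl).1]
    · exact ⟨0, fun e k k' h => (hg h).elim⟩
  choose κ hκ using hκ
  have hFvia : ∀ g e, e ∈ F g → y ∈ (e : Sym2 N) → via g := by
    intro g e he hy
    by_contra hg
    rcases he with ⟨-, he⟩ | ⟨h, -⟩
    · rw [he, Sym2.mem_iff] at hy
      rcases hy with h | h
      · exact (ends g).1.2 h.symm
      · exact (ends g).2.2 h.symm
    · exact h hg
  have hother : ∀ g, via g → ∀ e : D.edgeSet, (e : Sym2 N) = s(y, (ends g).2.1) → e ≠ e₀ := by
    rintro g hg e he rfl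
    simp only [e₀] at he
    rcases Sym2.eq_iff.1 he with ⟨h1, h2⟩ | ⟨h1, h2⟩
    · exact hxy.ne h1
    · exact hviane g hg h1.symm
  have hsame : ∀ g h, via g → via h → (ends g).2.1 = (ends h).2.1 → g = h := by
    intro g h hg hh e
    apply Subtype.ext
    rw [hends g, hends h, Subtype.ext e,
      Subtype.ext ((hvia g hg).1.trans (hvia h hh).1.symm)]
  have hfar : ∀ e k k', Q.EndAt e y k k' → e ≠ e₀ →
      dot (Q.p e k - p₀) (p₀ - Q.center y) < 0 := by
    intro e k k' hk he
    refine dot_neg_of_mem_closedBall (by rw [hk.dist_eq, hk₀.dist_eq]) ?_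
    exact fun h => he (hk.edge_eq hk₀ h)
  -- Different rerouted edges use different lines at `y`, which end at different points of the
  -- circle and are thus seen from `p₀` at different slopes.
  have hκinj : ∀ g h, via g → via h → g ≠ h → κ g ≠ κ h := by
    intro g h hg hh hgh hκκ
    obtain ⟨k, k', hk⟩ := exists_endAt hK (e := ⟨s(y, (ends g).2.1), (hvia g hg).2⟩) (x := y)
      (by simp)
    obtain ⟨l, l', hl⟩ := exists_endAt hK (e := ⟨s(y, (ends h).2.1), (hvia h hh).2⟩) (x := y)
      (by simp)
    have hg0 := hother g hg ⟨s(y, (ends g).2.1), (hvia g hg).2⟩ rfl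
    have hh0 := hother h hh ⟨s(y, (ends h).2.1), (hvia h hh).2⟩ rfl
    rw [hκ g _ k k' hg rfl hk, hκ h _ l l' hh rfl hl, div_neg, div_neg, neg_inj] at hκκ
    have hpp := eq_of_slope_eq hu₀ne hu₀dot (hk.dist_eq.trans hk₀.dist_eq.symm)
      (hl.dist_eq.trans hk₀.dist_eq.symm) (fun h => hg0 (hk.edge_eq hk₀ h))
      (fun h => hh0 (hl.edge_eq hk₀ h)) hκκ
    have he := congrArg Subtype.val (hk.edge_eq hl hpp)
    simp only at he
    rcases Sym2.eq_iff.1 he with ⟨-, h2⟩ | ⟨h1, -⟩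
    · exact hgh (hsame g h hg hh h2)
    · exact (ends h).2.2 h1.symm
  -- Using the slope as offset orders the strands along `xy` in the order in which their
  -- continuations are seen from `p₀`, so they fan out in the disk of `y` without crossing.
  let σ : H.edgeSet → D.edgeSet → ℝ := fun g _ => κ g
  have hσ : ∀ g h e, g ≠ h → e ∈ F g → e ∈ F h → σ g e ≠ σ h e := by
    intro g h e hgh he he'
    by_cases hy : y ∈ (e : Sym2 N)
    · exact hκinj g h (hFvia g e he hy) (hFvia h e he' hy) hgh
    · exfalso
      rcases he with ⟨-, he⟩ | ⟨-, he | he⟩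
      · rcases he' with ⟨-, he'⟩ | ⟨-, he' | he'⟩
        · apply hgh
          apply Subtype.ext
          rw [hends g, hends h]
          rw [he] at he'
          rcases Sym2.eq_iff.1 he' with ⟨h1, h2⟩ | ⟨h1, h2⟩
          · rw [Subtype.ext h1, Subtype.ext h2]
          · rw [Subtype.ext h1, Subtype.ext h2]
            exact Sym2.eq_swap
        · exact hy (by rw [he']; simp)
        · exact hy (by rw [he']; simp)
      · exact hy (by rw [he]; simp)
      · exact hy (by rw [he]; simp)
  let home : {z // z ≠ y} → N := Subtype.val
  -- the chords in the disk of `y` are disjoint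
  have hfan : ∀ᶠ ε in nhdsWithin (0 : ℝ) (Set.Ioi 0), ∀ g h : H.edgeSet, via g → via h →
      κ g < κ h → ∀ (e f : D.edgeSet) (k l : Fin K) , (e : Sym2 N) = s(y, (ends g).2.1) →
      (f : Sym2 N) = s(y, (ends h).2.1) → (∃ k', Q.EndAt e y k k') → (∃ l', Q.EndAt f y l l') →
      Disjoint
        (segment ℝ (pos O home σ ε (bend g e₀ k₀ : RoutePoint _ _ _ _ K))
          (pos O home σ ε (bend g e k : RoutePoint _ _ _ _ K)))
        (segment ℝ (pos O home σ ε (bend h e₀ k₀ : RoutePoint _ _ _ _ K))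
          (pos O home σ ε (bend h f l : RoutePoint _ _ _ _ K))) := by
    simp only [Filter.eventually_all]
    rintro g h hg hh hlt e f k l he hf ⟨k', hk⟩ ⟨l', hl⟩
    have he0 := hfar e k k' hk (hother g hg e he)
    have hf0 := hfar f l l' hl (hother h hh f hf)
    have ce := continuous_pos O home σ (bend g e k : RoutePoint _ _ _ _ K)
    have cf := continuous_pos O home σ (bend h f l : RoutePoint _ _ _ _ K)
    have ev1 : ∀ᶠ ε in nhdsWithin (0 : ℝ) (Set.Ioi 0),
        dot (pos O home σ ε (bend g e k : RoutePoint _ _ _ _ K) - p₀) (p₀ - Q.center y) < 0 := by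
      apply Filter.Eventually.filter_mono nhdsWithin_le_nhds
      refine ContinuousAt.eventually_lt ?_ continuousAt_const (by rwa [pos_zero_bend])
      unfold dot
      fun_prop
    have ev2 : ∀ᶠ ε in nhdsWithin (0 : ℝ) (Set.Ioi 0),
        dot (pos O home σ ε (bend h f l : RoutePoint _ _ _ _ K) - p₀) (p₀ - Q.center y) < 0 := by
      apply Filter.Eventually.filter_mono nhdsWithin_le_nhds
      refine ContinuousAt.eventually_lt ?_ continuousAt_const (by rwa [pos_zero_bend])
      unfold dot
      fun_prop
    have ev3 : ∀ᶠ ε in nhdsWithin (0 : ℝ) (Set.Ioi 0),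
        dot (pos O home σ ε (bend g e k : RoutePoint _ _ _ _ K) - (p₀ + (ε * κ g) • u₀)) u₀ *
          -dot (pos O home σ ε (bend h f l : RoutePoint _ _ _ _ K) - p₀) (p₀ - Q.center y) <
        dot (pos O home σ ε (bend h f l : RoutePoint _ _ _ _ K) - (p₀ + (ε * κ h) • u₀)) u₀ *
          -dot (pos O home σ ε (bend g e k : RoutePoint _ _ _ _ K) - p₀) (p₀ - Q.center y) := by
      apply Filter.Eventually.filter_mono nhdsWithin_le_nhds
      refine ContinuousAt.eventually_lt ?_ ?_ ?_
      · unfold dot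
        fun_prop
      · unfold dot
        fun_prop
      · rw [pos_zero_bend, pos_zero_bend]
        simp only [zero_mul, zero_smul, add_zero]
        rw [hκ g e k k' hg he hk, hκ h f l l' hh hf hl, div_lt_div_iff₀ (by linarith)
          (by linarith)] at hlt
        exact hlt
    filter_upwards [ev1, ev2, ev3, self_mem_nhdsWithin] with ε h1 h2 h3 hε
    exact disjoint_of_slopes hu₀dot hu₀ne (mul_lt_mul_of_pos_left hlt hε) h1 h2 h3
  obtain ⟨ε, hε, hεfan⟩ := ((eventually_disjoint (K := K) O home F σ hσ).and hfan).exists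
  let W := RoutePoint {z // z ≠ y} H.edgeSet N D.edgeSet K
  -- Hubs are forbidden here: chords go straight from a vertex to a bend, or from bend to bend in
  -- the disk of `y`.
  let S : H.edgeSet → SimpleGraph W := fun g => SimpleGraph.fromEdgeSet
    {s | Q.IsStrip F g s ∨ ∃ z, Q.IsChord home F g z s ∧ (∀ z', hub g z' ∉ s) ∧
      ∀ v, vertex v ∈ s → v ∈ (g : Sym2 {z // z ≠ y})}
  have hS : ∀ g, ∀ s ∈ (S g).edgeSet, Q.IsStrip F g s ∨ ∃ z, Q.IsChord home F g z s ∧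
      (∀ z', hub g z' ∉ s) ∧ ∀ v, vertex v ∈ s → v ∈ (g : Sym2 {z // z ≠ y}) := by
    intro g s hs
    rw [SimpleGraph.edgeSet_fromEdgeSet] at hs
    exact hs.1
  have hSstrip : ∀ g s, ¬ s.IsDiag → Q.IsStrip F g s → s ∈ (S g).edgeSet := by
    intro g s hs h
    rw [SimpleGraph.edgeSet_fromEdgeSet]
    exact ⟨Or.inl h, hs⟩
  have hline : ∀ g, ∀ e ∈ F g, ∀ z z' (k l : Fin K) k' l', Q.EndAt e z k k' → Q.EndAt e z' l l' →
      (S g).Reachable (bend g e k) (bend g e l) := by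
    intro g e he z z' k l k' l' hk hl
    have hle : ∀ {z} {k : Fin K} {k'}, Q.EndAt e z k k' → (k : ℕ) ≤ Q.len e := by
      rintro z k k' (⟨-, h, -⟩ | ⟨-, h, -⟩) <;> omega
    exact reachable_bend hK (hSstrip g) he (hle hk) (hle hl)
  have hvert : ∀ (g : H.edgeSet) (v : {z // z ≠ y}), v ∈ (g : Sym2 {z // z ≠ y}) → ∀ e ∈ F g,
      ∀ (k : Fin K) k', Q.EndAt e v.1 k k' → (S g).Reachable (vertex v) (bend g e k) := by
    intro g v hv e he k k' hk
    apply SimpleGraph.Adj.reachable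
    rw [SimpleGraph.fromEdgeSet_adj]
    refine ⟨Or.inr ⟨v.1, ⟨_, _, by simp, Or.inl ⟨v, rfl, rfl⟩,
      Or.inr (Or.inr ⟨e, he, k, k', hk, rfl⟩), rfl⟩, by simp, ?_⟩, by simp⟩
    intro v' hv'
    have : v' = v := by simpa using hv'
    rwa [this]
  have hreach : ∀ g, (S g).Reachable (vertex (ends g).1) (vertex (ends g).2) := by
    intro g
    have m1 : (ends g).1 ∈ (g : Sym2 {z // z ≠ y}) := by rw [hends g]; simp
    have m2 : (ends g).2 ∈ (g : Sym2 {z // z ≠ y}) := by rw [hends g]; simp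
    by_cases hg : via g
    · have hadj := (hvia g hg).2
      have hx := (hvia g hg).1
      let f : D.edgeSet := ⟨s(y, (ends g).2.1), hadj⟩
      have hf : f ∈ F g := Or.inr ⟨hg, Or.inr rfl⟩
      have he : e₀ ∈ F g := Or.inr ⟨hg, Or.inl rfl⟩
      obtain ⟨k, k', hk⟩ := exists_endAt hK (e := e₀) (x := (ends g).1.1) (by rw [hx]; simp [e₀])
      obtain ⟨l, l', hl⟩ := exists_endAt hK (e := f) (x := y) (by simp [f])
      obtain ⟨m, m', hm⟩ := exists_endAt hK (e := f) (x := (ends g).2.1) (by simp [f])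
      have hmid : (S g).Reachable (bend g e₀ k₀) (bend g f l) := by
        apply SimpleGraph.Adj.reachable
        rw [SimpleGraph.fromEdgeSet_adj]
        have hfe : (bend g e₀ k₀ : W) ≠ bend g f l := fun h =>
          hother g hg f rfl (RoutePoint.bend.inj h).2.1.symm
        exact ⟨Or.inr ⟨y, ⟨_, _, hfe, Or.inr (Or.inr ⟨e₀, he, k₀, k₀', hk₀, rfl⟩),
          Or.inr (Or.inr ⟨f, hf, l, l', hl, rfl⟩), rfl⟩, by simp, by simp⟩, hfe⟩
      exact ((hvert g _ m1 e₀ he k k' hk).trans (hline g e₀ he _ _ k k₀ _ _ hk hk₀)).trans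
        (hmid.trans ((hline g f hf _ _ l m _ _ hl hm).trans (hvert g _ m2 f hf m m' hm).symm))
    · have hadj : D.Adj (ends g).1.1 (ends g).2.1 := by
        by_contra h
        exact hg h
      let f : D.edgeSet := ⟨s((ends g).1.1, (ends g).2.1), hadj⟩
      have hf : f ∈ F g := Or.inl ⟨hg, rfl⟩
      obtain ⟨k, k', hk⟩ := exists_endAt hK (e := f) (x := (ends g).1.1) (by simp [f])
      obtain ⟨m, m', hm⟩ := exists_endAt hK (e := f) (x := (ends g).2.1) (by simp [f])
      exact (hvert g _ m1 f hf k k' hk).trans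
        ((hline g f hf _ _ k m _ _ hk hm).trans (hvert g _ m2 f hf m m' hm).symm)
  choose P hP using fun g => (hreach g).exists_isPath
  -- the points on a route
  have hown : ∀ g, ∀ w ∈ (P g).support, (∃ v ∈ (g : Sym2 {z // z ≠ y}), w = vertex v) ∨
      ∃ e i, w = bend g e i := by
    intro g w hw
    rcases SimpleGraph.Walk.mem_support_iff_exists_mem_edges.1 hw with rfl | ⟨s, hs, hws⟩
    · exact Or.inl ⟨_, by rw [hends g]; simp, rfl⟩
    · rcases hS g s ((P g).edges_subset_edgeSet hs) with ⟨e, he, i, j, -, -, rfl⟩ |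
        ⟨z, ⟨w₁, w₂, -, h1, h2, rfl⟩, h3, h4⟩
      · rcases Sym2.mem_iff.1 hws with rfl | rfl
        · exact Or.inr ⟨_, _, rfl⟩
        · exact Or.inr ⟨_, _, rfl⟩
      · have : Q.At home F g z w := by
          rcases Sym2.mem_iff.1 hws with rfl | rfl
          · exact h1
          · exact h2
        rcases this with ⟨v, rfl, -⟩ | rfl | ⟨e, -, l, -, -, rfl⟩
        · exact Or.inl ⟨v, h4 v hws, rfl⟩
        · exact (h3 _ hws).elim
        · exact Or.inr ⟨_, _, rfl⟩
  have hkind : ∀ g, ∀ s ∈ (P g).edges, Q.IsStrip F g s ∨ ∃ z, Q.IsChord home F g z s := by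
    intro g s hs
    rcases hS g s ((P g).edges_subset_edgeSet hs) with h | ⟨z, h, -⟩
    · exact Or.inl h
    · exact Or.inr ⟨z, h⟩
  have hAt : ∀ g, ∀ s ∈ (P g).edges, ∀ w ∈ s, ∀ z, Q.At home F g z w →
      (∃ v : {z // z ≠ y}, v.1 = z ∧ w = vertex v) ∨
      ∃ e ∈ F g, ∃ k : Fin K, ∃ k', Q.EndAt e z k k' ∧ w = bend g e k := by
    intro g s hs w hw z hz
    rcases hz with ⟨v, h1, h2⟩ | rfl | h
    · exact Or.inl ⟨v, h2, h1⟩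
    · rcases hown g _ ((P g).mem_support_of_mem_edges hs hw) with ⟨v, -, h⟩ | ⟨e, i, h⟩
      · simp at h
      · simp at h
    · exact Or.inr h
  -- Two lines used by one edge meet only at `y`, so a chord joining two bends lies there.
  have hFtwo : ∀ g e f z, e ∈ F g → f ∈ F g → e ≠ f → z ∈ (e : Sym2 N) → z ∈ (f : Sym2 N) →
      z = y ∧ ((e = e₀ ∧ (f : Sym2 N) = s(y, (ends g).2.1)) ∨
        (f = e₀ ∧ (e : Sym2 N) = s(y, (ends g).2.1))) := by
    have key : ∀ g (e f : D.edgeSet) z, via g → (e : Sym2 N) = s(x, y) →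
        (f : Sym2 N) = s(y, (ends g).2.1) → z ∈ (e : Sym2 N) → z ∈ (f : Sym2 N) → z = y := by
      intro g e f z hg he hf hz hz'
      rw [he, Sym2.mem_iff] at hz
      rw [hf, Sym2.mem_iff] at hz'
      rcases hz with rfl | rfl
      · rcases hz' with h | h
        · exact h
        · exact (hviane g hg h.symm).elim
      · rfl
    intro g e f z he hf hef hz hz'
    rcases he with ⟨hg, he⟩ | ⟨hg, he | he⟩ <;> rcases hf with ⟨hg', hf⟩ | ⟨hg', hf | hf⟩
    · exact (hef (Subtype.ext (he.trans hf.symm))).elim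
    · exact (hg hg').elim
    · exact (hg hg').elim
    · exact (hg' hg).elim
    · exact (hef (Subtype.ext (he.trans hf.symm))).elim
    · exact ⟨key g e f z hg he hf hz hz', Or.inl ⟨Subtype.ext he, hf⟩⟩
    · exact (hg' hg).elim
    · exact ⟨key g f e z hg hf he hz' hz, Or.inr ⟨Subtype.ext hf, he⟩⟩
    · exact (hef (Subtype.ext (he.trans hf.symm))).elim
  -- chords away from `y` end at a vertex
  have hchord : ∀ g, ∀ s ∈ (P g).edges, ∀ z, Q.IsChord home F g z s →
      (∃ v : {z // z ≠ y}, v.1 = z ∧ vertex v ∈ s) ∨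
      (z = y ∧ via g ∧ ∃ (f : D.edgeSet) (l : Fin K), (f : Sym2 N) = s(y, (ends g).2.1) ∧
        (∃ l', Q.EndAt f y l l') ∧ s = s(bend g e₀ k₀, bend g f l)) := by
    rintro g s hs z ⟨w, w', hww, hw, hw', rfl⟩
    rcases hAt g _ hs w (by simp) z hw with ⟨v, hv, rfl⟩ | ⟨e, he, k, k', hk, rfl⟩
    · exact Or.inl ⟨v, hv, by simp⟩
    rcases hAt g _ hs w' (by simp) z hw' with ⟨v, hv, rfl⟩ | ⟨f, hf, l, l', hl, rfl⟩
    · exact Or.inl ⟨v, hv, by simp⟩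
    right
    have hef : e ≠ f := by
      rintro rfl
      exact hww (by rw [Fin.ext (hk.unique hl).1])
    obtain ⟨rfl, ⟨rfl, h⟩ | ⟨rfl, h⟩⟩ := hFtwo g e f z he hf hef hk.mem hl.mem
    · refine ⟨rfl, hFvia g _ he hk.mem, f, l, h, ⟨l', hl⟩, ?_⟩
      rw [Fin.ext (hk.unique hk₀).1]
    · refine ⟨rfl, hFvia g _ he hk.mem, e, k, h, ⟨k', hk⟩, ?_⟩
      rw [Fin.ext (hl.unique hk₀).1]
      exact Sym2.eq_swap
  -- Chords in one disk other than that of `y` share its vertex; in the disk of `y` they are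
  -- disjoint by the order of slopes. No pair remains to be counted as a crossing.
  have hall : ∀ g h, ∀ s ∈ (P g).edges, ∀ t ∈ (P h).edges, (∀ w ∈ s, w ∉ t) →
      Disjoint (seg (pos O home σ ε) s) (seg (pos O home σ ε) t) := by
    intro g h s hs t ht hst
    by_cases hno : ∃ z, Q.IsChord home F g z s ∧ Q.IsChord home F h z t
    swap
    · exact hε g h s t hst (hkind g s hs) (hkind h t ht) hno
    obtain ⟨z, h1, h2⟩ := hno
    rcases hchord g s hs z h1 with ⟨v, hv, hvs⟩ | ⟨rfl, hg, e, k, he, hk, rfl⟩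
    · rcases hchord h t ht z h2 with ⟨v', hv', hvt⟩ | ⟨rfl, -⟩
      · obtain rfl : v = v' := Subtype.ext (hv.trans hv'.symm)
        exact (hst _ hvs hvt).elim
      · exact (v.2 hv).elim
    · rcases hchord h t ht z h2 with ⟨v', hv', hvt⟩ | ⟨-, hh, f, l, hf, hl, rfl⟩
      · exact (v'.2 hv').elim
      have hgh : g ≠ h := by
        rintro rfl
        exact hst (bend g e₀ k₀) (by simp) (by simp)
      rcases lt_or_gt_of_ne (hκinj g h hg hh hgh) with hlt | hlt
      · exact hεfan g h hg hh hlt e f k l he hf hk hl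
      · exact (hεfan h g hh hg hlt f e l k hf he hl hk).symm
  have hself : ∀ g v, (vertex v : W) ∈ (P g).support → v ∈ (g : Sym2 {z // z ≠ y}) := by
    intro g v hv
    rcases hown g _ hv with ⟨v', h, h'⟩ | ⟨e, i, h⟩
    · rwa [RoutePoint.vertex.inj h']
    · simp at h
  have hpriv : ∀ g h, g ≠ h → ∀ w, w ∈ (P g).support → w ∈ (P h).support →
      ∃ v, w = vertex v := by
    intro g h hgh w hw hw'
    rcases hown g _ hw with ⟨v', -, rfl⟩ | ⟨e, i, rfl⟩
    · exact ⟨v', rfl⟩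
    · exfalso
      rcases hown h _ hw' with ⟨v', -, h'⟩ | ⟨e, i, h'⟩
      · simp at h'
      · exact hgh (RoutePoint.bend.inj h').1
  obtain ⟨ψ, hψ⟩ := exists_drawing_of_routes H (vertex : _ → W) (fun a b h => by simpa using h) S
    (fun g => (ends g).1) (fun g => (ends g).2) hends P hP hself hpriv (pos O home σ ε)
    (fun g => hall g g)
  refine ⟨ψ, ?_⟩
  rw [← Set.encard_eq_zero, ← nonpos_iff_eq_zero]
  refine hψ.trans ?_
  rw [nonpos_iff_eq_zero, Set.encard_eq_zero, Set.eq_empty_iff_forall_notMem]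
  rintro ⟨s, t⟩ ⟨g, h, -, hs, ht, hst, hnd⟩
  exact hnd (hall g h s hs t ht hst)

/-! ### Subgraphs and contractions of planar graphs -/

namespace SimpleGraph

theorem Drawing.isCompact_arc {N : Type*} {D : SimpleGraph N} (φ : D.Drawing) (e : D.edgeSet) :
    IsCompact (φ.arc e) := by
  obtain ⟨e, he⟩ := e
  induction e with | _ x y
  obtain ⟨γ, -, h⟩ := φ.arc_simple x y he
  rw [← h]
  exact isCompact_range γ.continuous

/-- Two arcs of a plane drawing meet only in common end points. -/
theorem Drawing.exists_of_mem_arc {N : Type*} {D : SimpleGraph N} {φ : D.Drawing}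
    (hφ : φ.crossings = ∅) {e f : D.edgeSet} (hef : e ≠ f) {p : EuclideanSpace ℝ (Fin 2)}
    (he : p ∈ φ.arc e) (hf : p ∈ φ.arc f) :
    ∃ v, p = φ.point v ∧ v ∈ (e : Sym2 N) ∧ v ∈ (f : Sym2 N) := by
  by_contra h
  have : p ∈ φ.crossings := ⟨e, f, hef, he, hf, h⟩
  rw [hφ] at this
  exact this

/-- To give a plane drawing it suffices to give points and arcs that meet only in common end
points. -/
theorem isPlanar_of_arcs {N : Type*} {D : SimpleGraph N} (point : N → Plane)
    (hpoint : Function.Injective point) (arc : D.edgeSet → Set Plane)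
    (harc : ∀ (v w : N) (h : D.Adj v w), Plane.IsArc (point v) (point w) (arc ⟨s(v, w), h⟩))
    (hmem : ∀ (e : D.edgeSet) (v : N), point v ∈ arc e → v ∈ (e : Sym2 N))
    (hcross : ∀ e f : D.edgeSet, e ≠ f → ∀ p, p ∈ arc e → p ∈ arc f → ∃ v, p = point v) :
    D.IsPlanar := by
  refine ⟨⟨point, hpoint, arc, harc, hmem, ?_⟩, ?_⟩
  · rintro e f g hef - - p ⟨⟨he, hf⟩, hg⟩
    obtain ⟨v, rfl⟩ := hcross e f hef p he hf
    exact ⟨v, rfl, hmem e v he, hmem f v hf, hmem g v hg⟩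
  · rw [Set.eq_empty_iff_forall_notMem]
    rintro p ⟨e, f, hef, he, hf, hno⟩
    obtain ⟨v, rfl⟩ := hcross e f hef p he hf
    exact hno ⟨v, rfl, hmem e v he, hmem f v hf⟩

/-- Subgraphs of planar graphs are planar. -/
theorem IsPlanar.of_injective {N N' : Type*} {D : SimpleGraph N} (hD : D.IsPlanar)
    {D' : SimpleGraph N'} (f : N' → N) (hf : Function.Injective f)
    (h : ∀ a b, D'.Adj a b → D.Adj (f a) (f b)) : D'.IsPlanar := by
  obtain ⟨φ, hφ⟩ := hD
  have hmap : ∀ e : D'.edgeSet, (e : Sym2 N').map f ∈ D.edgeSet := by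
    rintro ⟨e, he⟩
    induction e with | _ a b
    exact h a b he
  refine isPlanar_of_arcs (fun a => φ.point (f a)) (φ.point_injective.comp hf)
    (fun e => φ.arc ⟨_, hmap e⟩) ?_ ?_ ?_
  · intro v w hvw
    exact φ.arc_simple _ _ (h v w hvw)
  · intro e v hv
    obtain ⟨v', hv', he⟩ := Sym2.mem_map.1 (φ.mem_of_point_mem_arc _ _ hv)
    rwa [← hf he]
  · intro e e' hee p hp hp'
    have hne : (⟨_, hmap e⟩ : D.edgeSet) ≠ ⟨_, hmap e'⟩ := by
      intro h
      exact hee (Subtype.ext (Sym2.map.injective hf (congrArg Subtype.val h)))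
    obtain ⟨v, rfl, hv, -⟩ := Drawing.exists_of_mem_arc hφ hne hp hp'
    obtain ⟨v', -, rfl⟩ := Sym2.mem_map.1 hv
    exact ⟨v', rfl⟩

/-- Adding isolated vertices preserves planarity. -/
theorem IsPlanar.of_embedding {N N' : Type*} [Finite N] [Finite N'] {D : SimpleGraph N}
    (hD : D.IsPlanar) {D' : SimpleGraph N'} (f : N → N') (hf : Function.Injective f)
    (h : ∀ a b, D'.Adj a b → ∃ x y, f x = a ∧ f y = b ∧ D.Adj x y) : D'.IsPlanar := by
  classical
  obtain ⟨φ, hφ⟩ := hD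
  -- The drawing is compact and the plane is not, so infinitely many points are left for the
  -- isolated vertices.
  let C : Set Plane := (⋃ e, φ.arc e) ∪ Set.range φ.point
  have hC : IsCompact C :=
    (isCompact_iUnion fun e => φ.isCompact_arc e).union (Set.finite_range _).isCompact
  have hinf : (Cᶜ).Infinite := by
    intro hfin
    refine noncompact_univ Plane ?_
    rw [← Set.union_compl_self C]
    exact hC.union hfin.isCompact
  have := hinf.to_subtype
  obtain ⟨num, hnum⟩ := exists_injective_nat N'
  let q : N' → Plane := fun a => (Infinite.natEmbedding (Cᶜ : Set Plane) (num a) : Plane)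
  have hq : Function.Injective q := fun a b hab =>
    hnum ((Infinite.natEmbedding (Cᶜ : Set Plane)).injective (Subtype.ext hab))
  have hqC : ∀ a, q a ∉ C := fun a => (Infinite.natEmbedding (Cᶜ : Set Plane) (num a)).2
  let point : N' → Plane := fun a => if h : ∃ x, f x = a then φ.point h.choose else q a
  have hpoint : ∀ x, point (f x) = φ.point x := by
    intro x
    have hx : ∃ y, f y = f x := ⟨x, rfl⟩
    simp only [point, dif_pos hx]
    rw [hf hx.choose_spec]
  have hpoint' : ∀ a, (¬ ∃ x, f x = a) → point a = q a := fun a ha => by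
    simp only [point, dif_neg ha]
  have hedge : ∀ e : D'.edgeSet, ∃ e' : D.edgeSet, (e' : Sym2 N).map f = e := by
    rintro ⟨e, he⟩
    induction e with | _ a b
    obtain ⟨x, y, rfl, rfl, hxy⟩ := h a b he
    exact ⟨⟨s(x, y), hxy⟩, rfl⟩
  choose ed hed using hedge
  refine isPlanar_of_arcs point ?_ (fun e => φ.arc (ed e)) ?_ ?_ ?_
  · intro a b hab
    by_cases ha : ∃ x, f x = a <;> by_cases hb : ∃ x, f x = b
    · obtain ⟨x, rfl⟩ := ha
      obtain ⟨y, rfl⟩ := hb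
      rw [hpoint, hpoint] at hab
      rw [φ.point_injective hab]
    · obtain ⟨x, rfl⟩ := ha
      rw [hpoint, hpoint' b hb] at hab
      exact (hqC b (hab ▸ Or.inr ⟨x, rfl⟩)).elim
    · obtain ⟨x, rfl⟩ := hb
      rw [hpoint, hpoint' a ha] at hab
      exact (hqC a (hab ▸ Or.inr ⟨x, rfl⟩)).elim
    · rw [hpoint' a ha, hpoint' b hb] at hab
      exact hq hab
  · intro a b hab
    obtain ⟨x, y, rfl, rfl, hxy⟩ := h a b hab
    have he : ed ⟨s(f x, f y), hab⟩ = ⟨s(x, y), hxy⟩ := by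
      apply Subtype.ext
      apply Sym2.map.injective hf
      rw [hed]
      rfl
    rw [he, hpoint, hpoint]
    exact φ.arc_simple x y hxy
  · intro e a ha
    by_cases hx : ∃ x, f x = a
    · obtain ⟨x, rfl⟩ := hx
      rw [hpoint] at ha
      rw [← hed e]
      exact Sym2.mem_map.2 ⟨x, φ.mem_of_point_mem_arc _ _ ha, rfl⟩
    · rw [hpoint' a hx] at ha
      exact (hqC a (Or.inl (Set.mem_iUnion.2 ⟨_, ha⟩))).elim
  · intro e e' hee p hp hp'
    have hne : ed e ≠ ed e' := by
      intro h
      apply hee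
      apply Subtype.ext
      rw [← hed e, ← hed e', h]
    obtain ⟨v, rfl, -⟩ := Drawing.exists_of_mem_arc hφ hne hp hp'
    exact ⟨f v, (hpoint v).symm⟩

/-- Contracting connected sets of vertices preserves planarity. -/
theorem IsPlanar.of_connected_fibers {N' : Type*} [Finite N'] {D' : SimpleGraph N'} (n : ℕ) :
    ∀ {N : Type*} [Finite N] {D : SimpleGraph N} (_ : D.IsPlanar) (f : N → N')
      (_ : Nat.card N = n)
      (_ : ∀ x y, f x = f y → Relation.ReflTransGen (fun u v => D.Adj u v ∧ f u = f v) x y)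
      (_ : ∀ a b, D'.Adj a b → ∃ x y, f x = a ∧ f y = b ∧ D.Adj x y), D'.IsPlanar := by
  classical
  induction n with
  | zero =>
    intro N _ D hD f hn hf h
    have := (Nat.card_eq_zero.1 hn).resolve_right (by simpa using ‹Finite N›)
    exact hD.of_embedding f (fun x => isEmptyElim x) h
  | succ n ih =>
    intro N _ D hD f hn hf h
    by_cases hinj : Function.Injective f
    · exact hD.of_embedding f hinj h
    rw [Function.not_injective_iff] at hinj
    obtain ⟨x, y, hxy, hne⟩ := hinj
    -- A non-injective fibre contains an edge `xz`. Contracting it removes `z` and lets the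
    -- induction on the number of vertices proceed.
    rcases (hf x y hxy).cases_head with h0 | ⟨z, ⟨hxz, hfz⟩, -⟩
    · exact (hne h0).elim
    clear hne hxy y
    let H : SimpleGraph {w // w ≠ z} :=
      { Adj := fun a b => a ≠ b ∧ (D.Adj a b ∨ (a.1 = x ∧ D.Adj z b) ∨ (b.1 = x ∧ D.Adj z a))
        symm := ⟨fun a b hab => ⟨hab.1.symm, by
          rcases hab.2 with h | h | h
          · exact Or.inl h.symm
          · exact Or.inr (Or.inr h)
          · exact Or.inr (Or.inl h)⟩⟩
        loopless := ⟨fun a ha => ha.1 rfl⟩ }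
    have hH : H.IsPlanar := hD.contract_edge hxz H fun a b hab => hab.2
    -- The contraction map sends `z` to `x`; it respects `f` and carries paths inside a fibre to
    -- such paths.
    let r : N → {w // w ≠ z} := fun w => if hw : w = z then ⟨x, hxz.ne⟩ else ⟨w, hw⟩
    have hrz : r z = ⟨x, hxz.ne⟩ := by simp [r]
    have hrw : ∀ w (hw : w ≠ z), r w = ⟨w, hw⟩ := fun w hw => by simp [r, hw]
    have hrf : ∀ w, f (r w).1 = f w := by
      intro w
      by_cases hw : w = z
      · rw [hw, hrz]; exact hfz
      · rw [hrw w hw]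
    have hradj : ∀ u v, D.Adj u v → r u = r v ∨ H.Adj (r u) (r v) := by
      intro u v huv
      by_cases he : r u = r v
      · exact Or.inl he
      refine Or.inr ⟨he, ?_⟩
      by_cases hu : u = z <;> by_cases hv : v = z
      · exact (huv.ne (hu.trans hv.symm)).elim
      · subst hu
        rw [hrz, hrw v hv]
        exact Or.inr (Or.inl ⟨rfl, huv⟩)
      · subst hv
        rw [hrz, hrw u hu]
        exact Or.inr (Or.inr ⟨rfl, huv.symm⟩)
      · rw [hrw u hu, hrw v hv]
        exact Or.inl huv
    refine ih hH (fun w => f w.1) ?_ ?_ ?_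
    · have h1 : Nat.card {w // w ≠ z} + 1 = Nat.card N := by
        have := Set.ncard_add_ncard_compl ({z} : Set N)
        rw [Set.ncard_singleton] at this
        rw [← this, add_comm]
        rfl
      omega
    · intro a b hab
      have key : ∀ {u v}, Relation.ReflTransGen (fun u v => D.Adj u v ∧ f u = f v) u v →
          Relation.ReflTransGen (fun u v : {w // w ≠ z} => H.Adj u v ∧ f u.1 = f v.1)
            (r u) (r v) := by
        intro u v huv
        induction huv with
        | refl => exact Relation.ReflTransGen.refl
        | @tail v w _ hvw ih =>
          rcases hradj v w hvw.1 with h | h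
          · rwa [← h]
          · exact ih.tail ⟨h, by rw [hrf, hrf, hvw.2]⟩
      have := key (hf a.1 b.1 hab)
      rwa [hrw a.1 a.2, hrw b.1 b.2] at this
    · intro a b hab
      obtain ⟨u, v, rfl, rfl, huv⟩ := h a b hab
      refine ⟨r u, r v, hrf u, hrf v, ?_⟩
      rcases hradj u v huv with h | h
      · refine (hab.ne ?_).elim
        rw [← hrf u, ← hrf v, h]
      · exact h

end SimpleGraph

/-! ### Partition into connected pieces of bounded size -/

namespace SimpleGraph

variable {N : Type*} {D : SimpleGraph N}

/-- Adjacency inside a set of vertices. -/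
def AdjIn (D : SimpleGraph N) (C : Set N) (u v : N) : Prop := D.Adj u v ∧ u ∈ C ∧ v ∈ C

/-- A set of vertices is connected (or empty). -/
def ConnIn (D : SimpleGraph N) (C : Set N) : Prop :=
  ∀ x ∈ C, ∀ y ∈ C, Relation.ReflTransGen (D.AdjIn C) x y

theorem AdjIn.symm {C : Set N} {u v : N} (h : D.AdjIn C u v) : D.AdjIn C v u :=
  ⟨h.1.symm, h.2.2, h.2.1⟩

theorem reflTransGen_adjIn_symm {C : Set N} {x y : N} (h : Relation.ReflTransGen (D.AdjIn C) x y) :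
    Relation.ReflTransGen (D.AdjIn C) y x := by
  induction h with
  | refl => exact Relation.ReflTransGen.refl
  | tail _ h ih => exact Relation.ReflTransGen.head h.symm ih

theorem reflTransGen_adjIn_mono {C C' : Set N} (hC : C ⊆ C') {x y : N}
    (h : Relation.ReflTransGen (D.AdjIn C) x y) : Relation.ReflTransGen (D.AdjIn C') x y := by
  induction h with
  | refl => exact Relation.ReflTransGen.refl
  | tail _ h ih => exact ih.tail ⟨h.1, hC h.2.1, hC h.2.2⟩

theorem connIn_of_center {C : Set N} (a : N)
    (h : ∀ x ∈ C, Relation.ReflTransGen (D.AdjIn C) x a) : D.ConnIn C :=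
  fun x hx y hy => (h x hx).trans (reflTransGen_adjIn_symm (h y hy))

/-- The vertices reachable inside a set. -/
def reachIn (D : SimpleGraph N) (C : Set N) (z : N) : Set N :=
  {w | Relation.ReflTransGen (D.AdjIn C) z w}

theorem reachIn_subset {C : Set N} {z : N} (hz : z ∈ C) : D.reachIn C z ⊆ C := by
  intro w hw
  rcases Relation.ReflTransGen.cases_tail hw with rfl | ⟨_, _, h⟩
  · exact hz
  · exact h.2.2

theorem reflTransGen_reachIn {C : Set N} {z w : N} (h : w ∈ D.reachIn C z) :
    Relation.ReflTransGen (D.AdjIn (D.reachIn C z)) z w := by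
  change Relation.ReflTransGen _ _ _ at h
  induction h with
  | refl => exact Relation.ReflTransGen.refl
  | @tail u v hu h ih => exact ih.tail ⟨h.1, hu, hu.tail h⟩

theorem connIn_reachIn {C : Set N} (z : N) : D.ConnIn (D.reachIn C z) :=
  connIn_of_center z fun _ hx => reflTransGen_adjIn_symm (reflTransGen_reachIn hx)

/-- A large connected set of vertices of bounded degree splits into two connected sets, neither of
which is small. -/
theorem ConnIn.exists_split [Finite N] {d M : ℕ} (hM : 0 < M)
    (hd : ∀ x, {y | D.Adj x y}.ncard ≤ d) {C : Set N} (hC : D.ConnIn C)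
    (hcard : 1 + d * (M - 1) + M ≤ C.ncard) :
    ∃ A ⊆ C, D.ConnIn A ∧ D.ConnIn (C \ A) ∧ M ≤ A.ncard ∧ M ≤ (C \ A).ncard := by
  classical
  -- Take a smallest connected `A` with at least `M` vertices and connected complement in `C`; the
  -- set `C` itself is a candidate. It remains to bound `A` from above.
  obtain ⟨A, ⟨hAC, hA, hCA, hMA⟩, hmin⟩ := Set.exists_min_image
    {A : Set N | A ⊆ C ∧ D.ConnIn A ∧ D.ConnIn (C \ A) ∧ M ≤ A.ncard} Set.ncard (Set.toFinite _)
    ⟨C, le_rfl, hC, by simp [ConnIn], by omega⟩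
  refine ⟨A, hAC, hA, hCA, hMA, ?_⟩
  have hAne : A.Nonempty := by
    rw [← Set.ncard_pos]
    omega
  -- A vertex of `A` with a neighbour in `C \ A`; if `C \ A` is empty, any vertex of `A` serves.
  obtain ⟨a, haA, hab⟩ : ∃ a ∈ A, ∀ y ∈ C \ A, ∃ b ∈ C \ A, D.Adj b a := by
    by_cases hne : (C \ A).Nonempty
    · obtain ⟨b, hb⟩ := hne
      obtain ⟨a, ha⟩ := hAne
      have key : ∀ w, Relation.ReflTransGen (D.AdjIn C) a w → w ∉ A →
          ∃ a ∈ A, ∃ b ∈ C \ A, D.Adj b a := by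
        intro w hw
        induction hw with
        | refl => exact fun h => (h ha).elim
        | @tail u v _ h ih =>
          intro hv
          by_cases hu : u ∈ A
          · exact ⟨u, hu, v, ⟨h.2.2, hv⟩, h.1.symm⟩
          · exact ih hu
      obtain ⟨a', ha', b', hb', h⟩ := key b (hC a (hAC ha) b hb.1) hb.2
      exact ⟨a', ha', fun _ _ => ⟨b', hb', h⟩⟩
    · obtain ⟨a, ha⟩ := hAne
      exact ⟨a, ha, fun y hy => (hne ⟨y, hy⟩).elim⟩
  -- each vertex of `A` other than `a` is connected to a neighbour of `a` without using `a`
  have hnb : ∀ z ∈ A \ {a}, ∃ w ∈ D.reachIn (A \ {a}) z, D.Adj a w := by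
    intro z hz
    have key : ∀ w, Relation.ReflTransGen (D.AdjIn A) z w →
        (∃ w' ∈ D.reachIn (A \ {a}) z, D.Adj a w') ∨ w ∈ D.reachIn (A \ {a}) z := by
      intro w hw
      induction hw with
      | refl => exact Or.inr Relation.ReflTransGen.refl
      | @tail u v _ h ih =>
        rcases ih with ih | ih
        · exact Or.inl ih
        · by_cases hv : v = a
          · subst hv
            exact Or.inl ⟨u, ih, h.1.symm⟩
          · refine Or.inr (Relation.ReflTransGen.tail ih ⟨h.1, reachIn_subset hz ih, h.2.2, ?_⟩)
            simpa using hv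
    rcases key a (hA z hz.1 a haA) with h | h
    · exact h
    · exact ((reachIn_subset hz h).2 rfl).elim
  -- Removing a component of `A \ {a}` from `C` leaves a connected set, since everything else is
  -- attached through `a`. A component with `M` vertices would contradict the minimality of `A`.
  have hsmall : ∀ z ∈ A \ {a}, (D.reachIn (A \ {a}) z).ncard ≤ M - 1 := by
    intro z hz
    have hsub := reachIn_subset (D := D) hz
    by_contra hbig
    have hconn : D.ConnIn (C \ D.reachIn (A \ {a}) z) := by
      have haR : a ∈ C \ D.reachIn (A \ {a}) z := ⟨hAC haA, fun h => (hsub h).2 rfl⟩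
      refine connIn_of_center a ?_
      rintro y ⟨hyC, hyR⟩
      by_cases hyA : y ∈ A
      · by_cases hya : y = a
        · rw [hya]
        have hy : y ∈ A \ {a} := ⟨hyA, by simpa using hya⟩
        obtain ⟨w, hw, haw⟩ := hnb y hy
        have hdisj : ∀ w ∈ D.reachIn (A \ {a}) y, w ∈ C \ D.reachIn (A \ {a}) z := by
          intro w hw
          refine ⟨hAC (reachIn_subset hy hw).1, fun hw' => hyR ?_⟩
          exact Relation.ReflTransGen.trans hw' (reflTransGen_adjIn_symm hw)
        exact (reflTransGen_adjIn_mono hdisj (reflTransGen_reachIn hw)).tail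
          ⟨haw.symm, hdisj w hw, haR⟩
      · obtain ⟨b, hb, hba⟩ := hab y ⟨hyC, hyA⟩
        have hdisj : C \ A ⊆ C \ D.reachIn (A \ {a}) z :=
          fun w hw => ⟨hw.1, fun h => hw.2 (hsub h).1⟩
        exact (reflTransGen_adjIn_mono hdisj (hCA y ⟨hyC, hyA⟩ b hb)).tail ⟨hba, hdisj hb, haR⟩
    have hle := hmin (D.reachIn (A \ {a}) z) ⟨fun w hw => hAC (hsub hw).1, connIn_reachIn z, hconn,
      by omega⟩
    have hlt : (D.reachIn (A \ {a}) z).ncard < A.ncard := by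
      exact Set.ncard_lt_ncard ⟨fun w hw => (hsub hw).1, fun h => (hsub (h haA)).2 rfl⟩
        (Set.toFinite _)
    omega
  -- Each component of `A \ {a}` contains a neighbour of `a`, so there are at most `d` of them.
  have hAcard : A.ncard ≤ 1 + d * (M - 1) := by
    have hcover : A ⊆ insert a (⋃ w ∈ ({y | D.Adj a y} ∩ (A \ {a})), D.reachIn (A \ {a}) w) := by
      intro z hz
      by_cases hza : z = a
      · exact Or.inl hza
      · right
        have hz' : z ∈ A \ {a} := ⟨hz, by simpa using hza⟩
        obtain ⟨w, hw, haw⟩ := hnb z hz'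
        simp only [Set.mem_iUnion]
        exact ⟨w, ⟨haw, reachIn_subset hz' hw⟩, reflTransGen_adjIn_symm hw⟩
    have hfin := Set.toFinite ({y | D.Adj a y} ∩ (A \ {a}))
    have h1 : (⋃ w ∈ ({y | D.Adj a y} ∩ (A \ {a})), D.reachIn (A \ {a}) w).ncard ≤ d * (M - 1) := by
      have e1 : (⋃ w ∈ ({y | D.Adj a y} ∩ (A \ {a})), D.reachIn (A \ {a}) w) =
          ((hfin.toFinset.biUnion fun w => (Set.toFinite (D.reachIn (A \ {a}) w)).toFinset :
            Finset N) : Set N) := by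
        ext z
        simp
      rw [e1, Set.ncard_coe_finset]
      refine (Finset.card_biUnion_le_card_mul _ _ (M - 1) ?_).trans ?_
      · intro w hw
        rw [← Set.ncard_eq_toFinset_card]
        exact hsmall w ((Set.Finite.mem_toFinset hfin).1 hw).2
      · refine Nat.mul_le_mul_right _ ?_
        rw [← Set.ncard_eq_toFinset_card]
        exact (Set.ncard_le_ncard Set.inter_subset_left).trans (hd a)
    calc A.ncard ≤ _ := Set.ncard_le_ncard hcover
      _ ≤ _ := Set.ncard_insert_le _ _
      _ ≤ 1 + d * (M - 1) := by omega
  have := Set.ncard_sdiff_add_ncard_of_subset hAC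
  omega

/-- The vertices of a graph of bounded degree can be partitioned into connected sets of bounded
size, each of which is a component unless it is large. -/
theorem exists_connected_partition [Finite N] {d M : ℕ} (hM : 0 < M)
    (hd : ∀ x, {y | D.Adj x y}.ncard ≤ d) :
    ∃ f : N → N, (∀ a, D.ConnIn (f ⁻¹' {a})) ∧
      (∀ a, (f ⁻¹' {a}).ncard ≤ d * (M - 1) + M) ∧
      ∀ a, M ≤ (f ⁻¹' {a}).ncard ∨ ∀ x y, f x = a → D.Adj x y → f y = a := by
  classical
  have hrep : ∀ c : D.ConnectedComponent, ∃ x, D.connectedComponentMk x = c :=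
    fun c => c.exists_rep
  choose rep hrep using hrep
  have hrep_adj : ∀ x y, D.Adj x y →
      rep (D.connectedComponentMk x) = rep (D.connectedComponentMk y) := fun x y h =>
    congrArg rep (SimpleGraph.ConnectedComponent.sound h.reachable)
  -- Among admissible partitions, encoded by labelling maps, take one with the most classes; the
  -- partition into components is admissible. A class above the bound could be split further.
  obtain ⟨f, ⟨hf, hfM⟩, hmax⟩ := Set.exists_max_image
    {f : N → N | (∀ a, D.ConnIn (f ⁻¹' {a})) ∧
      ∀ a, M ≤ (f ⁻¹' {a}).ncard ∨ ∀ x y, f x = a → D.Adj x y → f y = a}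
    (fun f => (Set.range f).ncard) (Set.toFinite _) (by
      refine ⟨fun x => rep (D.connectedComponentMk x), ?_, ?_⟩
      · intro a x hx y hy
        have hxy : D.Reachable x y := by
          have := congrArg D.connectedComponentMk (hx.trans hy.symm)
          simp only [hrep] at this
          exact SimpleGraph.ConnectedComponent.exact this
        obtain ⟨p⟩ := hxy
        induction p with
        | nil => exact Relation.ReflTransGen.refl
        | @cons x z y h p ih =>
          have hz : rep (D.connectedComponentMk z) = a := (hrep_adj x z h).symm.trans hx
          exact Relation.ReflTransGen.head ⟨h, hx, hz⟩ (ih hz hy)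
      · exact fun a => Or.inr fun x y hx hxy => (hrep_adj x y hxy).symm.trans hx)
  refine ⟨f, hf, ?_, hfM⟩
  by_contra hbig
  push Not at hbig
  obtain ⟨a, ha⟩ := hbig
  obtain ⟨A, hAC, hA, hCA, hMA, hMC⟩ := (hf a).exists_split hM hd (by omega)
  -- The oversized class shows that `f` is not injective, so on a finite set some label is free for
  -- the new class.
  have hnotsurj : ¬ Function.Surjective f := by
    intro hs
    have hinj := (Finite.injective_iff_surjective.2 hs)
    have h1 : (f ⁻¹' {a}).ncard ≤ 1 := by
      rw [Set.ncard_le_one]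
      intro x hx y hy
      exact hinj (hx.trans hy.symm)
    have h2 := Set.ncard_sdiff_add_ncard_of_subset hAC
    omega
  rw [Function.Surjective] at hnotsurj
  push Not at hnotsurj
  obtain ⟨b, hb⟩ := hnotsurj
  have hba : b ≠ a := by
    rintro rfl
    have h0 : f ⁻¹' {b} = ∅ := by
      rw [Set.eq_empty_iff_forall_notMem]
      exact fun x hx => hb x hx
    rw [h0, Set.ncard_empty] at ha
    omega
  let f' : N → N := fun x => if x ∈ A then b else f x
  have hfb : f' ⁻¹' {b} = A := by
    ext x
    simp only [f', Set.mem_preimage, Set.mem_singleton_iff]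
    split_ifs with h
    · simp [h]
    · simp [h, hb x]
  have hfa : f' ⁻¹' {a} = f ⁻¹' {a} \ A := by
    ext x
    simp only [f', Set.mem_preimage, Set.mem_singleton_iff, Set.mem_sdiff]
    split_ifs with h
    · simp [h, hba]
    · simp [h]
  have hfc : ∀ c, c ≠ a → c ≠ b → f' ⁻¹' {c} = f ⁻¹' {c} := by
    intro c hca hcb
    ext x
    simp only [f', Set.mem_preimage, Set.mem_singleton_iff]
    split_ifs with h
    · have : f x = a := hAC h
      simp [this, hca.symm, hcb.symm]
    · rfl
  have hconn : ∀ c, D.ConnIn (f' ⁻¹' {c}) := by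
    intro c
    by_cases hcb : c = b
    · rw [hcb, hfb]; exact hA
    by_cases hca : c = a
    · rw [hca, hfa]; exact hCA
    rw [hfc c hca hcb]; exact hf c
  have hlarge : ∀ c, M ≤ (f' ⁻¹' {c}).ncard ∨ ∀ x y, f' x = c → D.Adj x y → f' y = c := by
    intro c
    by_cases hcb : c = b
    · left; rw [hcb, hfb]; exact hMA
    by_cases hca : c = a
    · left; rw [hca, hfa]; exact hMC
    rw [hfc c hca hcb]
    refine (hfM c).imp_right fun h x y hx hxy => ?_
    have hx' : x ∈ f ⁻¹' {c} := by rw [← hfc c hca hcb]; exact hx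
    have : y ∈ f' ⁻¹' {c} := by rw [hfc c hca hcb]; exact h x y hx' hxy
    exact this
  have hlt : (Set.range f).ncard < (Set.range f').ncard := by
    refine Set.ncard_lt_ncard ⟨?_, ?_⟩ (Set.toFinite _)
    · rintro _ ⟨x, rfl⟩
      by_cases hx : f x = a
      · have : (f ⁻¹' {a} \ A).Nonempty := by
          rw [← Set.ncard_pos]
          omega
        obtain ⟨y, hy⟩ := this
        rw [← hfa] at hy
        exact ⟨y, hy.trans hx.symm⟩
      · refine ⟨x, ?_⟩
        have : x ∉ A := fun h => hx (hAC h)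
        simp [f', this]
    · intro h
      have : A.Nonempty := by
        rw [← Set.ncard_pos]
        omega
      obtain ⟨y, hy⟩ := this
      obtain ⟨x, hx⟩ := h (show b ∈ Set.range f' from ⟨y, by simp [f', hy]⟩)
      exact hb x hx
  exact (not_lt.2 (hmax f' ⟨hconn, hlarge⟩)) hlt

end SimpleGraph

/-! ### Compressing a decomposition to one node per vertex -/

namespace SimpleGraph

theorem connIn_of_connected_induce {N : Type*} {D : SimpleGraph N} {C : Set N}
    (h : (D.induce C).Connected) : D.ConnIn C := by
  intro x hx y hy
  obtain ⟨p⟩ := h.preconnected ⟨x, hx⟩ ⟨y, hy⟩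
  have key : ∀ {u v : C} (_ : (D.induce C).Walk u v), Relation.ReflTransGen (D.AdjIn C) u v := by
    intro u v p
    induction p with
    | nil => exact Relation.ReflTransGen.refl
    | @cons u w v h _ ih => exact Relation.ReflTransGen.head ⟨h, u.2, w.2⟩ ih
  exact key p

theorem ConnIn.connected_induce {N : Type*} {D : SimpleGraph N} {C : Set N}
    (h : D.ConnIn C) (hne : C.Nonempty) : (D.induce C).Connected := by
  have := hne.to_subtype
  refine ⟨?_⟩
  rintro ⟨x, hx⟩ ⟨y, hy⟩
  have key : ∀ w, Relation.ReflTransGen (D.AdjIn C) x w →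
      ∃ hw : w ∈ C, (D.induce C).Reachable ⟨x, hx⟩ ⟨w, hw⟩ := by
    intro w hw
    induction hw with
    | refl => exact ⟨hx, Reachable.refl _⟩
    | @tail u v _ huv ih =>
      obtain ⟨hu, ih⟩ := ih
      have hadj : (D.induce C).Adj ⟨u, hu⟩ ⟨v, huv.2.2⟩ := huv.1
      exact ⟨huv.2.2, ih.trans hadj.reachable⟩
  exact (key y (h x hx y hy)).2

namespace Decomposition

variable {V : Type*} {G : SimpleGraph V}

theorem connIn_bag (B : G.Decomposition) (v : V) : B.graph.ConnIn {x | v ∈ B.bag x} :=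
  connIn_of_connected_induce (B.connected v)

theorem card_bag_le (B : G.Decomposition) (x : B.Node) : (B.bag x).card ≤ B.width := by
  let := B.fintypeNode
  exact Finset.le_sup (f := fun x => (B.bag x).card) (Finset.mem_univ x)

theorem width_le (B : G.Decomposition) {k : ℕ} (h : ∀ x, (B.bag x).card ≤ k) : B.width ≤ k := by
  let := B.fintypeNode
  exact Finset.sup_le fun x _ => h x

/-- A planar decomposition of bounded degree, bounded width and linear order can be compressed to
one of bounded width whose order is the number of vertices. -/
theorem exists_compressed [Fintype V] (B : G.Decomposition) (hB : B.Planar) {k d M : ℕ}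
    (hM : 0 < M) (hk : B.width ≤ k) (hd : ∀ x, {y | B.graph.Adj x y}.ncard ≤ d)
    (horder : B.order ≤ M * Fintype.card V) :
    ∃ B' : G.Decomposition, B'.Planar ∧ B'.width ≤ (d * (M - 1) + M) * k + (d * (M - 1) + M) * k ∧
      B'.order = Fintype.card V := by
  classical
  let := B.fintypeNode
  obtain ⟨f, hconn, hcard, hbig⟩ := exists_connected_partition hM hd
  let L : Set B.Node := {a | M ≤ (f ⁻¹' {a}).ncard}
  have hclosed : ∀ x y, f x ∉ L → B.graph.Adj x y → f y = f x := fun x y hx hxy =>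
    (hbig (f x)).resolve_left hx x y rfl hxy
  -- Each large class takes at least `M` of the at most `M * |V|` nodes.
  have hL : Fintype.card L ≤ Fintype.card (Fin (Fintype.card V)) := by
    rw [Fintype.card_fin]
    refine Nat.le_of_mul_le_mul_left (le_trans ?_ horder) hM
    have h1 : Fintype.card B.Node = ∑ a : B.Node, (f ⁻¹' {a}).ncard := by
      rw [← Finset.card_univ,
        Finset.card_eq_sum_card_fiberwise (f := f) (t := Finset.univ) (by simp)]
      refine Finset.sum_congr rfl fun a _ => ?_
      rw [← Set.ncard_coe_finset]
      congr 1
      ext x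
      simp
    have h2 : ∑ a ∈ L.toFinset, M ≤ ∑ a : B.Node, (f ⁻¹' {a}).ncard :=
      (Finset.sum_le_sum fun a ha => show a ∈ L from Set.mem_toFinset.1 ha).trans
        (Finset.sum_le_sum_of_subset (Finset.subset_univ _))
    rw [Finset.sum_const, smul_eq_mul, Set.toFinset_card, mul_comm] at h2
    exact h2.trans h1.symm.le
  obtain ⟨β⟩ := Function.Embedding.nonempty_of_card_le hL
  have hhome : ∀ v, ∃ x, v ∈ B.bag x := fun v => by
    obtain ⟨⟨x, hx⟩⟩ := (B.connected v).nonempty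
    exact ⟨x, hx⟩
  choose home hhome using hhome
  -- Choose one vertex of `G` for each class that contains a home; it will index that class when the
  -- class is small.
  obtain ⟨s, hsc, hs⟩ : ∃ s : V → V, (∀ v, f (home (s v)) = f (home v)) ∧
      ∀ v w, f (home v) = f (home w) → s v = s w := by
    choose g hg using fun a : Set.range (fun v => f (home v)) => a.2
    refine ⟨fun v => g ⟨f (home v), v, rfl⟩, fun v => hg _, fun v w h => ?_⟩
    exact congrArg g (Subtype.ext h)
  -- A small class is closed under adjacency and the nodes of `v` are connected, so a vertex
  -- occurring in a small class occurs nowhere else.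
  have hwalk : ∀ v x y, v ∈ B.bag x → v ∈ B.bag y → f x ∉ L → f y = f x := by
    intro v x y hx hy hxL
    have h := B.connIn_bag v x hx y hy
    induction h with
    | refl => rfl
    | @tail u w _ h ih =>
      have hu := ih h.2.1
      rw [← hu]
      exact hclosed u w (hu ▸ hxL) h.1
  let e := Fintype.equivFin V
  -- An index may carry both a large class, through `β`, and a small one, through `e`; this doubles
  -- the width. Indices not used have empty bags, which makes the order exact.
  let bag : Fin (Fintype.card V) → Finset V := fun i => Finset.univ.filter fun v =>
    (∃ x, v ∈ B.bag x ∧ ∃ h : f x ∈ L, β ⟨f x, h⟩ = i) ∨ (f (home v) ∉ L ∧ e (s v) = i)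
  have hbag : ∀ i v, v ∈ bag i ↔ (∃ x, v ∈ B.bag x ∧ ∃ h : f x ∈ L, β ⟨f x, h⟩ = i) ∨
      (f (home v) ∉ L ∧ e (s v) = i) := fun i v => by simp [bag]
  let D : SimpleGraph (Fin (Fintype.card V)) :=
    { Adj := fun i j => i ≠ j ∧ ∃ x y, B.graph.Adj x y ∧ (∃ h : f x ∈ L, β ⟨f x, h⟩ = i) ∧
        ∃ h : f y ∈ L, β ⟨f y, h⟩ = j
      symm := ⟨fun i j ⟨hij, x, y, hxy, hx, hy⟩ => ⟨hij.symm, y, x, hxy.symm, hy, hx⟩⟩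
      loopless := ⟨fun i h => h.1 rfl⟩ }
  have hconnD : ∀ v, (D.induce {i | v ∈ bag i}).Connected := by
    intro v
    by_cases hv : f (home v) ∈ L
    · refine ConnIn.connected_induce (connIn_of_center (β ⟨f (home v), hv⟩) ?_)
        ⟨β ⟨f (home v), hv⟩, (hbag _ _).2 (Or.inl ⟨home v, hhome v, hv, rfl⟩)⟩
      intro i hi
      rcases (hbag _ _).1 hi with ⟨x, hx, hxL, rfl⟩ | ⟨h, -⟩
      swap
      · exact (h hv).elim
      have h := B.connIn_bag v (home v) (hhome v) x hx
      suffices hsuff : ∃ h : f x ∈ L, Relation.ReflTransGen (D.AdjIn {i | v ∈ bag i})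
          (β ⟨f (home v), hv⟩) (β ⟨f x, h⟩) from reflTransGen_adjIn_symm hsuff.2
      clear hi hxL hx
      induction h with
      | refl => exact ⟨hv, Relation.ReflTransGen.refl⟩
      | @tail u w _ h ih =>
        obtain ⟨huL, ih⟩ := ih
        have hwL : f w ∈ L := by
          by_contra hw
          exact hw (hclosed w u hw h.1.symm ▸ huL)
        refine ⟨hwL, ?_⟩
        by_cases heq : β ⟨f u, huL⟩ = β ⟨f w, hwL⟩
        · rwa [← heq]
        · exact ih.tail ⟨⟨heq, u, w, h.1, ⟨huL, rfl⟩, hwL, rfl⟩,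
            (hbag _ _).2 (Or.inl ⟨u, h.2.1, huL, rfl⟩), (hbag _ _).2 (Or.inl ⟨w, h.2.2, hwL, rfl⟩)⟩
    · refine ConnIn.connected_induce (connIn_of_center (e (s v)) ?_)
        ⟨e (s v), (hbag _ _).2 (Or.inr ⟨hv, rfl⟩)⟩
      intro i hi
      rcases (hbag _ _).1 hi with ⟨x, hx, hxL, rfl⟩ | ⟨-, rfl⟩
      · exact (hv (hwalk v _ _ (hhome v) hx hv ▸ hxL)).elim
      · exact Relation.ReflTransGen.refl
  have htouch : ∀ v w, G.Adj v w → ∃ i j, v ∈ bag i ∧ w ∈ bag j ∧ (i = j ∨ D.Adj i j) := by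
    intro v w hvw
    obtain ⟨x, y, hx, hy, hxy⟩ := B.touch v w hvw
    by_cases hxL : f x ∈ L
    · have hyL : f y ∈ L := by
        rcases hxy with rfl | hxy
        · exact hxL
        · by_contra h
          exact h (hclosed y x h hxy.symm ▸ hxL)
      refine ⟨β ⟨f x, hxL⟩, β ⟨f y, hyL⟩, (hbag _ _).2 (Or.inl ⟨x, hx, hxL, rfl⟩),
        (hbag _ _).2 (Or.inl ⟨y, hy, hyL, rfl⟩), ?_⟩
      by_cases heq : β ⟨f x, hxL⟩ = β ⟨f y, hyL⟩
      · exact Or.inl heq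
      · rcases hxy with rfl | hxy
        · exact Or.inl rfl
        · exact Or.inr ⟨heq, x, y, hxy, ⟨hxL, rfl⟩, hyL, rfl⟩
    · have hyx : f y = f x := by
        rcases hxy with rfl | hxy
        · rfl
        · exact hclosed x y hxL hxy
      have hv := hwalk v x (home v) hx (hhome v) hxL
      have hw := hwalk w y (home w) hy (hhome w) (hyx ▸ hxL)
      have hvw : s v = s w := hs v w (by rw [hv, hw, hyx])
      exact ⟨e (s v), e (s w), (hbag _ _).2 (Or.inr ⟨hv ▸ hxL, rfl⟩),
        (hbag _ _).2 (Or.inr ⟨hw ▸ hyx ▸ hxL, rfl⟩), Or.inl (congrArg e hvw)⟩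
  have hU : ∀ a, ((Finset.univ.filter fun x => f x = a).biUnion B.bag).card ≤
      (d * (M - 1) + M) * k := by
    intro a
    refine (Finset.card_biUnion_le_card_mul _ _ k fun x _ => (B.card_bag_le x).trans hk).trans ?_
    refine Nat.mul_le_mul_right _ ((le_of_eq ?_).trans (hcard a))
    rw [← Set.ncard_coe_finset]
    congr 1
    ext x
    simp
  refine ⟨⟨Fin (Fintype.card V), D, bag, hconnD, htouch⟩, ?_, width_le _ ?_, Fintype.card_fin _⟩
  -- The new graph arises from the subgraph on the large classes by contracting each class, with the
  -- remaining indices as isolated nodes.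
  · have h1 : (B.graph.induce {x | f x ∈ L}).IsPlanar :=
      IsPlanar.of_injective hB Subtype.val Subtype.val_injective fun a b h => h
    refine IsPlanar.of_connected_fibers _ h1 (fun x => β ⟨f x.1, x.2⟩) rfl ?_ ?_
    · rintro ⟨x, hx⟩ ⟨y, hy⟩ hxy
      have hxy' : f x = f y := congrArg Subtype.val (β.injective hxy)
      have h := hconn (f x) x rfl y hxy'.symm
      have key : ∀ w, Relation.ReflTransGen (B.graph.AdjIn (f ⁻¹' {f x})) x w →
          ∃ hw : f w ∈ L, Relation.ReflTransGen
            (fun u v : {x | f x ∈ L} => (B.graph.induce {x | f x ∈ L}).Adj u v ∧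
              β ⟨f u.1, u.2⟩ = β ⟨f v.1, v.2⟩) ⟨x, hx⟩ ⟨w, hw⟩ := by
        intro w hw
        induction hw with
        | refl => exact ⟨hx, Relation.ReflTransGen.refl⟩
        | @tail u w _ h ih =>
          obtain ⟨hu, ih⟩ := ih
          have hwu : f w = f u := Eq.trans h.2.2 (Eq.symm h.2.1)
          refine ⟨by rw [Set.mem_ofPred_eq, hwu]; exact hu, ih.tail ⟨h.1, ?_⟩⟩
          exact congrArg β (Subtype.ext hwu.symm)
      exact (key y h).2
    · rintro a b ⟨-, x, y, hxy, ⟨hx, rfl⟩, hy, rfl⟩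
      exact ⟨⟨x, hx⟩, ⟨y, hy⟩, rfl, rfl, hxy⟩
  · intro i
    have hsub : bag i ⊆ (Finset.univ.filter fun v => ∃ x, v ∈ B.bag x ∧
        ∃ h : f x ∈ L, β ⟨f x, h⟩ = i) ∪
        Finset.univ.filter fun v => f (home v) ∉ L ∧ e (s v) = i := by
      intro v hv
      simpa using (hbag i v).1 hv
    refine (Finset.card_le_card hsub).trans ((Finset.card_union_le _ _).trans (add_le_add ?_ ?_))
    · rcases Finset.eq_empty_or_nonempty (Finset.univ.filter fun v => ∃ x, v ∈ B.bag x ∧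
        ∃ h : f x ∈ L, β ⟨f x, h⟩ = i) with h0 | ⟨v, hv⟩
      · rw [h0]
        exact Nat.zero_le _
      · obtain ⟨x, -, hx, rfl⟩ := (Finset.mem_filter.1 hv).2
        refine le_trans (Finset.card_le_card ?_) (hU (f x))
        intro w hw
        obtain ⟨y, hy, hyL, hyx⟩ := (Finset.mem_filter.1 hw).2
        have := congrArg Subtype.val (β.injective hyx)
        exact Finset.mem_biUnion.2 ⟨y, Finset.mem_filter.2 ⟨Finset.mem_univ _, this⟩, hy⟩
    · rcases Finset.eq_empty_or_nonempty
        (Finset.univ.filter fun v => f (home v) ∉ L ∧ e (s v) = i) with h0 | ⟨v, hv⟩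
      · rw [h0]
        exact Nat.zero_le _
      · obtain ⟨-, rfl⟩ := (Finset.mem_filter.1 hv).2
        refine le_trans (Finset.card_le_card ?_) (hU (f (home v)))
        intro w hw
        obtain ⟨-, hwv⟩ := (Finset.mem_filter.1 hw).2
        have : f (home w) = f (home v) := by rw [← hsc w, ← hsc v, e.injective hwv]
        exact Finset.mem_biUnion.2
          ⟨home w, Finset.mem_filter.2 ⟨Finset.mem_univ _, this⟩, hhome w⟩

end Decomposition

end SimpleGraph

/-! ### Planarization of a drawing -/

namespace SimpleGraph

/-- `s` and `t` are consecutive elements of the set `T` of times. -/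
def ConsecIn (T : Set unitInterval) (s t : unitInterval) : Prop :=
  s ∈ T ∧ t ∈ T ∧ s < t ∧ ∀ r ∈ T, r ≤ s ∨ t ≤ r

theorem ConsecIn.eq_of_mem {T : Set unitInterval} {s t s' t' r : unitInterval}
    (h : ConsecIn T s t) (h' : ConsecIn T s' t') (hr : s < r ∧ r < t) (hr' : s' < r ∧ r < t') :
    s = s' ∧ t = t' := by
  constructor
  · refine le_antisymm ?_ ?_
    · exact (h'.2.2.2 s h.1).resolve_right fun h0 => absurd (hr'.2.trans_le h0) (not_lt.2 hr.1.le)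
    · exact (h.2.2.2 s' h'.1).resolve_right fun h0 => absurd (hr.2.trans_le h0) (not_lt.2 hr'.1.le)
  · refine le_antisymm ?_ ?_
    · exact (h.2.2.2 t' h'.2.1).resolve_left fun h0 => absurd (h0.trans_lt hr.1) (not_lt.2 hr'.2.le)
    · exact (h'.2.2.2 t h.2.1).resolve_left fun h0 => absurd (h0.trans_lt hr'.1) (not_lt.2 hr.2.le)

theorem ConsecIn.right_unique {T : Set unitInterval} {s t t' : unitInterval}
    (h : ConsecIn T s t) (h' : ConsecIn T s t') : t = t' :=
  le_antisymm ((h.2.2.2 t' h'.2.1).resolve_left (not_le.2 h'.2.2.1))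
    ((h'.2.2.2 t h.2.1).resolve_left (not_le.2 h.2.2.1))

theorem ConsecIn.left_unique {T : Set unitInterval} {s s' t : unitInterval}
    (h : ConsecIn T s t) (h' : ConsecIn T s' t) : s = s' :=
  le_antisymm ((h'.2.2.2 s h.1).resolve_right (not_le.2 h.2.2.1))
    ((h.2.2.2 s' h'.1).resolve_right (not_le.2 h'.2.2.1))

theorem exists_consecIn {T : Set unitInterval} (hT : T.Finite) (h0 : 0 ∈ T) {t : unitInterval}
    (ht : t ∈ T) (hpos : 0 < t) : ∃ s, ConsecIn T s t := by
  obtain ⟨s, ⟨hs, hst⟩, hmax⟩ := Set.exists_max_image (T ∩ Set.Iio t) id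
    (hT.subset Set.inter_subset_left) ⟨0, h0, hpos⟩
  refine ⟨s, hs, ht, hst, fun r hr => ?_⟩
  rcases lt_or_ge r t with h | h
  · exact Or.inl (hmax r ⟨hr, h⟩)
  · exact Or.inr h

theorem _root_.Plane.isArc_subpath {a b : Plane} (γ : _root_.Path a b) (hγ : Function.Injective γ)
    {s t : unitInterval} (hst : s < t) : Plane.IsArc (γ s) (γ t) (γ '' Set.Icc s t) := by
  refine ⟨γ.subpath s t, ?_, Path.range_subpath_of_le γ s t hst.le⟩
  intro u v huv
  have h := congrArg Subtype.val (hγ huv)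
  have hst' : (s : ℝ) < t := hst
  simp only [Set.Icc.coe_convexComb] at h
  apply Subtype.ext
  have h2 : ((t : ℝ) - s) * ((u : ℝ) - v) = 0 := by linear_combination h
  rcases mul_eq_zero.1 h2 with h2 | h2 <;> linarith

namespace Drawing

variable {V : Type*} {G : SimpleGraph V}

/-- The vertices and crossings of a drawing. -/
def nodes (φ : G.Drawing) : Set Plane := Set.range φ.point ∪ φ.crossings

theorem mem_nodes_of_mem_arc (φ : G.Drawing) {e f : G.edgeSet} (hef : e ≠ f) {p : Plane}
    (he : p ∈ φ.arc e) (hf : p ∈ φ.arc f) : p ∈ φ.nodes := by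
  by_cases h : ∃ v : V, p = φ.point v ∧ v ∈ (e : Sym2 V) ∧ v ∈ (f : Sym2 V)
  · obtain ⟨v, rfl, -⟩ := h
    exact Or.inl ⟨v, rfl⟩
  · exact Or.inr ⟨e, f, hef, he, hf, h⟩

theorem ncard_edges_le_two [Finite V] (φ : G.Drawing) {p : Plane} (hp : p ∉ Set.range φ.point) :
    {e | p ∈ φ.arc e}.ncard ≤ 2 := by
  by_contra! h
  obtain ⟨a, b, c, ha, hb, hc, hab, hac, hbc⟩ := (Set.two_lt_ncard_iff (Set.toFinite _)).1 h
  obtain ⟨v, rfl, -⟩ := φ.no_three a b c hab hac hbc p ⟨⟨ha, hb⟩, hc⟩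
  exact hp ⟨v, rfl⟩

/-- Parametrizations of the edges of a drawing. -/
structure Param (φ : G.Drawing) where
  tail : G.edgeSet → V
  head : G.edgeSet → V
  edge_eq : ∀ e : G.edgeSet, (e : Sym2 V) = s(tail e, head e)
  path : ∀ e, _root_.Path (φ.point (tail e)) (φ.point (head e))
  path_injective : ∀ e, Function.Injective (path e)
  range_path : ∀ e, Set.range (path e) = φ.arc e

theorem nonempty_param (φ : G.Drawing) : Nonempty φ.Param := by
  have h : ∀ e : G.edgeSet, ∃ (v w : V) (γ : _root_.Path (φ.point v) (φ.point w)),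
      (e : Sym2 V) = s(v, w) ∧ Function.Injective γ ∧ Set.range γ = φ.arc e := by
    rintro ⟨e, he⟩
    induction e with | _ v w
    obtain ⟨γ, h1, h2⟩ := φ.arc_simple v w he
    exact ⟨v, w, γ, rfl, h1, h2⟩
  choose v w γ h1 h2 h3 using h
  exact ⟨⟨v, w, h1, γ, h2, h3⟩⟩

namespace Param

variable {φ : G.Drawing} (P : φ.Param)

/-- The times at which an edge passes through a node. -/
def times (e : G.edgeSet) : Set unitInterval := {t | P.path e t ∈ φ.nodes}

theorem zero_mem_times (e : G.edgeSet) : 0 ∈ P.times e := by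
  refine Or.inl ⟨P.tail e, ?_⟩
  simp

theorem one_mem_times (e : G.edgeSet) : 1 ∈ P.times e := by
  refine Or.inl ⟨P.head e, ?_⟩
  simp

theorem path_mem_arc (e : G.edgeSet) (t : unitInterval) : P.path e t ∈ φ.arc e :=
  P.range_path e ▸ ⟨t, rfl⟩

theorem finite_times (hφ : φ.nodes.Finite) (e : G.edgeSet) : (P.times e).Finite :=
  hφ.preimage (P.path_injective e).injOn

theorem path_notMem_range {e : G.edgeSet} {t : unitInterval} (h0 : t ≠ 0) (h1 : t ≠ 1) :
    P.path e t ∉ Set.range φ.point := by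
  rintro ⟨v, hv⟩
  have h := φ.mem_of_point_mem_arc e v (hv ▸ P.path_mem_arc e t)
  rw [P.edge_eq e, Sym2.mem_iff] at h
  rcases h with rfl | rfl
  · exact h0 (P.path_injective e (hv.symm.trans (P.path e).source.symm))
  · exact h1 (P.path_injective e (hv.symm.trans (P.path e).target.symm))

/-- The planarization of a drawing: consecutive nodes along an edge are adjacent. -/
def planarization : SimpleGraph φ.nodes where
  Adj p q := ∃ e s t, ConsecIn (P.times e) s t ∧
    s((p : Plane), (q : Plane)) = s(P.path e s, P.path e t)
  symm := ⟨fun _ _ ⟨e, s, t, h, h'⟩ => ⟨e, s, t, h, Sym2.eq_swap.trans h'⟩⟩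
  loopless := ⟨fun p ⟨e, s, t, h, h'⟩ => by
    have : P.path e s = P.path e t := by
      rcases Sym2.eq_iff.1 h' with h' | h'
      · exact h'.1.symm.trans h'.2
      · exact h'.2.symm.trans h'.1
    exact h.2.2.1.ne (P.path_injective e this)⟩

/-- Draw each adjacency as the piece of edge between the two consecutive nodes. Pieces of different
edges meet only in nodes by the choice of the nodes, and different pieces of one edge share no inner
times. -/
theorem isPlanar_planarization : P.planarization.IsPlanar := by
  have hedge : ∀ ε : P.planarization.edgeSet, ∃ e s t, ConsecIn (P.times e) s t ∧
      (ε : Sym2 φ.nodes).map Subtype.val = s(P.path e s, P.path e t) := by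
    rintro ⟨ε, hε⟩
    induction ε with | _ p q
    exact hε
  choose e s t hcons hε using hedge
  refine isPlanar_of_arcs Subtype.val Subtype.val_injective
    (fun ε => P.path (e ε) '' Set.Icc (s ε) (t ε)) ?_ ?_ ?_
  · intro p q hpq
    have h := hε ⟨s(p, q), hpq⟩
    have harc := Plane.isArc_subpath (P.path (e ⟨s(p, q), hpq⟩)) (P.path_injective _)
      (hcons ⟨s(p, q), hpq⟩).2.2.1
    rcases Sym2.eq_iff.1 (show s((p : Plane), (q : Plane)) = _ from h) with ⟨h1, h2⟩ | ⟨h1, h2⟩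
    · rw [h1, h2]
      exact harc
    · rw [h1, h2]
      exact harc.symm
  · rintro ε p ⟨r, hr, hrp⟩
    have hrT : r ∈ P.times (e ε) := by
      rw [times, Set.mem_ofPred_eq, hrp]
      exact p.2
    have hp : (p : Plane) ∈ (ε : Sym2 φ.nodes).map Subtype.val := by
      rw [hε ε, Sym2.mem_iff, ← hrp]
      rcases (hcons ε).2.2.2 r hrT with h | h
      · exact Or.inl (congrArg _ (le_antisymm h hr.1))
      · exact Or.inr (congrArg _ (le_antisymm hr.2 h))
    obtain ⟨p', hp', h⟩ := Sym2.mem_map.1 hp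
    rwa [← Subtype.ext h]
  · rintro ε ε' hne p ⟨r, hr, hrp⟩ ⟨r', hr', hrp'⟩
    suffices h : p ∈ φ.nodes from ⟨⟨p, h⟩, rfl⟩
    by_cases hee : e ε = e ε'
    · by_contra hp
      have hr0 : r = r' := by
        have hcast : P.path (e ε') r' = P.path (e ε) r' := by rw [hee]
        exact P.path_injective (e ε) (hrp.trans (hrp'.symm.trans hcast))
      subst hr0
      have hnot : ∀ u ∈ P.times (e ε), u ≠ r := by
        rintro u hu rfl
        exact hp (hrp ▸ hu)
      have h1 := hnot _ (hcons ε).1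
      have h2 := hnot _ (hcons ε).2.1
      have h3 := hnot _ (hee ▸ (hcons ε').1)
      have h4 := hnot _ (hee ▸ (hcons ε').2.1)
      obtain ⟨hs, ht⟩ := (hcons ε).eq_of_mem (hee ▸ hcons ε')
        ⟨lt_of_le_of_ne hr.1 h1, lt_of_le_of_ne hr.2 h2.symm⟩
        ⟨lt_of_le_of_ne hr'.1 h3, lt_of_le_of_ne hr'.2 h4.symm⟩
      apply hne
      apply Subtype.ext
      apply Sym2.map.injective Subtype.val_injective
      rw [hε, hε, hs, ht, hee]
    · exact φ.mem_nodes_of_mem_arc hee (hrp ▸ P.path_mem_arc _ _) (hrp' ▸ P.path_mem_arc _ _)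

/-- At most `Δ` edges pass through a vertex point and at most two through any other node; each
contributes at most a preceding and a following neighbour. -/
theorem ncard_neighbors_le [Finite V] {Δ : ℕ}
    (hΔ : ∀ v, {g : G.edgeSet | v ∈ (g : Sym2 V)}.ncard ≤ Δ) (p : φ.nodes) :
    {q | P.planarization.Adj p q}.ncard ≤ (Δ + 2) * 2 := by
  classical
  have hE : {e | (p : Plane) ∈ φ.arc e}.ncard ≤ Δ + 2 := by
    by_cases hp : (p : Plane) ∈ Set.range φ.point
    · obtain ⟨v, hv⟩ := hp
      refine (Set.ncard_le_ncard ?_ (Set.toFinite _)).trans ((hΔ v).trans (Nat.le_add_right _ _))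
      intro e he
      exact φ.mem_of_point_mem_arc e v (hv ▸ he)
    · exact (φ.ncard_edges_le_two hp).trans (Nat.le_add_left _ _)
  rcases Set.eq_empty_or_nonempty {q | P.planarization.Adj p q} with hempty | ⟨_, e₀, -⟩
  · rw [hempty, Set.ncard_empty]
    exact Nat.zero_le _
  have hq : ∀ q : φ.nodes, ∃ eb : G.edgeSet × Bool, P.planarization.Adj p q →
      (p : Plane) ∈ φ.arc eb.1 ∧ ∃ s t, ConsecIn (P.times eb.1) s t ∧
        if eb.2 then (p : Plane) = P.path eb.1 s ∧ (q : Plane) = P.path eb.1 t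
        else (p : Plane) = P.path eb.1 t ∧ (q : Plane) = P.path eb.1 s := by
    intro q
    by_cases hpq : P.planarization.Adj p q
    · obtain ⟨e, s, t, h, h'⟩ := hpq
      rcases Sym2.eq_iff.1 h' with h' | h'
      · exact ⟨(e, true), fun _ => ⟨h'.1 ▸ P.path_mem_arc _ _, s, t, h, by simpa using h'⟩⟩
      · exact ⟨(e, false), fun _ => ⟨h'.1 ▸ P.path_mem_arc _ _, s, t, h, by simpa using h'⟩⟩
    · exact ⟨(e₀, true), fun h => (hpq h).elim⟩
  choose g hg using hq
  have hle := Set.ncard_le_ncard_of_injOn (s := {q | P.planarization.Adj p q})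
    (t := {e | (p : Plane) ∈ φ.arc e} ×ˢ (Set.univ : Set Bool)) g
    (fun q hq => ⟨(hg q hq).1, Set.mem_univ _⟩) (by
      intro q hq q' hq' hqq
      obtain ⟨-, s, t, hst, h⟩ := hg q hq
      obtain ⟨-, s', t', hst', h'⟩ := hg q' hq'
      rw [← hqq] at hst' h'
      apply Subtype.ext
      cases hb : (g q).2 <;> simp only [hb, if_true, if_false, Bool.false_eq_true] at h h'
      · have : t = t' := P.path_injective _ (h.1.symm.trans h'.1)
        subst this
        rw [h.2, h'.2, hst.left_unique hst']
      · have : s = s' := P.path_injective _ (h.1.symm.trans h'.1)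
        subst this
        rw [h.2, h'.2, hst.right_unique hst']) (Set.toFinite _)
  refine hle.trans ?_
  rw [Set.ncard_prod, Set.ncard_univ, Nat.card_eq_fintype_card, Fintype.card_bool]
  exact Nat.mul_le_mul_right _ hE

end Param

/-- A drawing gives a planar decomposition of width at most two and bounded degree, with a node for
each vertex and each crossing. -/
theorem exists_decomposition [Finite V] (φ : G.Drawing) (hφ : φ.crossings.Finite) {Δ : ℕ}
    (hΔ : ∀ v, {g : G.edgeSet | v ∈ (g : Sym2 V)}.ncard ≤ Δ) :
    ∃ B : G.Decomposition, B.Planar ∧ B.width ≤ 2 ∧ B.order ≤ Nat.card V + φ.crossings.ncard ∧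
      ∀ x, {y | B.graph.Adj x y}.ncard ≤ (Δ + 2) * 2 := by
  classical
  have := Fintype.ofFinite V
  obtain ⟨P⟩ := φ.nonempty_param
  have hfin : φ.nodes.Finite := (Set.finite_range _).union hφ
  let := hfin.fintype
  -- A vertex point carries its own vertex; a crossing carries the tails of the edges through it, at
  -- most two.
  let bag : φ.nodes → Finset V := fun p => Finset.univ.filter fun v =>
    (p : Plane) = φ.point v ∨ ((p : Plane) ∉ Set.range φ.point ∧
      ∃ e, (p : Plane) ∈ φ.arc e ∧ P.tail e = v)
  have hbag : ∀ p v, v ∈ bag p ↔ (p : Plane) = φ.point v ∨ ((p : Plane) ∉ Set.range φ.point ∧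
      ∃ e, (p : Plane) ∈ φ.arc e ∧ P.tail e = v) := fun p v => by simp [bag]
  have htimes : ∀ e t, ∀ ht : t ∈ P.times e, t ≠ 1 → P.tail e ∈ bag ⟨P.path e t, ht⟩ := by
    intro e t ht h1
    rw [hbag]
    by_cases h0 : t = 0
    · left
      simp [h0]
    · exact Or.inr ⟨P.path_notMem_range h0 h1, e, P.path_mem_arc e t, rfl⟩
  -- Walk back along `e` from node to node, by induction on the finite set of times, until its tail
  -- is reached; all these nodes contain the tail.
  have hback : ∀ e t, ∀ ht : t ∈ P.times e, t ≠ 1 →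
      Relation.ReflTransGen (P.planarization.AdjIn {p | P.tail e ∈ bag p}) ⟨P.path e t, ht⟩
        ⟨φ.point (P.tail e), Or.inl ⟨_, rfl⟩⟩ := by
    intro e t ht
    refine ((P.finite_times hfin e).wellFoundedOn (r := (· < ·))).induction ht
      (P := fun t => ∀ ht : t ∈ P.times e, t ≠ 1 →
        Relation.ReflTransGen (P.planarization.AdjIn {p | P.tail e ∈ bag p}) ⟨P.path e t, ht⟩
          ⟨φ.point (P.tail e), Or.inl ⟨_, rfl⟩⟩) ?_ ht
    intro t _ ih ht h1
    rcases eq_or_lt_of_le (unitInterval.nonneg' (t := t)) with rfl | h0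
    · have : (⟨P.path e 0, ht⟩ : φ.nodes) = ⟨φ.point (P.tail e), Or.inl ⟨_, rfl⟩⟩ :=
        Subtype.ext (P.path e).source
      rw [this]
    · obtain ⟨s, hs⟩ := exists_consecIn (P.finite_times hfin e) (P.zero_mem_times e) ht h0
      have hs1 : s ≠ 1 := (hs.2.2.1.trans_le unitInterval.le_one').ne
      exact Relation.ReflTransGen.head
        ⟨⟨e, s, t, hs, Sym2.eq_swap⟩, htimes e t ht h1, htimes e s hs.1 hs1⟩
        (ih s hs.1 hs.2.2.1 hs.1 hs1)
  -- The node before the head still contains the tail, and it is adjacent to the head.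
  have htouch : ∀ e, ∃ x y, P.tail e ∈ bag x ∧ P.head e ∈ bag y ∧ P.planarization.Adj x y := by
    intro e
    obtain ⟨s, hs⟩ := exists_consecIn (P.finite_times hfin e) (P.zero_mem_times e)
      (P.one_mem_times e) zero_lt_one
    refine ⟨⟨P.path e s, hs.1⟩, ⟨P.path e 1, hs.2.1⟩, htimes e s hs.1 hs.2.2.1.ne, ?_,
      e, s, 1, hs, rfl⟩
    rw [hbag]
    left
    simp
  refine ⟨⟨φ.nodes, P.planarization, bag, ?_, ?_⟩, P.isPlanar_planarization,
    Decomposition.width_le _ ?_, ?_, P.ncard_neighbors_le hΔ⟩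
  · intro v
    refine ConnIn.connected_induce
      (connIn_of_center (⟨φ.point v, Or.inl ⟨v, rfl⟩⟩ : φ.nodes) ?_)
      ⟨⟨φ.point v, Or.inl ⟨v, rfl⟩⟩, (hbag _ _).2 (Or.inl rfl)⟩
    rintro ⟨p, hp⟩ hv
    rcases (hbag _ _).1 hv with h | ⟨hpr, e, he, rfl⟩
    · simp only at h
      subst h
      exact Relation.ReflTransGen.refl
    · rw [← P.range_path e] at he
      obtain ⟨t, rfl⟩ := he
      refine hback e t hp ?_
      rintro rfl
      exact hpr ⟨P.head e, (P.path e).target.symm⟩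
  · intro v w hvw
    obtain ⟨x, y, hx, hy, hxy⟩ := htouch ⟨s(v, w), hvw⟩
    rcases Sym2.eq_iff.1 (P.edge_eq ⟨s(v, w), hvw⟩) with ⟨h1, h2⟩ | ⟨h1, h2⟩
    · exact ⟨x, y, h1 ▸ hx, h2 ▸ hy, Or.inr hxy⟩
    · exact ⟨y, x, h1 ▸ hy, h2 ▸ hx, Or.inr hxy.symm⟩
  · intro p
    by_cases hp : (p : Plane) ∈ Set.range φ.point
    · obtain ⟨v, hv⟩ := hp
      refine (Finset.card_le_card (t := {v}) ?_).trans (by simp)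
      intro w hw
      rcases (hbag _ _).1 hw with h | h
      · exact Finset.mem_singleton.2 (φ.point_injective (h.symm.trans hv.symm))
      · exact (h.1 ⟨v, hv⟩).elim
    · refine le_trans ?_ (φ.ncard_edges_le_two hp)
      rw [← Set.ncard_coe_finset]
      refine (Set.ncard_le_ncard (t := P.tail '' {e | (p : Plane) ∈ φ.arc e}) ?_
        (Set.toFinite _)).trans (Set.ncard_image_le (Set.toFinite _))
      intro w hw
      rcases (hbag _ _).1 hw with h | ⟨-, e, he, h⟩
      · exact (hp ⟨w, h.symm⟩).elim
      · exact ⟨e, he, h⟩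
  · have h1 : Fintype.card φ.nodes = φ.nodes.ncard := by
      rw [← Nat.card_eq_fintype_card, Nat.card_coe_set_eq]
    have h2 : (Set.range φ.point).ncard ≤ Nat.card V := by
      rw [← Set.image_univ, ← Set.ncard_univ]
      exact Set.ncard_image_le
    refine le_trans (le_of_eq ?_) ((Set.ncard_union_le _ _).trans (Nat.add_le_add_right h2 _))
    exact h1

end Drawing

end SimpleGraph

/-! ### The equivalence -/

namespace SimpleGraph

/-- The infimum is taken in the well-ordered `ℕ∞`. A linear bound makes it finite, so drawings exist
and one of them attains it. -/
theorem exists_drawing_of_crossingNumber_le {V : Type*} {G : SimpleGraph V} {c : ℝ≥0} {n : ℕ}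
    (h : (G.crossingNumber : ℝ≥0∞) ≤ (c : ℝ≥0∞) * (n : ℝ≥0∞)) :
    ∃ φ : G.Drawing, φ.crossings.Finite ∧ (φ.crossings.ncard : ℝ≥0) ≤ c * n := by
  have hlt : (G.crossingNumber : ℝ≥0∞) < ⊤ :=
    h.trans_lt (ENNReal.mul_lt_top ENNReal.coe_lt_top (ENNReal.natCast_lt_top n))
  have hne : G.crossingNumber ≠ ⊤ := by
    intro h0
    rw [h0] at hlt
    simp at hlt
  have : Nonempty G.Drawing := by
    by_contra hempty
    rw [not_nonempty_iff] at hempty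
    exact hne (iInf_of_empty _)
  obtain ⟨φ, hφ⟩ := ciInf_mem fun φ : G.Drawing => φ.crossings.encard
  have hφ' : φ.crossings.encard = G.crossingNumber := hφ
  have hfin : φ.crossings.Finite := Set.encard_ne_top_iff.1 (hφ' ▸ hne)
  refine ⟨φ, hfin, ?_⟩
  rw [← hφ', ← hfin.cast_ncard_eq, ENat.toENNReal_coe] at h
  exact_mod_cast h

theorem ncard_edges_at_le {V : Type*} [Fintype V] {G : SimpleGraph V} [DecidableRel G.Adj] {Δ : ℕ}
    (hΔ : G.maxDegree ≤ Δ) (v : V) : {g : G.edgeSet | v ∈ (g : Sym2 V)}.ncard ≤ Δ := by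
  classical
  refine le_trans ?_ ((G.degree_le_maxDegree v).trans hΔ)
  rw [← card_incidenceFinset_eq_degree, ← Set.ncard_coe_finset]
  refine Set.ncard_le_ncard_of_injOn Subtype.val ?_ Subtype.val_injective.injOn (Set.toFinite _)
  intro e he
  rw [coe_incidenceFinset]
  exact ⟨e.2, he⟩

theorem Decomposition.crossingNumber_le_of_order_le {V : Type*} [Fintype V] {G : SimpleGraph V}
    [DecidableRel G.Adj] {Δ k : ℕ} (hΔ : G.maxDegree ≤ Δ) (B : G.Decomposition) (hB : B.Planar)
    (hk : B.width ≤ k) {c : ℝ≥0} (horder : (B.order : ℝ≥0) ≤ c * (Fintype.card V : ℝ≥0)) :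
    (G.crossingNumber : ℝ≥0∞) ≤
      ((c * ((k * Δ * 2 : ℕ) : ℝ≥0) ^ 2 : ℝ≥0) : ℝ≥0∞) * (Fintype.card V : ℝ≥0∞) := by
  have h := ENat.toENNReal_le.2 (B.crossingNumber_le hB hk (ncard_edges_at_le hΔ))
  refine h.trans ?_
  rw [ENat.toENNReal_coe]
  have h' : ((B.order * (k * Δ * 2) ^ 2 : ℕ) : ℝ≥0) ≤
      (c * ((k * Δ * 2 : ℕ) : ℝ≥0) ^ 2) * (Fintype.card V : ℝ≥0) := by
    rw [Nat.cast_mul, Nat.cast_pow, mul_right_comm c]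
    exact mul_le_mul_left horder _
  exact_mod_cast h'

end SimpleGraph

/-- For every family of finite graphs of bounded degree, the following are equivalent: linear
crossing number; planar decompositions of bounded width whose order is the number of vertices;
planar decompositions of width (at most) two and linear order. -/
theorem mainTheorem3 {ι : Type*} (V : ι → Type*) [∀ i, Fintype (V i)]
    (G : ∀ i, SimpleGraph (V i)) [∀ i, DecidableRel (G i).Adj]
    (Δ : ℕ) (hΔ : ∀ i, (G i).maxDegree ≤ Δ) :
    List.TFAE [
      ∃ c₁ : ℝ≥0, ∀ i,
        ((G i).crossingNumber : ℝ≥0∞) ≤ (c₁ : ℝ≥0∞) * (Fintype.card (V i) : ℝ≥0∞),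
      ∃ c₂ : ℕ, ∀ i, ∃ D : (G i).Decomposition,
        D.Planar ∧ D.width ≤ c₂ ∧ D.order = Fintype.card (V i),
      ∃ c₃ : ℝ≥0, ∀ i, ∃ D : (G i).Decomposition,
        D.Planar ∧ D.width ≤ 2 ∧ (D.order : ℝ≥0) ≤ c₃ * (Fintype.card (V i) : ℝ≥0)] := by
  tfae_have 1 → 2 := by
    rintro ⟨c₁, h⟩
    -- The bound on class sizes for `M = ⌈c₁⌉₊ + 1` and degree `(Δ + 2) * 2`. This `M` covers one
    -- node per vertex and at most `⌈c₁⌉₊` crossings per vertex; the factor `2` below is the width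
    -- of the planarization's bags.
    let T := (Δ + 2) * 2 * (⌈c₁⌉₊ + 1 - 1) + (⌈c₁⌉₊ + 1)
    refine ⟨T * 2 + T * 2, fun i => ?_⟩
    obtain ⟨φ, hφ, hcr⟩ := SimpleGraph.exists_drawing_of_crossingNumber_le (h i)
    obtain ⟨B, hB, hw, ho, hd⟩ :=
      φ.exists_decomposition hφ (SimpleGraph.ncard_edges_at_le (hΔ i))
    refine B.exists_compressed hB (Nat.succ_pos ⌈c₁⌉₊) hw hd (ho.trans ?_)
    have hcr' : φ.crossings.ncard ≤ ⌈c₁⌉₊ * Fintype.card (V i) := by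
      have := hcr.trans (mul_le_mul_left (Nat.le_ceil c₁) (Fintype.card (V i) : ℝ≥0))
      exact_mod_cast this
    rw [Nat.card_eq_fintype_card, Nat.succ_mul]
    omega
  tfae_have 1 → 3 := by
    rintro ⟨c₁, h⟩
    refine ⟨1 + c₁, fun i => ?_⟩
    obtain ⟨φ, hφ, hcr⟩ := SimpleGraph.exists_drawing_of_crossingNumber_le (h i)
    obtain ⟨B, hB, hw, ho, -⟩ :=
      φ.exists_decomposition hφ (SimpleGraph.ncard_edges_at_le (hΔ i))
    refine ⟨B, hB, hw, ?_⟩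
    rw [Nat.card_eq_fintype_card] at ho
    have ho' : (B.order : ℝ≥0) ≤ Fintype.card (V i) + φ.crossings.ncard := by exact_mod_cast ho
    rw [add_mul, one_mul]
    exact ho'.trans (add_le_add_right hcr _)
  tfae_have 2 → 1 := by
    rintro ⟨c₂, h⟩
    refine ⟨1 * ((c₂ * Δ * 2 : ℕ) : ℝ≥0) ^ 2, fun i => ?_⟩
    obtain ⟨B, hB, hw, ho⟩ := h i
    exact B.crossingNumber_le_of_order_le (hΔ i) hB hw (c := 1) (by rw [ho, one_mul])
  tfae_have 3 → 1 := by
    rintro ⟨c₃, h⟩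
    refine ⟨c₃ * ((2 * Δ * 2 : ℕ) : ℝ≥0) ^ 2, fun i => ?_⟩
    obtain ⟨B, hB, hw, ho⟩ := h i
    exact B.crossingNumber_le_of_order_le (hΔ i) hB hw ho
  tfae_finish
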